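/- For a finite simple graph $G=(V,E)$ let $B\in\{0,1\}^{V\times E}$ be its vertex-edge incidence matrix, let $M(G)=\begin{bmatrix} I & B\\ B^{\intercal} & I\end{bmatrix}$, and let $\Delta(G)$ be the maximum of $|\det M'|$ over all square submatrices $M'$ of $M(G)$. A *total matching* of $G$ is a set $S\cup F$ with $S\subseteq V$ a stable set, $F\subseteq E$ a matching, and no vertex of $S$ an endpoint of an edge of $F$. Given weights $w:V\cup E\to\mathbb{R}$, its weight is $\sum_{v\in S}w(v)+\sum_{e\in F}w(e)$. **Theorem.** There are an algorithm and absolute constants $C,c$ such that for every $\Delta\in\mathbb{Z}_{\ge 1}$, every nonempty finite simple graph $G=(V,E)$ with $\Delta(G)\le\Delta$ and all real weights $w$ on $V\cup E$, the algorithm finds a total matching of $G$ of maximum weight in time at most $$C\cdot 2^{\,c\,\Delta\log\Delta}\,(|V|+|E|).$$ Here $G$ is given by $|V|$, $|E|$ and the list of its edges (in any order and orientation) together with the weights, and the output marks the chosen vertices and edges. Time is the number of instructions and tests executed by a program on a random access machine with finitely many integer and real registers and arrays (initially zero apart from the input), where integers may be copied, added, subtracted (with negative results replaced by $0$), compared and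 used as array addresses, weights may only be copied, added, subtracted and compared, and all integers that occur are at most $C(|V|+|E|)$. -/

import Mathlib

/-! ### Total matchings -/

namespace SimpleGraph

/-- The vertex set `S` and the edge set `F` together form a total matching of `G`: `S` is a stable
set, `F` is a matching, and no vertex of `S` is an endpoint of an edge of `F`. -/
structure IsTotalMatching {V : Type*} (G : SimpleGraph V) (S : Finset V)
    (F : Finset (Sym2 V)) : Prop where
  edges : ∀ e ∈ F, e ∈ G.edgeSet
  stable : ∀ u ∈ S, ∀ v ∈ S, ¬ G.Adj u v
  matching : ∀ e ∈ F, ∀ f ∈ F, e ≠ f → ∀ v, ¬ (v ∈ e ∧ v ∈ f)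
  nonincident : ∀ v ∈ S, ∀ e ∈ F, v ∉ e

/-- The total weight of the vertices in `S` and the edges in `F`. -/
def totalWeight {V : Type*} (wV : V → ℝ) (wE : Sym2 V → ℝ) (S : Finset V)
    (F : Finset (Sym2 V)) : ℝ :=
  ∑ v ∈ S, wV v + ∑ e ∈ F, wE e

/-- `S ∪ F` is a total matching of `G` whose weight is maximum among all total matchings. -/
def IsMaxWeightTotalMatching {V : Type*} (G : SimpleGraph V) (wV : V → ℝ) (wE : Sym2 V → ℝ)
    (S : Finset V) (F : Finset (Sym2 V)) : Prop :=
  G.IsTotalMatching S F ∧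
    ∀ S' F', G.IsTotalMatching S' F' → totalWeight wV wE S' F' ≤ totalWeight wV wE S F

/-! ### The constraint matrix and its maximum subdeterminant -/

open Classical in
/-- The vertex-edge incidence matrix, with one column per edge of `G`. -/
noncomputable def vertexEdgeMatrix {V : Type*} (G : SimpleGraph V) : Matrix V G.edgeSet ℤ :=
  Matrix.of fun v e => if v ∈ (e : Sym2 V) then 1 else 0

open Classical in
/-- The constraint matrix `[I B; Bᵀ I]` of the total matching integer program. -/
noncomputable def totalMatchingMatrix {V : Type*} (G : SimpleGraph V) :
    Matrix (V ⊕ G.edgeSet) (V ⊕ G.edgeSet) ℤ :=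
  Matrix.fromBlocks 1 G.vertexEdgeMatrix G.vertexEdgeMatrix.transpose 1

/-- The absolute values of the determinants of all square submatrices of the constraint matrix. -/
def subdets {V : Type*} (G : SimpleGraph V) : Set ℕ :=
  {d | ∃ (k : ℕ) (f g : Fin k ↪ V ⊕ G.edgeSet),
    d = (G.totalMatchingMatrix.submatrix f g).det.natAbs}

/-- The maximum subdeterminant of the constraint matrix of `G`. -/
noncomputable def maxSubdet {V : Type*} (G : SimpleGraph V) : ℕ :=
  sSup G.subdets

/-- For a finite graph, the supremum in `maxSubdet` is a maximum. -/
theorem isGreatest_maxSubdet {V : Type*} [Finite V] (G : SimpleGraph V) :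
    IsGreatest G.subdets G.maxSubdet := by
  classical
  have : Fintype V := Fintype.ofFinite V
  have hfin : G.subdets.Finite := by
    refine (Set.finite_range
      (fun p : Σ k : Fin (Fintype.card (V ⊕ G.edgeSet) + 1),
          (Fin k ↪ V ⊕ G.edgeSet) × (Fin k ↪ V ⊕ G.edgeSet) =>
        (G.totalMatchingMatrix.submatrix p.2.1 p.2.2).det.natAbs)).subset ?_
    rintro d ⟨k, f, g, rfl⟩
    have hk := Fintype.card_le_of_embedding f
    rw [Fintype.card_fin] at hk
    exact ⟨⟨⟨k, Nat.lt_succ_of_le hk⟩, f, g⟩, rfl⟩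
  have hne : G.subdets.Nonempty :=
    ⟨_, 0, Function.Embedding.ofIsEmpty, Function.Embedding.ofIsEmpty, rfl⟩
  exact ⟨Nat.sSup_mem hne hfin.bddAbove, fun d hd => le_csSup hfin.bddAbove hd⟩

end SimpleGraph

/-! ### A random access machine with real weights

A program is a finite text built from elementary instructions, conditionals and loops. It works on
integer registers, real registers, integer arrays and real arrays, all named by constants of the
program, so that a program uses finitely many of them. Array cells are addressed by the contents of
integer registers. The only operations on real numbers are addition, subtraction, copying and
comparison. Every executed instruction and every evaluated test costs one unit of time. -/

namespace RealRAM

/-- A memory configuration. -/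
structure State where
  /-- integer registers -/
  ireg : ℕ → ℕ
  /-- integer arrays: `iarr a i` is cell `i` of array `a` -/
  iarr : ℕ → ℕ → ℕ
  /-- real registers -/
  rreg : ℕ → ℝ
  /-- real arrays -/
  rarr : ℕ → ℕ → ℝ

/-- Elementary instructions. -/
inductive Instr where
  /-- does nothing -/
  | skip
  /-- `ireg x := c` -/
  | const (x c : ℕ)
  /-- `ireg x := ireg y` -/
  | copy (x y : ℕ)
  /-- `ireg x := ireg y + ireg z` -/
  | add (x y z : ℕ)
  /-- `ireg x := max 0 (ireg y - ireg z)` -/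
  | sub (x y z : ℕ)
  /-- `ireg x := iarr a [ireg y]` -/
  | load (x a y : ℕ)
  /-- `iarr a [ireg x] := ireg y` -/
  | store (a x y : ℕ)
  /-- `rreg x := rreg y` -/
  | rcopy (x y : ℕ)
  /-- `rreg x := rreg y + rreg z` -/
  | radd (x y z : ℕ)
  /-- `rreg x := rreg y - rreg z` -/
  | rsub (x y z : ℕ)
  /-- `rreg x := rarr a [ireg y]` -/
  | rload (x a y : ℕ)
  /-- `rarr a [ireg x] := rreg y` -/
  | rstore (a x y : ℕ)

/-- The memory configuration after one elementary instruction. -/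
noncomputable def Instr.eval : Instr → State → State
  | .skip, σ => σ
  | .const x c, σ => { σ with ireg := Function.update σ.ireg x c }
  | .copy x y, σ => { σ with ireg := Function.update σ.ireg x (σ.ireg y) }
  | .add x y z, σ => { σ with ireg := Function.update σ.ireg x (σ.ireg y + σ.ireg z) }
  | .sub x y z, σ => { σ with ireg := Function.update σ.ireg x (σ.ireg y - σ.ireg z) }
  | .load x a y, σ => { σ with ireg := Function.update σ.ireg x (σ.iarr a (σ.ireg y)) }
  | .store a x y, σ =>
    { σ with iarr := Function.update σ.iarr a (Function.update (σ.iarr a) (σ.ireg x) (σ.ireg y)) }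
  | .rcopy x y, σ => { σ with rreg := Function.update σ.rreg x (σ.rreg y) }
  | .radd x y z, σ => { σ with rreg := Function.update σ.rreg x (σ.rreg y + σ.rreg z) }
  | .rsub x y z, σ => { σ with rreg := Function.update σ.rreg x (σ.rreg y - σ.rreg z) }
  | .rload x a y, σ => { σ with rreg := Function.update σ.rreg x (σ.rarr a (σ.ireg y)) }
  | .rstore a x y, σ =>
    { σ with rarr := Function.update σ.rarr a (Function.update (σ.rarr a) (σ.ireg x) (σ.rreg y)) }

/-- Tests on integer registers and on real registers. -/
inductive Test where
  | ieq (x y : ℕ)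
  | ine (x y : ℕ)
  | ilt (x y : ℕ)
  | ile (x y : ℕ)
  | rlt (x y : ℕ)
  | rle (x y : ℕ)

/-- The test succeeds in the given memory configuration. -/
def Test.Holds : Test → State → Prop
  | .ieq x y, σ => σ.ireg x = σ.ireg y
  | .ine x y, σ => σ.ireg x ≠ σ.ireg y
  | .ilt x y, σ => σ.ireg x < σ.ireg y
  | .ile x y, σ => σ.ireg x ≤ σ.ireg y
  | .rlt x y, σ => σ.rreg x < σ.rreg y
  | .rle x y, σ => σ.rreg x ≤ σ.rreg y

/-- Programs. -/
inductive Program where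
  | instr (i : Instr)
  | seq (p q : Program)
  | ite (b : Test) (p q : Program)
  | loop (b : Test) (p : Program)

/-- Every integer in the memory is at most `W`. -/
def State.Fits (W : ℕ) (σ : State) : Prop :=
  (∀ x, σ.ireg x ≤ W) ∧ ∀ a i, σ.iarr a i ≤ W

/-- `Exec W p σ t τ`: started in `σ`, the program `p` halts in `τ` after exactly `t` units of time,
and no integer greater than `W` occurs in the memory after any instruction. A loop
`loop b p` repeats `p` as long as the test `b` succeeds. -/
inductive Exec (W : ℕ) : Program → State → ℕ → State → Prop where
  | instr {i : Instr} {σ : State} (h : (i.eval σ).Fits W) :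
      Exec W (.instr i) σ 1 (i.eval σ)
  | seq {p q : Program} {σ τ υ : State} {s t : ℕ} (hp : Exec W p σ s τ) (hq : Exec W q τ t υ) :
      Exec W (.seq p q) σ (s + t) υ
  | ite_true {b : Test} {p q : Program} {σ τ : State} {t : ℕ} (hb : b.Holds σ)
      (hp : Exec W p σ t τ) : Exec W (.ite b p q) σ (1 + t) τ
  | ite_false {b : Test} {p q : Program} {σ τ : State} {t : ℕ} (hb : ¬ b.Holds σ)
      (hq : Exec W q σ t τ) : Exec W (.ite b p q) σ (1 + t) τ
  | loop_true {b : Test} {p : Program} {σ τ υ : State} {s t : ℕ} (hb : b.Holds σ)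
      (hp : Exec W p σ s τ) (hl : Exec W (.loop b p) τ t υ) :
      Exec W (.loop b p) σ (1 + s + t) υ
  | loop_false {b : Test} {p : Program} {σ : State} (hb : ¬ b.Holds σ) :
      Exec W (.loop b p) σ 1 σ

end RealRAM

/-! ### Input and output -/

namespace TotalMatchingIO

/-- `ends` lists the edges of `G` as pairs of endpoints, every edge exactly once, in any order and
in any orientation. In particular `m` is the number of edges of `G`. -/
def IsEdgeList {n m : ℕ} (G : SimpleGraph (Fin n)) (ends : Fin m → Fin n × Fin n) : Prop :=
  Function.Injective (fun j => s((ends j).1, (ends j).2)) ∧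
    Set.range (fun j => s((ends j).1, (ends j).2)) = G.edgeSet

/-- The initial memory: integer registers `0` and `1` hold the numbers of vertices and edges, the
integer arrays `0` and `1` hold the first and the second endpoints of the listed edges, the real
arrays `0` and `1` hold the weights of the vertices and of the listed edges. Everything else
is zero. -/
noncomputable def input {n m : ℕ} (ends : Fin m → Fin n × Fin n) (wV : Fin n → ℝ)
    (wE : Sym2 (Fin n) → ℝ) : RealRAM.State where
  ireg x := if x = 0 then n else if x = 1 then m else 0
  iarr a i := if h : i < m then
      (if a = 0 then ((ends ⟨i, h⟩).1 : ℕ) else if a = 1 then ((ends ⟨i, h⟩).2 : ℕ) else 0)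
    else 0
  rreg _ := 0
  rarr a i :=
    if a = 0 then (if h : i < n then wV ⟨i, h⟩ else 0)
    else if a = 1 then (if h : i < m then wE s((ends ⟨i, h⟩).1, (ends ⟨i, h⟩).2) else 0)
    else 0

/-- The vertices in the output: those whose cell in integer array `2` contains `1`. -/
def outVertices (n : ℕ) (τ : RealRAM.State) : Finset (Fin n) :=
  Finset.univ.filter fun v => τ.iarr 2 v = 1

/-- The edges in the output: those whose cell in integer array `3` contains `1`. -/
def outEdges {n m : ℕ} (ends : Fin m → Fin n × Fin n) (τ : RealRAM.State) :
    Finset (Sym2 (Fin n)) :=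
  (Finset.univ.filter fun j : Fin m => τ.iarr 3 j = 1).image fun j => s((ends j).1, (ends j).2)

end TotalMatchingIO

/-! The bound on subdeterminants enters only through vertex degrees. For a stable set `I`, the rows
and columns belonging to `I` and to all edges form a submatrix whose determinant is, by a Schur
complement, that of the identity minus the Gram matrix of the incidence rows of `I`. No edge meets
`I` twice, so this matrix is diagonal and the determinant is the product of the factors 1 - deg v
(`prod_degree_sub_one_le_maxSubdet`). A single vertex gives deg v ≤ Δ + 1. A largest stable set
among the vertices of degree at least three, the branching vertices, dominates them, and comparing a
sum with a product shows that there are at most 2Δ of them (`card_branching_le`).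

A total matching is an independent set for a conflict relation on vertices and edges
(`indep_elements`). It contains at most one element of every star, a star being a vertex with its
incident edges. So at each branching vertex there are deg + 2 options: the vertex, one of its edges,
or nothing. This makes at most (Δ + 3) ^ (2Δ) selections, which are enumerated by a mixed radix
counter. In the components of the branching vertices, what remains outside their stars is a disjoint
union of paths. If a path is listed as vertex, edge, vertex and so on, two of its elements conflict
exactly when their positions differ by at most two; two dummies of weight zero keep different paths
apart. The best completion of a selection is thus a heaviest set of unblocked positions at pairwise
distance at least three, which the linear recursion `lin` computes. `PathSeq.indep_union` shows that
completions are feasible, `exists_digits_sum_le` that some selection is as good as any given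
independent set.

A component without branching vertices is a path or a cycle. There an arbitrary vertex plays the
role of the only branching vertex, with at most four options. Components do not interact
(`MaxIndep.union`).

For linear time, arrays are cleared only where the current group touches them, and walks are paid
for by the vertices they visit. Programs are verified in a Hoare logic with time: `Runs` is total
correctness, `Frame` records what a program leaves untouched, and loops carry a potential that pays
for their rounds. -/

namespace RealRAM

/-! ### Written registers and arrays -/

/-- Integer registers written by an instruction. -/
def Instr.iw : Instr → List ℕ
  | .const x _ => [x]
  | .copy x _ => [x]
  | .add x _ _ => [x]
  | .sub x _ _ => [x]
  | .load x _ _ => [x]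
  | _ => []

/-- Integer arrays written by an instruction. -/
def Instr.aw : Instr → List ℕ
  | .store a _ _ => [a]
  | _ => []

/-- Real registers written by an instruction. -/
def Instr.rw : Instr → List ℕ
  | .rcopy x _ => [x]
  | .radd x _ _ => [x]
  | .rsub x _ _ => [x]
  | .rload x _ _ => [x]
  | _ => []

/-- Real arrays written by an instruction. -/
def Instr.raw : Instr → List ℕ
  | .rstore a _ _ => [a]
  | _ => []

namespace Program

/-- All locations of one kind written by a program. -/
def collect (f : Instr → List ℕ) : Program → List ℕ
  | .instr i => f i
  | .seq p q => p.collect f ++ q.collect f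
  | .ite _ p q => p.collect f ++ q.collect f
  | .loop _ p => p.collect f

/-- Integer registers written by a program. -/
abbrev iw (p : Program) : List ℕ := p.collect Instr.iw
/-- Integer arrays written by a program. -/
abbrev aw (p : Program) : List ℕ := p.collect Instr.aw
/-- Real registers written by a program. -/
abbrev rw (p : Program) : List ℕ := p.collect Instr.rw
/-- Real arrays written by a program. -/
abbrev raw (p : Program) : List ℕ := p.collect Instr.raw

/-- Running time bound of loop-free programs. -/
def cost : Program → ℕ
  | .instr _ => 1
  | .seq p q => p.cost + q.cost
  | .ite _ p q => 1 + max p.cost q.cost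
  | .loop _ _ => 1

end Program

/-- `τ` agrees with `σ` on everything that `p` does not write. -/
structure Frame (p : Program) (σ τ : State) : Prop where
  ireg : ∀ x, x ∉ p.iw → τ.ireg x = σ.ireg x
  iarr : ∀ a, a ∉ p.aw → τ.iarr a = σ.iarr a
  rreg : ∀ x, x ∉ p.rw → τ.rreg x = σ.rreg x
  rarr : ∀ a, a ∉ p.raw → τ.rarr a = σ.rarr a

theorem Frame.refl (p : Program) (σ : State) : Frame p σ σ :=
  ⟨fun _ _ => rfl, fun _ _ => rfl, fun _ _ => rfl, fun _ _ => rfl⟩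

theorem Frame.trans {p : Program} {σ τ υ : State} (h : Frame p σ τ) (h' : Frame p τ υ) :
    Frame p σ υ :=
  ⟨fun x hx => (h'.ireg x hx).trans (h.ireg x hx), fun x hx => (h'.iarr x hx).trans (h.iarr x hx),
    fun x hx => (h'.rreg x hx).trans (h.rreg x hx), fun x hx => (h'.rarr x hx).trans (h.rarr x hx)⟩

theorem Frame.mono {p q : Program} {σ τ : State} (h : Frame p σ τ)
    (hi : p.iw ⊆ q.iw) (ha : p.aw ⊆ q.aw) (hr : p.rw ⊆ q.rw) (hra : p.raw ⊆ q.raw) :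
    Frame q σ τ :=
  ⟨fun x hx => h.ireg x fun hh => hx (hi hh), fun x hx => h.iarr x fun hh => hx (ha hh),
    fun x hx => h.rreg x fun hh => hx (hr hh), fun x hx => h.rarr x fun hh => hx (hra hh)⟩

theorem Frame.instr (i : Instr) (σ : State) : Frame (.instr i) σ (i.eval σ) := by
  constructor <;> intro x hx <;> cases i <;>
    simp_all [Instr.eval, Program.collect, Instr.iw, Instr.aw, Instr.rw, Instr.raw]

theorem Frame.seq {p q : Program} {σ τ υ : State} (h : Frame p σ τ) (h' : Frame q τ υ) :
    Frame (.seq p q) σ υ :=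
  (h.mono (q := .seq p q) (by simp [Program.collect]) (by simp [Program.collect])
    (by simp [Program.collect]) (by simp [Program.collect])).trans
  (h'.mono (by simp [Program.collect]) (by simp [Program.collect])
    (by simp [Program.collect]) (by simp [Program.collect]))

/-- The footprint is read off the program text and bounds the effect of every execution, however
often loops run. Whether a location survives a concrete program becomes membership in an explicit
list, which `decide` settles. -/
theorem Exec.frame {W : ℕ} {p : Program} {σ τ : State} {t : ℕ} (h : Exec W p σ t τ) :
    Frame p σ τ := by
  induction h with
  | instr _ => exact Frame.instr _ _
  | seq _ _ h1 h2 => exact h1.seq h2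
  | ite_true _ _ h =>
    exact h.mono (by simp [Program.collect]) (by simp [Program.collect])
      (by simp [Program.collect]) (by simp [Program.collect])
  | ite_false _ _ h =>
    exact h.mono (by simp [Program.collect]) (by simp [Program.collect])
      (by simp [Program.collect]) (by simp [Program.collect])
  | loop_true _ _ _ h1 h2 =>
    exact (h1.mono (by simp [Program.collect]) (by simp [Program.collect])
      (by simp [Program.collect]) (by simp [Program.collect])).trans h2
  | loop_false _ => exact Frame.refl _ _

theorem Exec.fits {W : ℕ} {p : Program} {σ τ : State} {t : ℕ} (h : Exec W p σ t τ)
    (hσ : σ.Fits W) : τ.Fits W := by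
  induction h with
  | instr h => exact h
  | seq _ _ h1 h2 => exact h2 (h1 hσ)
  | ite_true _ _ h => exact h hσ
  | ite_false _ _ h => exact h hσ
  | loop_true _ _ _ h1 h2 => exact h2 (h1 hσ)
  | loop_false _ => exact hσ

/-- The values produced by the instruction are at most `W`. -/
def Instr.Safe (W : ℕ) : Instr → State → Prop
  | .const _ c, _ => c ≤ W
  | .add _ y z, σ => σ.ireg y + σ.ireg z ≤ W
  | _, _ => True

/-- Only constants and sums can exceed the values already in memory: copies, loads and stores reuse
values, and truncated subtraction never increases its first argument. -/
theorem State.Fits.eval {W : ℕ} {i : Instr} {σ : State} (hσ : σ.Fits W) (hi : i.Safe W σ) :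
    (i.eval σ).Fits W := by
  obtain ⟨h1, h2⟩ := hσ
  cases i <;> refine ⟨fun x => ?_, fun a j => ?_⟩ <;>
    simp only [Instr.eval, Instr.Safe, Function.update_apply] at hi ⊢ <;>
    first
      | exact h1 _
      | exact h2 _ _
      | (split_ifs <;> first | exact h1 _ | exact h2 _ _ | exact hi | exact (Nat.sub_le _ _).trans (h1 _)
                             | (simp only [Function.update_apply]; split_ifs <;> first | exact h1 _ | exact h2 _ _))

/-! ### Total correctness with time -/

/-- Started in a memory that fits, `p` halts, and its running time and final memory satisfy `Q`. -/
def Runs (W : ℕ) (p : Program) (σ : State) (Q : ℕ → State → Prop) : Prop :=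
  σ.Fits W → ∃ t τ, Exec W p σ t τ ∧ Q t τ

variable {W : ℕ} {p q : Program} {b : Test} {σ : State} {Q Q' : ℕ → State → Prop}

theorem Runs.of_fits (h : σ.Fits W → Runs W p σ Q) : Runs W p σ Q := fun hσ => h hσ hσ

theorem Runs.mono (h : Runs W p σ Q)
    (hQ : ∀ t τ, Frame p σ τ → τ.Fits W → Q t τ → Q' t τ) : Runs W p σ Q' := fun hσ => by
  obtain ⟨t, τ, he, hq⟩ := h hσ
  exact ⟨t, τ, he, hQ t τ he.frame (he.fits hσ) hq⟩

theorem Runs.seq {R : ℕ → State → Prop} (h : Runs W p σ R)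
    (hQ : ∀ s τ, Frame p σ τ → τ.Fits W → R s τ → Runs W q τ fun t υ => Q (s + t) υ) :
    Runs W (.seq p q) σ Q := fun hσ => by
  obtain ⟨s, τ, he, hr⟩ := h hσ
  obtain ⟨t, υ, he', hq⟩ := hQ s τ he.frame (he.fits hσ) hr (he.fits hσ)
  exact ⟨_, υ, he.seq he', hq⟩

theorem Runs.ite (h1 : b.Holds σ → Runs W p σ fun t τ => Q (1 + t) τ)
    (h2 : ¬ b.Holds σ → Runs W q σ fun t τ => Q (1 + t) τ) : Runs W (.ite b p q) σ Q := fun hσ => by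
  by_cases hb : b.Holds σ
  · obtain ⟨t, τ, he, hq⟩ := h1 hb hσ
    exact ⟨_, τ, .ite_true hb he, hq⟩
  · obtain ⟨t, τ, he, hq⟩ := h2 hb hσ
    exact ⟨_, τ, .ite_false hb he, hq⟩

theorem Runs.instr {i : Instr} (hi : i.Safe W σ) (hQ : Q 1 (i.eval σ)) : Runs W (.instr i) σ Q :=
  fun hσ => ⟨1, _, .instr (hσ.eval hi), hQ⟩

/-- The loop rule: `Inv k` is the invariant with potential `k`, which pays for the iterations. -/
theorem Runs.loop {Inv : ℕ → State → Prop} (k : ℕ) (h0 : Inv k σ)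
    (hstep : ∀ k τ, Frame p σ τ → τ.Fits W → Inv k τ → b.Holds τ →
      Runs W p τ fun s υ => ∃ k', Inv k' υ ∧ s + 1 + k' ≤ k) :
    Runs W (.loop b p) σ fun t τ => ∃ k', Inv k' τ ∧ ¬ b.Holds τ ∧ t + k' ≤ k + 1 := by
  intro hσ
  have key : ∀ k τ, Frame p σ τ → τ.Fits W → Inv k τ →
      ∃ t υ, Exec W (.loop b p) τ t υ ∧ ∃ k', Inv k' υ ∧ ¬ b.Holds υ ∧ t + k' ≤ k + 1 := by
    intro k
    induction k using Nat.strong_induction_on with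
    | _ k ih =>
      intro τ hfr hfit hinv
      by_cases hb : b.Holds τ
      -- The test itself costs one unit, so the potential drops strictly in every round; this forces
      -- termination.
      · obtain ⟨s, υ, he, k', hk', hle⟩ := hstep k τ hfr hfit hinv hb hfit
        obtain ⟨t, ω, he', k'', h1, h2, h3⟩ :=
          ih k' (by omega) υ (hfr.trans he.frame) (he.fits hfit) hk'
        exact ⟨_, ω, .loop_true hb he he', k'', h1, h2, by omega⟩
      · exact ⟨1, τ, .loop_false hb, k, hinv, hb, by omega⟩
  exact key k σ (Frame.refl _ _) hσ h0

/-- Weakest precondition of loop-free programs. -/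
def wp (W : ℕ) : Program → (State → Prop) → State → Prop
  | .instr i, Q, σ => i.Safe W σ ∧ Q (i.eval σ)
  | .seq p q, Q, σ => wp W p (wp W q Q) σ
  | .ite b p q, Q, σ => (b.Holds σ → wp W p Q σ) ∧ (¬ b.Holds σ → wp W q Q σ)
  | .loop _ _, _, _ => False

/-- The time of a loop-free program is bounded by its shape alone, so only the final memory has to
be computed, by unfolding `wp`. -/
theorem Runs.of_wp {Q : State → Prop} (h : wp W p Q σ) :
    Runs W p σ fun t τ => t ≤ p.cost ∧ Q τ := by
  induction p generalizing σ Q with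
  | instr i => exact Runs.instr h.1 ⟨le_rfl, h.2⟩
  | seq p q ihp ihq =>
    exact (ihp h).seq fun s τ _ _ hr => (ihq hr.2).mono fun t υ _ _ hq =>
      ⟨Nat.add_le_add hr.1 hq.1, hq.2⟩
  | ite b p q ihp ihq =>
    refine Runs.ite (fun hb => (ihp (h.1 hb)).mono fun t τ _ _ hq => ⟨?_, hq.2⟩)
      (fun hb => (ihq (h.2 hb)).mono fun t τ _ _ hq => ⟨?_, hq.2⟩)
    · have := hq.1; simp only [Program.cost]; omega
    · have := hq.1; simp only [Program.cost]; omega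
  | loop b p => exact h.elim

theorem Runs.seq_wp {R : State → Prop} (h : wp W p R σ)
    (hQ : ∀ s τ, s ≤ p.cost → Frame p σ τ → τ.Fits W → R τ → Runs W q τ fun t υ => Q (s + t) υ) :
    Runs W (.seq p q) σ Q :=
  (Runs.of_wp h).seq fun s τ h1 h2 hr => hQ s τ hr.1 h1 h2 hr.2

end RealRAM

namespace RealRAM

local infixr:60 " ⨾ " => Program.seq

/-! ### Counting loops and linked lists

Register `2` holds `0` and register `3` holds `1`. Array `4` holds the heads of linked lists and
array `5` the successors. -/

/-- The memory after assigning to an integer register. -/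
def State.setI (σ : State) (i x : ℕ) : State := { σ with ireg := Function.update σ.ireg i x }

/-- Executes `body` with register `i` running from `0` to the content of `lim`. -/
def forUp (i lim : ℕ) (body : Program) : Program :=
  .instr (.const i 0) ⨾ .loop (.ilt i lim) (body ⨾ .instr (.add i i 3))

/-- Executes `body` with register `arc` running through the linked list of register `x`. -/
def forArcs (arc x : ℕ) (body : Program) : Program :=
  .instr (.load arc 4 x) ⨾ .loop (.ine arc 2) (body ⨾ .instr (.load arc 5 arc))

variable {W : ℕ} {σ : State} {body : Program}

theorem Frame.body_forUp {i lim : ℕ} {σ τ : State} (h : Frame body σ τ) :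
    Frame (forUp i lim body) σ τ :=
  h.mono (by simp [forUp, Program.collect]) (by simp [forUp, Program.collect])
    (by simp [forUp, Program.collect]) (by simp [forUp, Program.collect])

theorem Frame.setI_forUp {i lim : ℕ} {σ : State} (x : ℕ) :
    Frame (forUp i lim body) σ (σ.setI i x) := by
  constructor <;> intro y hy <;>
    simp_all [forUp, Program.collect, State.setI, Instr.iw]

theorem Frame.body_forArcs {i x : ℕ} {σ τ : State} (h : Frame body σ τ) :
    Frame (forArcs i x body) σ τ :=
  h.mono (by simp [forArcs, Program.collect]) (by simp [forArcs, Program.collect])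
    (by simp [forArcs, Program.collect]) (by simp [forArcs, Program.collect])

theorem Frame.setI_forArcs {i y : ℕ} {σ : State} (x : ℕ) :
    Frame (forArcs i y body) σ (σ.setI i x) := by
  constructor <;> intro z hz <;>
    simp_all [forArcs, Program.collect, State.setI, Instr.iw]

/-- Rule for counting loops; `Inv k T` is the invariant after `k` rounds in which the bodies took
time `T`. -/
theorem Runs.forUp_time {i lim L : ℕ} (Inv : ℕ → ℕ → State → Prop)
    (hone : σ.ireg 3 = 1) (hlim : σ.ireg lim = L)
    (hne : i ≠ 3 ∧ i ≠ lim ∧ i ∉ body.iw ∧ lim ∉ body.iw ∧ 3 ∉ body.iw)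
    (hins : ∀ k T τ x, Inv k T τ → Inv k T (τ.setI i x)) (h0 : Inv 0 0 σ)
    (hstep : ∀ k T τ, k < L → Frame (forUp i lim body) σ τ → τ.Fits W → τ.ireg i = k → Inv k T τ →
      Runs W body τ fun s υ => Inv (k + 1) (T + s) υ) :
    Runs W (forUp i lim body) σ fun t τ => ∃ T, t ≤ T + 2 * L + 2 ∧ Inv L T τ := by
  obtain ⟨n1, n2, n3, n4, n5⟩ := hne
  -- Induction on the number `r` of rounds left. A round pays two units beyond its body, for the
  -- test and the increment, and the failing test pays one; the initial assignment completes `2 * L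
  -- + 2`.
  have key : ∀ r k T τ, k + r = L → Frame (forUp i lim body) σ τ → τ.Fits W → τ.ireg i = k →
      Inv k T τ → ∃ t υ, Exec W (.loop (.ilt i lim) (body ⨾ .instr (.add i i 3))) τ t υ ∧
        ∃ T', T + t ≤ T' + 2 * r + 1 ∧ Inv L T' υ := by
    intro r
    induction r with
    | zero =>
      intro k T τ hk hfr hfit hi hinv
      refine ⟨1, τ, .loop_false ?_, T, by omega, ?_⟩
      · have := hfr.ireg lim (by simp [forUp, Program.collect, Instr.iw]; tauto)
        simp only [Test.Holds]; omega
      · rwa [← hk]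
    | succ r ih =>
      intro k T τ hk hfr hfit hi hinv
      have hlim' : τ.ireg lim = L :=
        (hfr.ireg lim (by simp [forUp, Program.collect, Instr.iw]; tauto)).trans hlim
      have hone' : τ.ireg 3 = 1 :=
        (hfr.ireg 3 (by simp [forUp, Program.collect, Instr.iw]; tauto)).trans hone
      obtain ⟨s, υ, he, hυ⟩ := hstep k T τ (by omega) hfr hfit hi hinv hfit
      have hυi : υ.ireg i = k := (he.frame.ireg i n3).trans hi
      have hυ1 : υ.ireg 3 = 1 := (he.frame.ireg 3 n5).trans hone'
      have hset : (Instr.add i i 3).eval υ = υ.setI i (k + 1) := by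
        simp [Instr.eval, State.setI, hυi, hυ1]
      -- The incremented counter is at most the limit, which already sits in a register.
      have hsafe : (Instr.add i i 3).Safe W υ := by
        have := hfit.1 lim
        simp only [Instr.Safe]; omega
      have hfit2 := (he.fits hfit).eval hsafe
      rw [hset] at hfit2
      have hfr2 : Frame (forUp i lim body) σ (υ.setI i (k + 1)) :=
        (hfr.trans he.frame.body_forUp).trans (Frame.setI_forUp _)
      obtain ⟨t, ω, he', T', hT, hω⟩ := ih (k + 1) (T + s) (υ.setI i (k + 1)) (by omega) hfr2 hfit2
        (by simp [State.setI]) (hins _ _ _ _ hυ)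
      rw [← hset] at he' hfit2
      refine ⟨_, ω, .loop_true ?_ (.seq he (.instr hfit2)) he', T', ?_, hω⟩
      · simp only [Test.Holds]; omega
      · omega
  have hset : (Instr.const i 0).eval σ = σ.setI i 0 := rfl
  refine Runs.seq (R := fun s τ => s = 1 ∧ τ = σ.setI i 0) ?_ ?_
  · exact Runs.instr (by simp [Instr.Safe]) ⟨rfl, rfl⟩
  · rintro _ _ hfr hfit ⟨rfl, rfl⟩ _
    obtain ⟨t, υ, he, T', hT, hυ⟩ := key L 0 0 (σ.setI i 0) (by omega) (Frame.setI_forUp _) hfit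
      (by simp [State.setI]) (hins _ _ _ _ h0)
    exact ⟨t, υ, he, T', by omega, hυ⟩

/-- Rule for counting loops whose body takes time at most `B`. -/
theorem Runs.forUp {i lim L : ℕ} (B : ℕ) (Inv : ℕ → State → Prop)
    (hone : σ.ireg 3 = 1) (hlim : σ.ireg lim = L)
    (hne : i ≠ 3 ∧ i ≠ lim ∧ i ∉ body.iw ∧ lim ∉ body.iw ∧ 3 ∉ body.iw)
    (hins : ∀ k τ x, Inv k τ → Inv k (τ.setI i x)) (h0 : Inv 0 σ)
    (hstep : ∀ k τ, k < L → Frame (forUp i lim body) σ τ → τ.Fits W → τ.ireg i = k → Inv k τ →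
      Runs W body τ fun s υ => s ≤ B ∧ Inv (k + 1) υ) :
    Runs W (forUp i lim body) σ fun t τ => t ≤ (B + 2) * L + 2 ∧ Inv L τ := by
  refine (Runs.forUp_time (fun k T τ => T ≤ B * k ∧ Inv k τ) hone hlim hne
    (fun k T τ x h => ⟨h.1, hins _ _ _ h.2⟩) ⟨by simp, h0⟩ ?_).mono ?_
  · intro k T τ hk hfr hfit hi hinv
    refine (hstep k τ hk hfr hfit hi hinv.2).mono fun s υ _ _ h => ⟨?_, h.2⟩
    have := hinv.1
    have := h.1
    rw [Nat.mul_succ]; omega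
  · rintro t τ _ _ ⟨T, h1, h2, h3⟩
    refine ⟨?_, h3⟩
    rw [Nat.add_mul]; omega

/-- Rule for loops through the linked list `l`. -/
theorem Runs.forArcs_time {arc x : ℕ} {l : List ℕ} (Inv : List ℕ → ℕ → State → Prop)
    (hzero : σ.ireg 2 = 0) (hhead : σ.iarr 4 (σ.ireg x) = l.headD 0)
    (hnext : ∀ l1 p l2, l = l1 ++ p :: l2 → p ≠ 0 ∧ σ.iarr 5 p = l2.headD 0)
    (hne : arc ≠ 2 ∧ arc ∉ body.iw ∧ 2 ∉ body.iw ∧ 5 ∉ body.aw)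
    (hins : ∀ k T τ x, Inv k T τ → Inv k T (τ.setI arc x)) (h0 : Inv [] 0 σ)
    (hstep : ∀ l1 p l2 T τ, l = l1 ++ p :: l2 → Frame (forArcs arc x body) σ τ → τ.Fits W →
      τ.ireg arc = p → Inv l1 T τ → Runs W body τ fun s υ => Inv (l1 ++ [p]) (T + s) υ) :
    Runs W (forArcs arc x body) σ fun t τ => ∃ T, t ≤ T + 2 * l.length + 2 ∧ Inv l T τ := by
  obtain ⟨n1, n2, n3, n4⟩ := hne
  have key : ∀ l2 l1 T τ, l = l1 ++ l2 → Frame (forArcs arc x body) σ τ → τ.Fits W →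
      τ.ireg arc = l2.headD 0 → Inv l1 T τ →
      ∃ t υ, Exec W (.loop (.ine arc 2) (body ⨾ .instr (.load arc 5 arc))) τ t υ ∧
        ∃ T', T + t ≤ T' + 2 * l2.length + 1 ∧ Inv l T' υ := by
    intro l2
    induction l2 with
    | nil =>
      intro l1 T τ hl hfr hfit hi hinv
      have hz : τ.ireg 2 = 0 :=
        (hfr.ireg 2 (by simp [forArcs, Program.collect, Instr.iw]; tauto)).trans hzero
      refine ⟨1, τ, .loop_false ?_, T, by simp, ?_⟩
      -- The end of a list is encoded by `0`; by `hnext` no entry of `l` is `0`.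
      · simp only [Test.Holds, hz]; simpa using hi
      · rw [hl]; simpa using hinv
    | cons p l2 ih =>
      intro l1 T τ hl hfr hfit hi hinv
      have hz : τ.ireg 2 = 0 :=
        (hfr.ireg 2 (by simp [forArcs, Program.collect, Instr.iw]; tauto)).trans hzero
      have h5 : τ.iarr 5 = σ.iarr 5 :=
        hfr.iarr 5 (by simp [forArcs, Program.collect, Instr.aw]; tauto)
      obtain ⟨hp, hnx⟩ := hnext l1 p l2 hl
      have hi' : τ.ireg arc = p := by simpa using hi
      obtain ⟨s, υ, he, hυ⟩ := hstep l1 p l2 T τ hl hfr hfit hi' hinv hfit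
      have hυi : υ.ireg arc = p := (he.frame.ireg arc n2).trans hi'
      have hυ5 : υ.iarr 5 = σ.iarr 5 := (he.frame.iarr 5 n4).trans h5
      have hset : (Instr.load arc 5 arc).eval υ = υ.setI arc (l2.headD 0) := by
        simp [Instr.eval, State.setI, hυi, hυ5, hnx]
      have hfit2 := (he.fits hfit).eval (i := .load arc 5 arc) trivial
      rw [hset] at hfit2
      have hfr2 : Frame (forArcs arc x body) σ (υ.setI arc (l2.headD 0)) :=
        (hfr.trans he.frame.body_forArcs).trans (Frame.setI_forArcs _)
      obtain ⟨t, ω, he', T', hT, hω⟩ := ih (l1 ++ [p]) (T + s) (υ.setI arc (l2.headD 0))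
        (by simp [hl]) hfr2 hfit2 (by simp [State.setI]) (hins _ _ _ _ hυ)
      rw [← hset] at he' hfit2
      refine ⟨_, ω, .loop_true ?_ (.seq he (.instr hfit2)) he', T', ?_, hω⟩
      · simp only [Test.Holds]; omega
      · simp only [List.length_cons]; omega
  refine Runs.seq (R := fun s τ => s = 1 ∧ τ = σ.setI arc (l.headD 0)) ?_ ?_
  · exact Runs.instr (by simp [Instr.Safe]) ⟨rfl, by simp [Instr.eval, State.setI, hhead]⟩
  · rintro _ _ hfr hfit ⟨rfl, rfl⟩ _
    obtain ⟨t, υ, he, T', hT, hυ⟩ := key l [] 0 (σ.setI arc (l.headD 0)) (by simp)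
      (Frame.setI_forArcs _) hfit (by simp [State.setI]) (hins _ _ _ _ h0)
    exact ⟨t, υ, he, T', by omega, hυ⟩

/-- Rule for loops through the linked list `l` whose body takes time at most `B`. -/
theorem Runs.forArcs {arc x : ℕ} {l : List ℕ} (B : ℕ) (Inv : List ℕ → State → Prop)
    (hzero : σ.ireg 2 = 0) (hhead : σ.iarr 4 (σ.ireg x) = l.headD 0)
    (hnext : ∀ l1 p l2, l = l1 ++ p :: l2 → p ≠ 0 ∧ σ.iarr 5 p = l2.headD 0)
    (hne : arc ≠ 2 ∧ arc ∉ body.iw ∧ 2 ∉ body.iw ∧ 5 ∉ body.aw)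
    (hins : ∀ k τ x, Inv k τ → Inv k (τ.setI arc x)) (h0 : Inv [] σ)
    (hstep : ∀ l1 p l2 τ, l = l1 ++ p :: l2 → Frame (forArcs arc x body) σ τ → τ.Fits W →
      τ.ireg arc = p → Inv l1 τ → Runs W body τ fun s υ => s ≤ B ∧ Inv (l1 ++ [p]) υ) :
    Runs W (forArcs arc x body) σ fun t τ => t ≤ (B + 2) * l.length + 2 ∧ Inv l τ := by
  refine (Runs.forArcs_time (fun k T τ => T ≤ B * k.length ∧ Inv k τ) hzero hhead hnext hne
    (fun k T τ x h => ⟨h.1, hins _ _ _ h.2⟩) ⟨by simp, h0⟩ ?_).mono ?_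
  · intro l1 p l2 T τ hl hfr hfit hi hinv
    refine (hstep l1 p l2 τ hl hfr hfit hi hinv.2).mono fun s υ _ _ h => ⟨?_, h.2⟩
    have := hinv.1
    have := h.1
    rw [List.length_append, List.length_singleton, Nat.mul_add, mul_one]; omega
  · rintro t τ _ _ ⟨T, h1, h2, h3⟩
    refine ⟨?_, h3⟩
    rw [Nat.add_mul]; omega

end RealRAM

/-! ### Graphs given by edge lists, and their elements -/

/-- A simple graph on `{0, …, n - 1}` given by the endpoints of its `m` edges. Its elements are
numbers: a vertex stands for itself and edge `j` is the element `n + j`. The number `n + m` is a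
dummy of weight `0`. -/
structure Net where
  n : ℕ
  m : ℕ
  fst : ℕ → ℕ
  snd : ℕ → ℕ
  w : ℕ → ℝ
  fst_lt : ∀ j < m, fst j < n
  snd_lt : ∀ j < m, snd j < n
  ne : ∀ j < m, fst j ≠ snd j
  inj : ∀ i < m, ∀ j < m,
    (fst i = fst j ∧ snd i = snd j) ∨ (fst i = snd j ∧ snd i = fst j) → i = j
  w_dummy : w (n + m) = 0

namespace Net

variable (N : Net)

/-- The source of an arc; edge `j` gives the arc `j + 1` and its reverse `m + j + 1`. -/
def src (p : ℕ) : ℕ := if p ≤ N.m then N.fst (p - 1) else N.snd (p - N.m - 1)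

/-- The target of an arc. -/
def tgt (p : ℕ) : ℕ := if p ≤ N.m then N.snd (p - 1) else N.fst (p - N.m - 1)

/-- The element of the edge of an arc. -/
def eid (p : ℕ) : ℕ := if p ≤ N.m then N.n + (p - 1) else N.n + (p - N.m - 1)

/-- The arcs of the first `k` edges with source `v`, the last one first. -/
def adjTo : ℕ → ℕ → List ℕ
  | 0, _ => []
  | k + 1, v => (if N.snd k = v then [N.m + k + 1] else []) ++
      ((if N.fst k = v then [k + 1] else []) ++ adjTo k v)

/-- The arcs with source `v`. -/
def adj (v : ℕ) : List ℕ := N.adjTo N.m v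

theorem mem_adjTo {k v p : ℕ} : p ∈ N.adjTo k v ↔
    (1 ≤ p ∧ p ≤ k ∧ N.fst (p - 1) = v) ∨
      (N.m + 1 ≤ p ∧ p ≤ N.m + k ∧ N.snd (p - N.m - 1) = v) := by
  induction k with
  | zero => simp [adjTo]; omega
  | succ k ih =>
    have h1 : (p ∈ if N.snd k = v then [N.m + k + 1] else []) ↔
        N.snd k = v ∧ p = N.m + k + 1 := by split_ifs with h <;> simp [h]
    have h2 : (p ∈ if N.fst k = v then [k + 1] else []) ↔ N.fst k = v ∧ p = k + 1 := by
      split_ifs with h <;> simp [h]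
    rw [adjTo, List.mem_append, List.mem_append, ih, h1, h2]
    constructor
    · rintro (⟨h, rfl⟩ | ⟨h, rfl⟩ | ⟨h1, h2, h3⟩ | ⟨h1, h2, h3⟩)
      · exact Or.inr ⟨by omega, by omega, by rw [← h]; congr 1; omega⟩
      · exact Or.inl ⟨by omega, by omega, by rw [← h]; congr 1⟩
      · exact Or.inl ⟨h1, by omega, h3⟩
      · exact Or.inr ⟨h1, by omega, h3⟩
    · rintro (⟨h1, h2, h3⟩ | ⟨h1, h2, h3⟩)
      · rcases Nat.lt_or_ge k p with h | h
        · obtain rfl : p = k + 1 := by omega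
          exact Or.inr (Or.inl ⟨h3, rfl⟩)
        · exact Or.inr (Or.inr (Or.inl ⟨h1, h, h3⟩))
      · rcases Nat.lt_or_ge (N.m + k) p with h | h
        · obtain rfl : p = N.m + k + 1 := by omega
          refine Or.inl ⟨?_, rfl⟩
          rw [← h3]; congr 1; omega
        · exact Or.inr (Or.inr (Or.inr ⟨h1, h, h3⟩))

theorem mem_adj {v p : ℕ} : p ∈ N.adj v ↔ 1 ≤ p ∧ p ≤ 2 * N.m ∧ N.src p = v := by
  rw [adj, mem_adjTo, src]
  split_ifs with h
  · constructor
    · rintro (h1 | h1)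
      · exact ⟨h1.1, by omega, h1.2.2⟩
      · omega
    · exact fun h1 => Or.inl ⟨h1.1, h, h1.2.2⟩
  · constructor
    · rintro (h1 | h1)
      · omega
      · exact ⟨by omega, by omega, h1.2.2⟩
    · exact fun h1 => Or.inr ⟨by omega, by omega, h1.2.2⟩

variable {N} {u v x i j p q : ℕ}

theorem tgt_lt (h : p ∈ N.adj v) : N.tgt p < N.n := by
  rw [mem_adj] at h
  unfold tgt
  split_ifs
  · exact N.snd_lt _ (by omega)
  · exact N.fst_lt _ (by omega)

theorem src_lt (h : p ∈ N.adj v) : v < N.n := by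
  rw [mem_adj] at h
  rw [← h.2.2]
  unfold src
  split_ifs
  · exact N.fst_lt _ (by omega)
  · exact N.snd_lt _ (by omega)

theorem tgt_ne (h : p ∈ N.adj v) : N.tgt p ≠ v := by
  rw [mem_adj] at h
  rw [← h.2.2]
  unfold src tgt
  split_ifs
  · exact (N.ne _ (by omega)).symm
  · exact N.ne _ (by omega)

theorem eid_range (h : p ∈ N.adj v) : N.n ≤ N.eid p ∧ N.eid p < N.n + N.m := by
  rw [mem_adj] at h
  unfold eid
  split_ifs <;> omega

/-- Reversing an arc shifts its number by `N.m`, up or down. -/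
theorem exists_rev (h : p ∈ N.adj v) :
    ∃ q ∈ N.adj (N.tgt p), N.tgt q = v ∧ N.eid q = N.eid p := by
  rw [mem_adj] at h
  obtain ⟨h1, h2, h3⟩ := h
  by_cases hp : p ≤ N.m
  · refine ⟨p + N.m, ?_, ?_, ?_⟩
    · rw [mem_adj]
      refine ⟨by omega, by omega, ?_⟩
      rw [src, tgt, if_neg (by omega), if_pos hp]; congr 1; omega
    · rw [src, if_pos hp] at h3
      rw [tgt, if_neg (by omega), ← h3]; congr 1; omega
    · rw [eid, eid, if_neg (by omega), if_pos hp]; omega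
  · refine ⟨p - N.m, ?_, ?_, ?_⟩
    · rw [mem_adj]
      refine ⟨by omega, by omega, ?_⟩
      rw [src, tgt, if_pos (by omega), if_neg hp]
    · rw [src, if_neg hp] at h3
      rw [tgt, if_pos (by omega), ← h3]
    · rw [eid, eid, if_pos (by omega), if_neg hp]

theorem eq_of_eid_eq (hp : p ∈ N.adj u) (hq : q ∈ N.adj v) (h : N.eid p = N.eid q) :
    (u = v ∧ p = q) ∨ (u = N.tgt q ∧ v = N.tgt p) := by
  rw [mem_adj] at hp hq
  obtain ⟨h1, h2, rfl⟩ := hp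
  obtain ⟨h3, h4, rfl⟩ := hq
  unfold eid at h
  unfold src tgt
  split_ifs at h with ha hb hb
  · obtain rfl : p = q := by omega
    exact Or.inl ⟨rfl, rfl⟩
  · have : p - 1 = q - N.m - 1 := by omega
    simp [ha, hb, this]
  · have : p - N.m - 1 = q - 1 := by omega
    simp [ha, hb, this]
  · obtain rfl : p = q := by omega
    exact Or.inl ⟨rfl, rfl⟩

/-- Here simplicity of the graph enters: arcs with equal ends come from one edge, and if they
traversed it in opposite directions it would be a loop. -/
theorem eq_of_tgt_eq (hp : p ∈ N.adj u) (hq : q ∈ N.adj u) (h : N.tgt p = N.tgt q) : p = q := by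
  rw [mem_adj] at hp hq
  obtain ⟨h1, h2, h5⟩ := hp
  obtain ⟨h3, h4, h6⟩ := hq
  unfold tgt at h
  unfold src at h5 h6
  split_ifs at h h5 h6 with ha hb hb
  · have := N.inj (p - 1) (by omega) (q - 1) (by omega) (Or.inl ⟨h5.trans h6.symm, h⟩)
    omega
  · have h0 := N.inj (p - 1) (by omega) (q - N.m - 1) (by omega) (Or.inr ⟨h5.trans h6.symm, h⟩)
    rw [h0] at h
    exact absurd h.symm (N.ne _ (by omega))
  · have h0 := N.inj (p - N.m - 1) (by omega) (q - 1) (by omega) (Or.inr ⟨h, h5.trans h6.symm⟩)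
    rw [h0] at h
    exact absurd h (N.ne _ (by omega))
  · have := N.inj (p - N.m - 1) (by omega) (q - N.m - 1) (by omega)
      (Or.inl ⟨h, h5.trans h6.symm⟩)
    omega

theorem exists_adj_eid (hj : j < N.m) : j + 1 ∈ N.adj (N.fst j) ∧ N.tgt (j + 1) = N.snd j ∧
    N.eid (j + 1) = N.n + j := by
  rw [mem_adj, src, tgt, eid, if_pos (by omega), if_pos (by omega), if_pos (by omega)]
  exact ⟨⟨by omega, by omega, rfl⟩, rfl, rfl⟩

/-- Adjacency of vertices. -/
def Nbr (N : Net) (u v : ℕ) : Prop := ∃ p ∈ N.adj u, N.tgt p = v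

theorem Nbr.symm (h : N.Nbr u v) : N.Nbr v u := by
  obtain ⟨p, hp, rfl⟩ := h
  obtain ⟨q, hq, h, _⟩ := exists_rev hp
  exact ⟨q, hq, h⟩

theorem Nbr.lt_left (h : N.Nbr u v) : u < N.n := by
  obtain ⟨p, hp, rfl⟩ := h
  exact src_lt hp

theorem Nbr.lt_right (h : N.Nbr u v) : v < N.n := h.symm.lt_left

/-- A vertex with its incident edges. -/
def star (N : Net) (v : ℕ) : Finset ℕ := insert v ((N.adj v).map N.eid).toFinset

theorem mem_star : i ∈ N.star v ↔ i = v ∨ ∃ p ∈ N.adj v, N.eid p = i := by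
  simp [star]

theorem self_mem_star (N : Net) (v : ℕ) : v ∈ N.star v := mem_star.2 (Or.inl rfl)

theorem eid_mem_star (h : p ∈ N.adj v) : N.eid p ∈ N.star v := mem_star.2 (Or.inr ⟨p, h, rfl⟩)

theorem mem_star_of_lt (hi : i < N.n) : i ∈ N.star v ↔ i = v := by
  rw [mem_star]
  refine ⟨?_, Or.inl⟩
  rintro (h | ⟨p, hp, rfl⟩)
  · exact h
  · have := eid_range hp; omega

theorem lt_of_mem_star (hv : v < N.n) (hi : i ∈ N.star v) : i < N.n + N.m := by
  rcases mem_star.1 hi with rfl | ⟨p, hp, rfl⟩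
  · omega
  · exact (eid_range hp).2

theorem eid_mem_star_iff (hp : p ∈ N.adj u) (hv : v < N.n) :
    N.eid p ∈ N.star v ↔ v = u ∨ v = N.tgt p := by
  rw [mem_star]
  constructor
  · rintro (h | ⟨q, hq, h⟩)
    · have := eid_range hp; omega
    · rcases eq_of_eid_eq hp hq h.symm with h | h
      · exact Or.inl h.1.symm
      · exact Or.inr h.2
  · rintro (rfl | rfl)
    · exact Or.inr ⟨p, hp, rfl⟩
    · obtain ⟨q, hq, _, h⟩ := exists_rev hp
      exact Or.inr ⟨q, hq, h⟩

theorem eq_or_nbr_of_mem_star (hu : i ∈ N.star u) (hv : i ∈ N.star v) (hu' : u < N.n)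
    (hv' : v < N.n) : u = v ∨ N.Nbr u v := by
  rcases mem_star.1 hu with rfl | ⟨p, hp, rfl⟩
  · exact Or.inl ((mem_star_of_lt hu').1 hv)
  · rcases (eid_mem_star_iff hp hv').1 hv with h | h
    · exact Or.inl h.symm
    · exact Or.inr ⟨p, hp, h.symm⟩

/-- The conflict relation of elements: two elements with a common star, or adjacent vertices. -/
def Conf (N : Net) (i j : ℕ) : Prop := (∃ v < N.n, i ∈ N.star v ∧ j ∈ N.star v) ∨ N.Nbr i j

theorem Conf.symm (h : N.Conf i j) : N.Conf j i := by
  rcases h with ⟨v, hv, h1, h2⟩ | h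
  · exact Or.inl ⟨v, hv, h2, h1⟩
  · exact Or.inr h.symm

theorem conf_of_star (hv : v < N.n) (hi : i ∈ N.star v) (hj : j ∈ N.star v) : N.Conf i j :=
  Or.inl ⟨v, hv, hi, hj⟩

/-- This and `conf_edge` describe the conflicts of a fixed element through at most two adjacency
lists; the machine blocks exactly these elements. -/
theorem conf_vertex (hx : x < N.n) : N.Conf x j ↔ j ∈ N.star x ∨ N.Nbr x j := by
  constructor
  · rintro (⟨v, _, h1, h2⟩ | h)
    · rw [(mem_star_of_lt hx).1 h1]; exact Or.inl h2
    · exact Or.inr h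
  · rintro (h | h)
    · exact Or.inl ⟨x, hx, N.self_mem_star x, h⟩
    · exact Or.inr h

theorem conf_edge (hp : p ∈ N.adj x) :
    N.Conf (N.eid p) j ↔ j ∈ N.star x ∨ j ∈ N.star (N.tgt p) := by
  constructor
  · rintro (⟨v, hv, h1, h2⟩ | h)
    · rcases (eid_mem_star_iff hp hv).1 h1 with rfl | rfl
      · exact Or.inl h2
      · exact Or.inr h2
    · have := eid_range hp
      have := h.lt_left
      omega
  · rintro (h | h)
    · exact Or.inl ⟨x, src_lt hp, eid_mem_star hp, h⟩
    · exact Or.inl ⟨_, tgt_lt hp, (eid_mem_star_iff hp (tgt_lt hp)).2 (Or.inr rfl), h⟩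

/-- Independence of elements. -/
def Indep (N : Net) (I : Finset ℕ) : Prop := ∀ i ∈ I, ∀ j ∈ I, i ≠ j → ¬ N.Conf i j

theorem Indep.mono {I J : Finset ℕ} (h : N.Indep J) (hIJ : I ⊆ J) : N.Indep I :=
  fun i hi j hj => h i (hIJ hi) j (hIJ hj)

/-- `I` is a maximum-weight independent subset of `A`. -/
structure MaxIndep (N : Net) (A I : Finset ℕ) : Prop where
  subset : I ⊆ A
  indep : N.Indep I
  le : ∀ J ⊆ A, N.Indep J → ∑ i ∈ J, N.w i ≤ ∑ i ∈ I, N.w i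

/-- Without conflicts between `A` and `B`, both independence and weight split, so the two parts can
be optimised separately. -/
theorem MaxIndep.union {A B I J : Finset ℕ} (hI : N.MaxIndep A I) (hJ : N.MaxIndep B J)
    (hAB : Disjoint A B) (hc : ∀ i ∈ A, ∀ j ∈ B, ¬ N.Conf i j) : N.MaxIndep (A ∪ B) (I ∪ J) := by
  refine ⟨Finset.union_subset_union hI.subset hJ.subset, ?_, fun K hK hKi => ?_⟩
  · intro i hi j hj hij
    rcases Finset.mem_union.1 hi with hi | hi <;> rcases Finset.mem_union.1 hj with hj | hj
    · exact hI.indep i hi j hj hij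
    · exact hc i (hI.subset hi) j (hJ.subset hj)
    · exact fun h => hc j (hI.subset hj) i (hJ.subset hi) h.symm
    · exact hJ.indep i hi j hj hij
  · have h1 : K = (K ∩ A) ∪ (K ∩ B) := by
      rw [← Finset.inter_union_distrib_left, Finset.inter_eq_left.2 hK]
    rw [h1, Finset.sum_union (hAB.mono Finset.inter_subset_right Finset.inter_subset_right),
      Finset.sum_union (hAB.mono hI.subset hJ.subset)]
    exact add_le_add (hI.le _ Finset.inter_subset_right (hKi.mono Finset.inter_subset_left))
      (hJ.le _ Finset.inter_subset_right (hKi.mono Finset.inter_subset_left))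

/-- A set of vertices closed under adjacency. -/
def Closed (N : Net) (U : Finset ℕ) : Prop := ∀ u ∈ U, ∀ v, N.Nbr u v → v ∈ U

/-- The vertices of `U` and the edges incident to them. -/
def els (N : Net) (U : Finset ℕ) : Finset ℕ := U.biUnion N.star

theorem mem_els {U : Finset ℕ} : i ∈ N.els U ↔ ∃ v ∈ U, i ∈ N.star v := by simp [els]

theorem els_union (U V : Finset ℕ) : N.els (U ∪ V) = N.els U ∪ N.els V := Finset.union_biUnion

/-- A conflict would lead from a vertex of `U` to one of `V` through vertices that are successively
equal or adjacent, and closedness keeps each of these steps inside `U`. -/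
theorem not_conf_of_closed {U V : Finset ℕ} (hU : N.Closed U) (hUV : Disjoint U V)
    (hUn : ∀ u ∈ U, u < N.n) (hVn : ∀ v ∈ V, v < N.n) (hi : i ∈ N.els U) (hj : j ∈ N.els V) :
    ¬ N.Conf i j := by
  obtain ⟨u, hu, hi⟩ := mem_els.1 hi
  obtain ⟨v, hv, hj⟩ := mem_els.1 hj
  have hclosed : ∀ a ∈ U, ∀ b, a = b ∨ N.Nbr a b → b ∈ U := by
    rintro a ha b (rfl | h)
    · exact ha
    · exact hU a ha b h
  rintro (⟨z, hz, h1, h2⟩ | h)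
  · have hzU := hclosed u hu z (eq_or_nbr_of_mem_star hi h1 (hUn u hu) hz)
    have hvU := hclosed z hzU v (eq_or_nbr_of_mem_star h2 hj hz (hVn v hv))
    exact Finset.disjoint_left.1 hUV hvU hv
  · obtain rfl := (mem_star_of_lt h.lt_left).1 hi
    obtain rfl := (mem_star_of_lt h.lt_right).1 hj
    exact Finset.disjoint_left.1 hUV (hU _ hu _ h) hv

theorem conf_self_of_mem_els {U : Finset ℕ} (hUn : ∀ u ∈ U, u < N.n) (hi : i ∈ N.els U) :
    N.Conf i i := by
  obtain ⟨u, hu, hi⟩ := mem_els.1 hi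
  exact conf_of_star (hUn u hu) hi hi

/-- An element of a star conflicts with itself, so a common element would already be a conflict
between the two sides. -/
theorem disjoint_els_of_closed {U V : Finset ℕ} (hU : N.Closed U) (hUV : Disjoint U V)
    (hUn : ∀ u ∈ U, u < N.n) (hVn : ∀ v ∈ V, v < N.n) : Disjoint (N.els U) (N.els V) :=
  Finset.disjoint_left.2 fun _ hi hj =>
    not_conf_of_closed hU hUV hUn hVn hi hj (conf_self_of_mem_els hUn hi)

end Net

/-! ### Maximum-weight sets of positions at pairwise distance at least three -/

section Linear

variable (w : ℕ → ℝ) (ok : ℕ → Prop)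

open Classical in
/-- The maximum weight of a set of admissible positions below `k` at pairwise distance at
least `3`. -/
noncomputable def lin : ℕ → ℝ
  | 0 => 0
  | k + 1 => if ok k ∧ lin k < w k + lin (k - 2) then w k + lin (k - 2) else lin k

/-- The recursion for `lin` takes position `k`. -/
def Takes (k : ℕ) : Prop := ok k ∧ lin w ok k < w k + lin w ok (k - 2)

open Classical in
/-- An optimal set of positions for `lin`. -/
noncomputable def linTrace : ℕ → Finset ℕ
  | 0 => ∅
  | k + 1 => if Takes w ok k then insert k (linTrace (k - 2)) else linTrace k

variable {w ok} {i j k : ℕ}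

theorem lin_zero : lin w ok 0 = 0 := by rw [lin]

theorem lin_succ_of_takes (h : Takes w ok k) : lin w ok (k + 1) = w k + lin w ok (k - 2) := by
  rw [lin]; exact if_pos h

theorem lin_succ_of_not_takes (h : ¬ Takes w ok k) : lin w ok (k + 1) = lin w ok k := by
  rw [lin]; exact if_neg h

theorem linTrace_zero : linTrace w ok 0 = ∅ := by rw [linTrace]

theorem linTrace_succ_of_takes (h : Takes w ok k) :
    linTrace w ok (k + 1) = insert k (linTrace w ok (k - 2)) := by rw [linTrace, if_pos h]

theorem linTrace_succ_of_not_takes (h : ¬ Takes w ok k) :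
    linTrace w ok (k + 1) = linTrace w ok k := by rw [linTrace, if_neg h]

theorem lin_le_succ : lin w ok k ≤ lin w ok (k + 1) := by
  by_cases h : Takes w ok k
  · rw [lin_succ_of_takes h]; exact h.2.le
  · rw [lin_succ_of_not_takes h]

theorem lin_mono : Monotone (lin w ok) := monotone_nat_of_le_succ fun _ => lin_le_succ

theorem le_lin_succ (h : ok k) : w k + lin w ok (k - 2) ≤ lin w ok (k + 1) := by
  by_cases ht : Takes w ok k
  · rw [lin_succ_of_takes ht]
  · rw [lin_succ_of_not_takes ht]
    exact not_lt.1 fun hlt => ht ⟨h, hlt⟩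

/-- In case of a tie the recursion does not take a position, so it takes only positive weights. This
is why dummies, of weight zero, never enter a solution. -/
theorem Takes.pos (h : Takes w ok k) : 0 < w k := by
  have h1 := h.2
  have h2 : lin w ok (k - 2) ≤ lin w ok k := lin_mono (Nat.sub_le _ _)
  linarith

/-- Taking position `k` leaves the positions below `k - 2`, all at distance at least three from `k`;
for `k < 2` truncated subtraction correctly gives the empty range. -/
theorem linTrace_spec (k : ℕ) :
    (∀ i ∈ linTrace w ok k, i < k ∧ Takes w ok i ∧ ∀ j ∈ linTrace w ok k, i < j → i + 3 ≤ j) ∧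
      ∑ i ∈ linTrace w ok k, w i = lin w ok k := by
  induction k using Nat.strong_induction_on with
  | _ k ih =>
    cases k with
    | zero => simp [linTrace_zero, lin_zero]
    | succ k =>
      by_cases h : Takes w ok k
      · obtain ⟨h1, h2⟩ := ih (k - 2) (by omega)
        have hlt : ∀ i ∈ linTrace w ok (k - 2), i + 3 ≤ k := fun i hi => by
          have := (h1 i hi).1; omega
        rw [linTrace_succ_of_takes h, lin_succ_of_takes h, Finset.sum_insert, h2]
        · refine ⟨fun i hi => ?_, rfl⟩
          rcases Finset.mem_insert.1 hi with rfl | hi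
          · refine ⟨by omega, h, fun j hj hij => ?_⟩
            rcases Finset.mem_insert.1 hj with rfl | hj
            · omega
            · have := hlt j hj; omega
          · refine ⟨by have := hlt i hi; omega, (h1 i hi).2.1, fun j hj hij => ?_⟩
            rcases Finset.mem_insert.1 hj with rfl | hj
            · exact hlt i hi
            · exact (h1 i hi).2.2 j hj hij
        · intro hk
          have := hlt k hk
          omega
      · obtain ⟨h1, h2⟩ := ih k (by omega)
        rw [linTrace_succ_of_not_takes h, lin_succ_of_not_takes h]
        exact ⟨fun i hi => ⟨by have := (h1 i hi).1; omega, (h1 i hi).2⟩, h2⟩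

/-- If `k` belongs to `P`, the other members of `P` below `k` are below `k - 2`, which matches the
branch of the recursion that takes `k`. -/
theorem sum_le_lin {P : Finset ℕ} (hok : ∀ i ∈ P, ok i)
    (hd : ∀ i ∈ P, ∀ j ∈ P, i < j → i + 3 ≤ j) (k : ℕ) :
    ∑ i ∈ P.filter (· < k), w i ≤ lin w ok k := by
  induction k using Nat.strong_induction_on with
  | _ k ih =>
    cases k with
    | zero => simp [lin_zero]
    | succ k =>
      by_cases hk : k ∈ P
      · have : P.filter (· < k + 1) = insert k (P.filter (· < k - 2)) := by
          ext i
          simp only [Finset.mem_filter, Finset.mem_insert]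
          constructor
          · rintro ⟨h1, h2⟩
            rcases Nat.lt_succ_iff_lt_or_eq.1 h2 with h | h
            · have := hd i h1 k hk h
              exact Or.inr ⟨h1, by omega⟩
            · exact Or.inl h
          · rintro (rfl | ⟨h1, h2⟩)
            · exact ⟨hk, by omega⟩
            · exact ⟨h1, by omega⟩
        rw [this, Finset.sum_insert (by simp)]
        exact (add_le_add_right (ih (k - 2) (by omega)) _).trans (le_lin_succ (hok k hk))
      · have : P.filter (· < k + 1) = P.filter (· < k) := by
          ext i
          simp only [Finset.mem_filter]
          refine ⟨fun ⟨h1, h2⟩ => ⟨h1, ?_⟩, fun ⟨h1, h2⟩ => ⟨h1, by omega⟩⟩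
          rcases Nat.lt_succ_iff_lt_or_eq.1 h2 with h | h
          · exact h
          · exact absurd (h ▸ h1) hk
        rw [this]
        exact (ih k (by omega)).trans lin_le_succ

end Linear

/-! ### Mixed radix numbers -/

/-- The number with `p` digits `d` in the mixed radix system `b`. -/
def mixRank (b d : ℕ → ℕ) (p : ℕ) : ℕ := ∑ i ∈ Finset.range p, d i * ∏ l ∈ Finset.range i, b l

theorem mixRank_lt {b d : ℕ → ℕ} {p : ℕ} (h : ∀ i < p, d i < b i) :
    mixRank b d p < ∏ l ∈ Finset.range p, b l := by
  induction p with
  | zero => simp [mixRank]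
  | succ p ih =>
    have h1 := ih fun i hi => h i (by omega)
    have h2 : (d p + 1) * ∏ l ∈ Finset.range p, b l ≤ b p * ∏ l ∈ Finset.range p, b l :=
      Nat.mul_le_mul_right _ (h p (by omega))
    rw [mixRank, Finset.sum_range_succ, Finset.prod_range_succ, mul_comm _ (b p)]
    rw [mixRank] at h1
    rw [Nat.add_mul] at h2
    omega

/-- The last digit is the quotient by the product of the earlier radices. Injectivity later ensures
that each new rank adds only one selection. -/
theorem mixRank_inj {b d e : ℕ → ℕ} {p : ℕ} (hd : ∀ i < p, d i < b i) (he : ∀ i < p, e i < b i)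
    (h : mixRank b d p = mixRank b e p) : ∀ i < p, d i = e i := by
  induction p with
  | zero => intro i hi; omega
  | succ p ih =>
    have h1 := mixRank_lt (b := b) (d := d) (p := p) fun i hi => hd i (by omega)
    have h2 := mixRank_lt (b := b) (d := e) (p := p) fun i hi => he i (by omega)
    set B := ∏ l ∈ Finset.range p, b l with hB
    have h3 : mixRank b d p + d p * B = mixRank b e p + e p * B := by
      simpa only [mixRank, Finset.sum_range_succ] using h
    have hlast : d p = e p := by
      have h4 : (mixRank b d p + d p * B) / B = (mixRank b e p + e p * B) / B := by rw [h3]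
      have hB0 : 0 < B := by omega
      rwa [Nat.add_mul_div_right _ _ hB0, Nat.add_mul_div_right _ _ hB0, Nat.div_eq_of_lt h1,
        Nat.div_eq_of_lt h2, zero_add, zero_add] at h4
    intro i hi
    rcases Nat.lt_succ_iff_lt_or_eq.1 hi with h | rfl
    · exact ih (fun i hi => hd i (by omega)) (fun i hi => he i (by omega)) (by
        rw [hlast] at h3; omega) i h
    · exact hlast

/-- The old contribution of digit `i` stands on one side and the new one on the other, which avoids
subtraction of natural numbers. -/
theorem mixRank_update {b d : ℕ → ℕ} {p i : ℕ} (hi : i < p) (v : ℕ) :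
    mixRank b (Function.update d i v) p + d i * ∏ l ∈ Finset.range i, b l =
      mixRank b d p + v * ∏ l ∈ Finset.range i, b l := by
  have hmem := Finset.mem_range.2 hi
  rw [mixRank, mixRank, ← Finset.add_sum_erase _ _ hmem, ← Finset.add_sum_erase _ _ hmem]
  have : ∑ x ∈ (Finset.range p).erase i, Function.update d i v x * ∏ l ∈ Finset.range x, b l =
      ∑ x ∈ (Finset.range p).erase i, d x * ∏ l ∈ Finset.range x, b l := by
    refine Finset.sum_congr rfl fun x hx => ?_
    rw [Function.update_of_ne (Finset.ne_of_mem_erase hx)]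
  rw [this, Function.update_self]
  omega

theorem mixRank_zero {b d : ℕ → ℕ} {p : ℕ} (h : ∀ i < p, d i = 0) : mixRank b d p = 0 :=
  Finset.sum_eq_zero fun i hi => by rw [h i (Finset.mem_range.1 hi), zero_mul]

namespace Net

variable {N : Net} {u v x i j p q : ℕ}

/-! ### Choosing at most one element of every star of a list of vertices -/

/-- The element that digit `d` selects in the star of `x`: `x` itself, then the incident edges,
finally none. -/
def pick (N : Net) (x d : ℕ) : Finset ℕ :=
  if d = 0 then {x} else if h : d - 1 < (N.adj x).length then {N.eid ((N.adj x)[d - 1])} else ∅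

theorem pick_zero : N.pick x 0 = {x} := by simp [pick]

theorem pick_arc {d : ℕ} (h : d < (N.adj x).length) :
    N.pick x (d + 1) = {N.eid ((N.adj x)[d])} := by simp [pick, h]

theorem pick_last {d : ℕ} (h : (N.adj x).length ≤ d) : N.pick x (d + 1) = ∅ := by
  simp [pick, h]

theorem pick_subset_star {d : ℕ} : N.pick x d ⊆ N.star x := by
  unfold pick
  split_ifs with h1 h2
  · simpa using N.self_mem_star x
  · simpa using eid_mem_star (List.getElem_mem h2)
  · simp

theorem exists_pick (hi : i ∈ N.star x) : ∃ d < (N.adj x).length + 2, N.pick x d = {i} := by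
  rcases mem_star.1 hi with rfl | ⟨p, hp, rfl⟩
  · exact ⟨0, by omega, pick_zero⟩
  · obtain ⟨k, hk, rfl⟩ := List.getElem_of_mem hp
    exact ⟨k + 1, by omega, pick_arc hk⟩

/-- The elements selected by the digits `d` at the first `k` vertices `xs`. -/
def chosen (N : Net) (xs d : ℕ → ℕ) (k : ℕ) : Finset ℕ :=
  (Finset.range k).biUnion fun i => N.pick (xs i) (d i)

/-- The elements selected by the digits `d` at the first `k` vertices `xs` do not conflict. -/
def Valid (N : Net) (xs d : ℕ → ℕ) (k : ℕ) : Prop :=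
  ∀ l < k, ∀ l' < l, ∀ i ∈ N.pick (xs l') (d l'), ∀ j ∈ N.pick (xs l) (d l), ¬ N.Conf i j

/-- The first `k` vertices of `xs`. -/
def verts (xs : ℕ → ℕ) (k : ℕ) : Finset ℕ := (Finset.range k).image xs

theorem verts_succ {xs : ℕ → ℕ} {k : ℕ} : verts xs (k + 1) = insert (xs k) (verts xs k) := by
  rw [verts, Finset.range_add_one, Finset.image_insert, verts]

variable {xs d : ℕ → ℕ} {k : ℕ}

theorem chosen_zero : N.chosen xs d 0 = ∅ := by simp [chosen]

theorem chosen_succ : N.chosen xs d (k + 1) = N.chosen xs d k ∪ N.pick (xs k) (d k) := by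
  rw [chosen, Finset.range_add_one, Finset.biUnion_insert, Finset.union_comm, chosen]

theorem mem_chosen : i ∈ N.chosen xs d k ↔ ∃ l < k, i ∈ N.pick (xs l) (d l) := by
  simp [chosen]

theorem valid_zero : N.Valid xs d 0 := fun _ h => by omega

theorem valid_succ : N.Valid xs d (k + 1) ↔
    N.Valid xs d k ∧ ∀ i ∈ N.chosen xs d k, ∀ j ∈ N.pick (xs k) (d k), ¬ N.Conf i j := by
  constructor
  · refine fun h => ⟨fun l hl => h l (by omega), fun i hi j hj => ?_⟩
    obtain ⟨l, hl, hi⟩ := mem_chosen.1 hi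
    exact h k (by omega) l hl i hi j hj
  · rintro ⟨h1, h2⟩ l hl l' hl' i hi j hj
    rcases Nat.lt_succ_iff_lt_or_eq.1 hl with h | rfl
    · exact h1 l h l' hl' i hi j hj
    · exact h2 i (mem_chosen.2 ⟨l', hl', hi⟩) j hj

theorem chosen_congr {e : ℕ → ℕ} (h : ∀ l < k, d l = e l) : N.chosen xs d k = N.chosen xs e k :=
  Finset.biUnion_congr rfl fun l hl => by rw [h l (Finset.mem_range.1 hl)]

theorem valid_congr {e : ℕ → ℕ} (h : ∀ l < k, d l = e l) : N.Valid xs d k ↔ N.Valid xs e k := by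
  unfold Valid
  constructor <;> intro H l hl l' hl' i hi j hj
  · rw [← h l hl] at hj
    rw [← h l' (by omega)] at hi
    exact H l hl l' hl' i hi j hj
  · rw [h l hl] at hj
    rw [h l' (by omega)] at hi
    exact H l hl l' hl' i hi j hj

theorem chosen_subset : N.chosen xs d k ⊆ N.els (verts xs k) := by
  intro i hi
  obtain ⟨l, hl, hi⟩ := mem_chosen.1 hi
  exact mem_els.2 ⟨xs l, Finset.mem_image_of_mem _ (Finset.mem_range.2 hl), pick_subset_star hi⟩

theorem pick_subsingleton {e : ℕ} (hi : i ∈ N.pick x e) (hj : j ∈ N.pick x e) : i = j := by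
  unfold pick at hi hj
  split_ifs at hi hj <;> simp_all

/-- Picks at one vertex coincide, so `Valid` has to compare only different vertices. -/
theorem Valid.indep (h : N.Valid xs d k) : N.Indep (N.chosen xs d k) := by
  intro i hi j hj hij
  obtain ⟨l, hl, hi⟩ := mem_chosen.1 hi
  obtain ⟨l', hl', hj⟩ := mem_chosen.1 hj
  rcases lt_trichotomy l l' with hll | rfl | hll
  · exact h l' hl' l hll i hi j hj
  · exact absurd (pick_subsingleton hi hj) hij
  · exact fun hc => h l hl l' hll j hj i hi hc.symm

/-- An independent set has at most one element in each star and can be read off vertex by vertex. An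
edge joining two listed vertices lies in both their stars; it is picked at the first one, and the
second picks nothing, because `Valid` excludes choosing the same element twice. -/
theorem exists_digits {I : Finset ℕ} (hI : N.Indep I) (k : ℕ) (hx : ∀ l < k, xs l < N.n) :
    ∃ d : ℕ → ℕ, (∀ l < k, d l < (N.adj (xs l)).length + 2) ∧ N.Valid xs d k ∧
      N.chosen xs d k = I ∩ N.els (verts xs k) := by
  induction k with
  | zero => exact ⟨fun _ => 0, fun l h => by omega, valid_zero, by simp [chosen, els, verts]⟩
  | succ k ih =>
    obtain ⟨d, h1, h2, h3⟩ := ih fun l hl => hx l (by omega)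
    have hsub : N.chosen xs d k ⊆ I := h3 ▸ Finset.inter_subset_left
    have hstep : ∃ e < (N.adj (xs k)).length + 2, N.pick (xs k) e ⊆ I ∧
        I ∩ N.star (xs k) ⊆ N.chosen xs d k ∪ N.pick (xs k) e ∧
        Disjoint (N.chosen xs d k) (N.pick (xs k) e) := by
      -- Either the star contributes a new element, necessarily unique, or everything it contributes
      -- has been picked at earlier vertices and the last digit selects nothing.
      by_cases hex : ∃ i ∈ I ∩ N.star (xs k), i ∉ N.chosen xs d k
      · obtain ⟨i, hi, hni⟩ := hex
        obtain ⟨hiI, his⟩ := Finset.mem_inter.1 hi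
        obtain ⟨e, he, hpick⟩ := exists_pick his
        refine ⟨e, he, by simpa [hpick] using hiI, fun j hj => ?_, by simpa [hpick] using hni⟩
        obtain ⟨hjI, hjs⟩ := Finset.mem_inter.1 hj
        rw [hpick, Finset.mem_union, Finset.mem_singleton]
        by_contra hcon
        exact hI j hjI i hiI (fun h => hcon (Or.inr h)) (conf_of_star (hx k (by omega)) hjs his)
      · push Not at hex
        refine ⟨(N.adj (xs k)).length + 1, by omega, ?_⟩
        rw [pick_last le_rfl]
        exact ⟨by simp, fun i hi => by simpa using hex i hi, by simp⟩
    obtain ⟨e, he, he1, he2, he3⟩ := hstep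
    have hcongr : ∀ l < k, Function.update d k e l = d l := fun l hl =>
      Function.update_of_ne (by omega) _ _
    refine ⟨Function.update d k e, fun l hl => ?_, ?_, ?_⟩
    · rcases Nat.lt_succ_iff_lt_or_eq.1 hl with h | rfl
      · rw [hcongr l h]; exact h1 l h
      · rwa [Function.update_self]
    · rw [valid_succ, valid_congr hcongr, chosen_congr hcongr, Function.update_self]
      refine ⟨h2, fun i hi j hj => hI i (hsub hi) j (he1 hj) ?_⟩
      rintro rfl
      exact Finset.disjoint_left.1 he3 hi hj
    · rw [chosen_succ, chosen_congr hcongr, Function.update_self, verts_succ]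
      apply Finset.Subset.antisymm
      · refine Finset.union_subset (fun i hi => ?_) fun i hi => ?_
        · rw [h3] at hi
          obtain ⟨ha, hb⟩ := Finset.mem_inter.1 hi
          obtain ⟨v, hv, hb⟩ := mem_els.1 hb
          exact Finset.mem_inter.2 ⟨ha, mem_els.2 ⟨v, Finset.mem_insert_of_mem hv, hb⟩⟩
        · exact Finset.mem_inter.2
            ⟨he1 hi, mem_els.2 ⟨xs k, Finset.mem_insert_self _ _, pick_subset_star hi⟩⟩
      · intro i hi
        obtain ⟨ha, hb⟩ := Finset.mem_inter.1 hi
        obtain ⟨v, hv, hb⟩ := mem_els.1 hb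
        rcases Finset.mem_insert.1 hv with rfl | hv
        · exact he2 (Finset.mem_inter.2 ⟨ha, hb⟩)
        · exact Finset.mem_union_left _ (h3 ▸ Finset.mem_inter.2 ⟨ha, mem_els.2 ⟨v, hv, hb⟩⟩)

/-! ### Linear arrangements -/

/-- The first `L` entries of `s` are the elements of `B` and dummies, and two elements conflict if
and only if their distance is at most two. -/
structure PathSeq (N : Net) (s : ℕ → ℕ) (L : ℕ) (B : Finset ℕ) : Prop where
  mem : ∀ i, i ∈ B ↔ ∃ k < L, s k = i ∧ i ≠ N.n + N.m
  inj : ∀ k l, k < l → l < L → s k ≠ N.n + N.m → s k ≠ s l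
  conf : ∀ k l, k < l → l < L → s k ≠ N.n + N.m → s l ≠ N.n + N.m →
    (N.Conf (s k) (s l) ↔ l ≤ k + 2)

theorem PathSeq.mem_of_lt {s : ℕ → ℕ} {L : ℕ} {B : Finset ℕ} (h : N.PathSeq s L B) (hk : k < L)
    (hs : s k ≠ N.n + N.m) : s k ∈ B := (h.mem _).2 ⟨k, hk, rfl, hs⟩

/-- The positions of `s` that do not conflict with `C`. -/
def Free (N : Net) (s : ℕ → ℕ) (C : Finset ℕ) (k : ℕ) : Prop := ∀ c ∈ C, ¬ N.Conf c (s k)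

/-- The positions of `s` in an optimal completion of `C`. -/
noncomputable def completion (N : Net) (s : ℕ → ℕ) (L : ℕ) (C : Finset ℕ) : Finset ℕ :=
  linTrace (fun k => N.w (s k)) (N.Free s C) L

/-- The weight of an optimal completion of `C`. -/
noncomputable def completionWeight (N : Net) (s : ℕ → ℕ) (L : ℕ) (C : Finset ℕ) : ℝ :=
  lin (fun k => N.w (s k)) (N.Free s C) L

variable {s : ℕ → ℕ} {L : ℕ} {A B C : Finset ℕ}

theorem completion_spec (hk : k ∈ N.completion s L C) :
    k < L ∧ N.Free s C k ∧ s k ≠ N.n + N.m := by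
  obtain ⟨h1, h2, _⟩ := (linTrace_spec (w := fun k => N.w (s k)) (ok := N.Free s C) L).1 k hk
  refine ⟨h1, h2.1, fun h => ?_⟩
  have h3 := h2.pos
  simp only [h, N.w_dummy, lt_self_iff_false] at h3

/-- Feasibility of completions: the recursion takes free positions at pairwise distance at least
three, none of them a dummy, so the positions carry distinct elements without conflicts. -/
theorem PathSeq.indep_union (hs : N.PathSeq s L B) (hA : Disjoint A B) (hC : C ⊆ A)
    (hCi : N.Indep C) :
    N.Indep (C ∪ (N.completion s L C).image s) ∧ (N.completion s L C).image s ⊆ B ∧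
      ∑ i ∈ C ∪ (N.completion s L C).image s, N.w i =
        ∑ i ∈ C, N.w i + N.completionWeight s L C := by
  have hB : (N.completion s L C).image s ⊆ B := by
    intro i hi
    obtain ⟨k, hk, rfl⟩ := Finset.mem_image.1 hi
    have := completion_spec hk
    exact hs.mem_of_lt this.1 this.2.2
  have hinj : ∀ k ∈ N.completion s L C, ∀ l ∈ N.completion s L C, s k = s l → k = l := by
    intro k hk l hl h
    have h1 := completion_spec hk
    have h2 := completion_spec hl
    rcases lt_trichotomy k l with hkl | hkl | hkl
    · exact absurd h (hs.inj k l hkl h2.1 h1.2.2)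
    · exact hkl
    · exact absurd h.symm (hs.inj l k hkl h1.1 h2.2.2)
  have hspec := linTrace_spec (w := fun k => N.w (s k)) (ok := N.Free s C) L
  refine ⟨?_, hB, ?_⟩
  · intro i hi j hj hij
    rcases Finset.mem_union.1 hi with hi | hi <;> rcases Finset.mem_union.1 hj with hj | hj
    · exact hCi i hi j hj hij
    · obtain ⟨k, hk, rfl⟩ := Finset.mem_image.1 hj
      exact (completion_spec hk).2.1 i hi
    · obtain ⟨k, hk, rfl⟩ := Finset.mem_image.1 hi
      exact fun h => (completion_spec hk).2.1 j hj h.symm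
    · obtain ⟨k, hk, rfl⟩ := Finset.mem_image.1 hi
      obtain ⟨l, hl, rfl⟩ := Finset.mem_image.1 hj
      have h1 := completion_spec hk
      have h2 := completion_spec hl
      rcases lt_trichotomy k l with hkl | rfl | hkl
      · have := (hspec.1 k hk).2.2 l hl hkl
        rw [hs.conf k l hkl h2.1 h1.2.2 h2.2.2]; omega
      · exact absurd rfl hij
      · have := (hspec.1 l hl).2.2 k hk hkl
        refine fun hc => ?_
        have := (hs.conf l k hkl h1.1 h2.2.2 h1.2.2).1 hc.symm
        omega
  · rw [Finset.sum_union (hA.mono hC hB), Finset.sum_image (fun k hk l hl => hinj k hk l hl)]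
    exact congrArg _ hspec.2

/-- Optimality of completions: the positions occupied by `I` are free because `C ⊆ I`, and far apart
because `I` is independent, so they compete in the recursion. -/
theorem PathSeq.sum_le (hs : N.PathSeq s L B) {I : Finset ℕ} (hI : N.Indep I) (hCI : C ⊆ I)
    (hCB : Disjoint C B) : ∑ i ∈ I ∩ B, N.w i ≤ N.completionWeight s L C := by
  have hP := sum_le_lin (w := fun k => N.w (s k)) (ok := N.Free s C)
    (P := (Finset.range L).filter fun k => s k ∈ I ∩ B)
    (fun k hk c hc hconf => by
      obtain ⟨_, hk⟩ := Finset.mem_filter.1 hk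
      obtain ⟨hkI, hkB⟩ := Finset.mem_inter.1 hk
      refine hI c (hCI hc) _ hkI ?_ hconf
      rintro rfl
      exact Finset.disjoint_left.1 hCB hc hkB)
    (fun k hk l hl hkl => by
      obtain ⟨hkL, hk⟩ := Finset.mem_filter.1 hk
      obtain ⟨hlL, hl⟩ := Finset.mem_filter.1 hl
      obtain ⟨hkI, hkB⟩ := Finset.mem_inter.1 hk
      obtain ⟨hlI, hlB⟩ := Finset.mem_inter.1 hl
      rw [Finset.mem_range] at hkL hlL
      obtain ⟨_, _, _, hkD⟩ := (hs.mem _).1 hkB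
      obtain ⟨_, _, _, hlD⟩ := (hs.mem _).1 hlB
      have := hI _ hkI _ hlI (hs.inj k l hkl hlL hkD)
      rw [hs.conf k l hkl hlL hkD hlD] at this
      omega) L
  refine le_trans (le_of_eq ?_) hP
  rw [Finset.filter_filter]
  symm
  refine Finset.sum_bij (fun k _ => s k) (fun k hk => ?_) (fun k hk l hl h => ?_)
    (fun i hi => ?_) (fun k _ => rfl)
  · exact (Finset.mem_filter.1 hk).2.1
  · obtain ⟨_, hk, hkL⟩ := Finset.mem_filter.1 hk
    obtain ⟨_, hl, hlL⟩ := Finset.mem_filter.1 hl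
    obtain ⟨_, _, _, hkD⟩ := (hs.mem _).1 (Finset.mem_inter.1 hk).2
    obtain ⟨_, _, _, hlD⟩ := (hs.mem _).1 (Finset.mem_inter.1 hl).2
    rcases lt_trichotomy k l with hkl | hkl | hkl
    · exact absurd h (hs.inj k l hkl hlL hkD)
    · exact hkl
    · exact absurd h.symm (hs.inj l k hkl hkL hlD)
  · obtain ⟨k, hk, rfl, _⟩ := (hs.mem i).1 (Finset.mem_inter.1 hi).2
    exact ⟨k, Finset.mem_filter.2 ⟨Finset.mem_range.2 hk, hi, hk⟩, rfl⟩

/-- Every independent set is dominated by the completion of some selection. -/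
theorem exists_digits_sum_le (hs : N.PathSeq s L B) (hx : ∀ l < k, xs l < N.n)
    (hdis : Disjoint (N.els (verts xs k)) B) {I : Finset ℕ} (hI : N.Indep I)
    (hsub : I ⊆ N.els (verts xs k) ∪ B) :
    ∃ d : ℕ → ℕ, (∀ l < k, d l < (N.adj (xs l)).length + 2) ∧ N.Valid xs d k ∧
      ∑ i ∈ I, N.w i ≤
        ∑ i ∈ N.chosen xs d k, N.w i + N.completionWeight s L (N.chosen xs d k) := by
  obtain ⟨d, h1, h2, h3⟩ := exists_digits hI k hx
  refine ⟨d, h1, h2, ?_⟩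
  have hI' : I = (I ∩ N.els (verts xs k)) ∪ (I ∩ B) := by
    rw [← Finset.inter_union_distrib_left, Finset.inter_eq_left.2 hsub]
  conv_lhs => rw [hI']
  rw [Finset.sum_union (hdis.mono Finset.inter_subset_right Finset.inter_subset_right), ← h3]
  exact add_le_add_right (hs.sum_le hI (h3 ▸ Finset.inter_subset_left)
    (hdis.mono_left chosen_subset)) _

end Net

/-! ### The algorithm

Integer registers: `0` number of vertices, `1` number of edges, `2`, `3`, `4` the constants `0`,
`1`, `2`, `6` the dummy element, `7` the option to choose a vertex, `8` the number of branching
vertices, `9` the length of the linear arrangement, others are scratch registers.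
Integer arrays: `4` to `7` heads, successors, targets and edges of the arcs, `9` visited vertices,
`10` branching vertices, `11` linear arrangement, `12` options of the branching vertices,
`13` blocked elements, `14` solution, `15` decisions of the recursion.
Real registers: `0` the constant `0`, `1` best weight, others are scratch registers.
Real arrays: `2` weights of the elements, `3` values of the recursion. -/

namespace RealRAM

local infixr:60 " ⨾ " => Program.seq
local prefix:max "◇" => Program.instr

namespace Algo

/-- Assigns register `val` to the cells of array `arr` of the star of the vertex in register `x`. -/
def markStar (arr x val : ℕ) : Program :=
  ◇(.store arr x val) ⨾ forArcs 26 x (◇(.load 27 7 26) ⨾ ◇(.store arr 27 val))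

/-- Clears array `arr` on the stars of the branching vertices and on the linear arrangement. -/
def clearGroup (arr : ℕ) : Program :=
  forUp 10 8 (◇(.load 11 10 10) ⨾ markStar arr 11 2) ⨾
    forUp 10 9 (◇(.load 11 11 10) ⨾ ◇(.store arr 11 2))

/-- Marks the branching vertices as visited. -/
def visitBranching : Program := forUp 10 8 (◇(.load 11 10 10) ⨾ ◇(.store 9 11 3))

/-- Appends register `x` to the linear arrangement. -/
def append (x : ℕ) : Program := ◇(.store 11 9 x) ⨾ ◇(.add 9 9 3)

/-- One step of a walk: examines arc `15` and moves on. -/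
def walkStep : Program :=
  ◇(.load 13 6 15) ⨾ ◇(.load 14 9 13) ⨾
    .ite (.ieq 14 2)
      (◇(.load 16 7 15) ⨾ append 16 ⨾ append 13 ⨾ ◇(.store 9 13 3) ⨾ ◇(.load 15 4 13))
      ◇(.load 15 5 15)

/-- Prepares a walk from the vertex in register `13`. -/
def walkStart : Program :=
  append 6 ⨾ append 6 ⨾ append 13 ⨾ ◇(.store 9 13 3) ⨾ ◇(.load 15 4 13)

/-- Walks along unvisited vertices from the vertex in register `13`. -/
def walk : Program := walkStart ⨾ .loop (.ine 15 2) walkStep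

/-- Walks from all unvisited neighbours of the branching vertices. -/
def walks : Program :=
  ◇(.const 9 0) ⨾ forUp 10 8 (◇(.load 11 10 10) ⨾ forArcs 12 11
    (◇(.load 13 6 12) ⨾ ◇(.load 14 9 13) ⨾ .ite (.ieq 14 2) walk ◇.skip))

/-- Blocks the element in register `16`, which option `17` selects at the vertex in
register `11`, and all elements in conflict with it. -/
def blockConflicts : Program :=
  markStar 13 11 3 ⨾ .ite (.ieq 17 7)
    (forArcs 12 11 (◇(.load 13 6 12) ⨾ ◇(.store 13 13 3)))
    (◇(.load 13 6 17) ⨾ markStar 13 13 3)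

/-- Loads the element of the nonzero option `17` of branching vertex number `10`. -/
def loadElement : Program :=
  ◇(.load 11 10 10) ⨾ .ite (.ieq 17 7) ◇(.copy 16 11) ◇(.load 16 7 17)

/-- Selects the element of the current option of branching vertex number `10` if it is not
blocked. -/
def selectStep : Program :=
  ◇(.load 17 12 10) ⨾ .ite (.ieq 17 2) ◇.skip
    (loadElement ⨾ ◇(.load 18 13 16) ⨾ .ite (.ieq 18 3) ◇(.copy 19 2)
      (◇(.rload 3 2 16) ⨾ ◇(.radd 2 2 3) ⨾ blockConflicts))

/-- Selects elements according to the options of the branching vertices. -/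
def select : Program :=
  clearGroup 13 ⨾ ◇(.copy 19 3) ⨾ ◇(.rcopy 2 0) ⨾ forUp 10 8 selectStep

/-- One step of the recursion on the linear arrangement. -/
def linStep : Program :=
  ◇(.load 16 11 20) ⨾ ◇(.load 18 13 16) ⨾ ◇(.rload 4 3 20) ⨾ ◇(.store 15 20 2) ⨾
    ◇(.add 21 20 3) ⨾ ◇(.rstore 3 21 4) ⨾
    .ite (.ieq 18 3) ◇.skip
      (◇(.sub 22 20 4) ⨾ ◇(.rload 5 3 22) ⨾ ◇(.rload 3 2 16) ⨾ ◇(.radd 5 3 5) ⨾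
        .ite (.rlt 4 5) (◇(.store 15 20 3) ⨾ ◇(.rstore 3 21 5)) ◇.skip)

/-- The recursion on the linear arrangement. -/
def linear : Program :=
  ◇(.rstore 3 2 0) ⨾ forUp 20 9 linStep ⨾ ◇(.rload 4 3 9) ⨾ ◇(.radd 6 2 4)

/-- Writes the selected elements of the branching vertices to the solution. -/
def saveSelected : Program :=
  forUp 10 8 (◇(.load 17 12 10) ⨾ .ite (.ieq 17 2) ◇.skip (loadElement ⨾ ◇(.store 14 16 3)))

/-- One step of `saveLinear`. -/
def traceStep : Program :=
  ◇(.sub 20 20 3) ⨾ ◇(.load 18 15 20) ⨾ .ite (.ieq 18 3)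
    (◇(.load 16 11 20) ⨾ ◇(.store 14 16 3) ⨾ ◇(.sub 20 20 4)) ◇.skip

/-- Writes the elements taken by the recursion to the solution. -/
def saveLinear : Program := ◇(.copy 20 9) ⨾ .loop (.ilt 2 20) traceStep

/-- Evaluates the current options and saves the solution if it is the best so far. -/
def evaluate : Program :=
  select ⨾ .ite (.ieq 19 3)
    (linear ⨾ .ite (.rlt 1 6)
      (◇(.rcopy 1 6) ⨾ clearGroup 14 ⨾ saveSelected ⨾ saveLinear) ◇.skip) ◇.skip

/-- One step of `increment`. -/
def incrementStep : Program :=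
  ◇(.load 17 12 10) ⨾ .ite (.ieq 17 2) (◇(.store 12 10 7) ⨾ ◇(.add 10 10 3))
    (.ite (.ieq 17 7) (◇(.load 11 10 10) ⨾ ◇(.load 17 4 11)) ◇(.load 17 5 17) ⨾
      ◇(.store 12 10 17) ⨾ ◇(.copy 23 3) ⨾ ◇(.copy 24 2))

/-- Passes to the next combination of options; register `23` tells whether there is one. -/
def increment : Program :=
  ◇(.copy 23 2) ⨾ ◇(.copy 24 8) ⨾ ◇(.const 10 0) ⨾ .loop (.ilt 10 24) incrementStep

/-- Tries all combinations of options. -/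
def search : Program :=
  forUp 10 8 ◇(.store 12 10 7) ⨾ ◇(.rcopy 1 0) ⨾ ◇(.copy 23 3) ⨾
    .loop (.ieq 23 3) (evaluate ⨾ increment)

/-- Finds an optimal solution on the components of the branching vertices. -/
def group : Program := visitBranching ⨾ walks ⨾ search

/-- Adds edge number `10` to the linked lists. -/
def addEdge : Program :=
  ◇(.add 16 0 10) ⨾ ◇(.rload 3 1 10) ⨾ ◇(.rstore 2 16 3) ⨾ ◇(.load 11 0 10) ⨾
    ◇(.load 13 1 10) ⨾ ◇(.add 17 10 3) ⨾ ◇(.store 6 17 13) ⨾ ◇(.store 7 17 16) ⨾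
    ◇(.load 18 4 11) ⨾ ◇(.store 5 17 18) ⨾ ◇(.store 4 11 17) ⨾ ◇(.add 17 17 1) ⨾
    ◇(.store 6 17 11) ⨾ ◇(.store 7 17 16) ⨾ ◇(.load 18 4 13) ⨾ ◇(.store 5 17 18) ⨾
    ◇(.store 4 13 17)

/-- Computes constants, weights and linked lists. -/
def setup : Program :=
  ◇(.const 3 1) ⨾ ◇(.const 4 2) ⨾ ◇(.add 6 0 1) ⨾ ◇(.add 7 6 1) ⨾ ◇(.sub 7 7 0) ⨾
    ◇(.add 7 7 3) ⨾ forUp 10 0 (◇(.rload 3 0 10) ⨾ ◇(.rstore 2 10 3)) ⨾ forUp 10 1 addEdge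

/-- Makes the vertices of degree at least three the branching vertices. -/
def findBranching : Program :=
  ◇(.const 8 0) ⨾ forUp 10 0 (◇(.load 11 4 10) ⨾ ◇(.load 11 5 11) ⨾ ◇(.load 11 5 11) ⨾
    .ite (.ieq 11 2) ◇.skip (◇(.store 10 8 10) ⨾ ◇(.add 8 8 3)))

/-- Treats the component of vertex number `25` unless it is visited. -/
def component : Program :=
  ◇(.load 11 9 25) ⨾ .ite (.ieq 11 2)
    (◇(.store 10 2 25) ⨾ ◇(.copy 8 3) ⨾ group) ◇.skip

/-- Writes the output. -/
def output : Program :=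
  forUp 10 0 (◇(.load 11 14 10) ⨾ ◇(.store 2 10 11)) ⨾
    forUp 10 1 (◇(.add 11 0 10) ⨾ ◇(.load 11 14 11) ⨾ ◇(.store 3 10 11))

/-- The algorithm for maximum-weight total matchings. -/
def program : Program :=
  setup ⨾ findBranching ⨾ group ⨾ forUp 25 0 component ⨾ output

end Algo

/-! ### The graph in memory and the marking of stars -/

/-- The memory holds the graph `N` and the constants. -/
structure Static (N : Net) (σ : State) : Prop where
  r0 : σ.ireg 0 = N.n
  r1 : σ.ireg 1 = N.m
  r2 : σ.ireg 2 = 0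
  r3 : σ.ireg 3 = 1
  r4 : σ.ireg 4 = 2
  r6 : σ.ireg 6 = N.n + N.m
  r7 : σ.ireg 7 = 2 * N.m + 1
  head : ∀ v, σ.iarr 4 v = (N.adj v).headD 0
  next : ∀ v l1 p l2, N.adj v = l1 ++ p :: l2 → σ.iarr 5 p = l2.headD 0
  tgt : ∀ v, ∀ p ∈ N.adj v, σ.iarr 6 p = N.tgt p
  eid : ∀ v, ∀ p ∈ N.adj v, σ.iarr 7 p = N.eid p
  w : ∀ i, σ.rarr 2 i = N.w i
  rz : σ.rreg 0 = 0

/-- The program does not write the locations of `Static`. -/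
abbrev Program.Keeps (p : Program) : Prop :=
  (∀ x ∈ [0, 1, 2, 3, 4, 6, 7], x ∉ p.iw) ∧ (∀ a ∈ [4, 5, 6, 7], a ∉ p.aw) ∧ 2 ∉ p.raw ∧ 0 ∉ p.rw

theorem Static.frame {N : Net} {σ τ : State} {p : Program} (hS : Static N σ) (h : Frame p σ τ)
    (hp : p.Keeps) : Static N τ := by
  obtain ⟨h1, h2, h3, h4⟩ := hp
  constructor
  · rw [h.ireg _ (h1 _ (by simp)), hS.r0]
  · rw [h.ireg _ (h1 _ (by simp)), hS.r1]
  · rw [h.ireg _ (h1 _ (by simp)), hS.r2]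
  · rw [h.ireg _ (h1 _ (by simp)), hS.r3]
  · rw [h.ireg _ (h1 _ (by simp)), hS.r4]
  · rw [h.ireg _ (h1 _ (by simp)), hS.r6]
  · rw [h.ireg _ (h1 _ (by simp)), hS.r7]
  · rw [h.iarr _ (h2 _ (by simp))]; exact hS.head
  · rw [h.iarr _ (h2 _ (by simp))]; exact hS.next
  · rw [h.iarr _ (h2 _ (by simp))]; exact hS.tgt
  · rw [h.iarr _ (h2 _ (by simp))]; exact hS.eid
  · rw [h.rarr _ h3]; exact hS.w
  · rw [h.rreg _ h4, hS.rz]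

theorem Static.next_arc {N : Net} {σ : State} (hS : Static N σ) {v : ℕ} (l1 : List ℕ) (p : ℕ)
    (l2 : List ℕ) (h : N.adj v = l1 ++ p :: l2) : p ≠ 0 ∧ σ.iarr 5 p = l2.headD 0 := by
  have hp : p ∈ N.adj v := by simp [h]
  exact ⟨by have := (N.mem_adj.1 hp).1; omega, hS.next v l1 p l2 h⟩

namespace Algo

variable {W : ℕ} {N : Net} {σ : State}

/-- Each arc costs four units, two for the body and two for the loop. -/
theorem runs_markStar {arr x val : ℕ} (hS : Static N σ)
    (hne : arr ∉ [4, 5, 6, 7] ∧ x ≠ 26 ∧ x ≠ 27 ∧ val ≠ 26 ∧ val ≠ 27) :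
    Runs W (markStar arr x val) σ fun t τ => t ≤ 4 * (N.adj (σ.ireg x)).length + 3 ∧
      ∀ i, τ.iarr arr i = if i ∈ N.star (σ.ireg x) then σ.ireg val else σ.iarr arr i := by
  obtain ⟨h1, h2, h3, h4, h5⟩ := hne
  simp only [List.mem_cons, List.not_mem_nil, or_false, not_or] at h1
  obtain ⟨ha, hb, hc, hd⟩ := h1
  refine Runs.seq_wp (R := fun τ => ∀ i, τ.iarr arr i = if i = σ.ireg x then σ.ireg val
    else σ.iarr arr i) ?_ ?_
  · refine ⟨trivial, fun i => ?_⟩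
    simp only [Instr.eval, Function.update_self, Function.update_apply]
  · intro s τ hs hfr hfit hτ
    have hS' : Static N τ := hS.frame hfr (by
      simp [Program.Keeps, Program.collect, Instr.iw, Instr.aw, Instr.rw, Instr.raw, Ne.symm ha, Ne.symm hb,
        Ne.symm hc, Ne.symm hd])
    have hx : τ.ireg x = σ.ireg x := hfr.ireg _ (by simp [Program.collect, Instr.iw])
    have hv : τ.ireg val = σ.ireg val := hfr.ireg _ (by simp [Program.collect, Instr.iw])
    have hfor := Runs.forArcs (W := W) (body := ◇(.load 27 7 26) ⨾ ◇(.store arr 27 val))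
      (arc := 26) (x := x) (l := N.adj (σ.ireg x)) 2
      (fun l τ' => ∀ i, τ'.iarr arr i = if i = σ.ireg x ∨ ∃ p ∈ l, N.eid p = i then σ.ireg val
        else σ.iarr arr i) hS'.r2 (by rw [hx]; exact hS'.head _) (fun l1 p l2 h =>
        hS'.next_arc _ _ _ h)
      (by simp [Program.collect, Instr.iw, Instr.aw, Ne.symm hb])
      (fun l τ' _ h => h) (by simpa using hτ)
      (fun l1 p l2 τ' hl hfr' hfit' hp hinv => by
        have h7 : τ'.iarr 7 = τ.iarr 7 := hfr'.iarr _ (by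
          simp [forArcs, Program.collect, Instr.aw, Ne.symm hd])
        have hval : τ'.ireg val = σ.ireg val := (hfr'.ireg _ (by
          simp [forArcs, Program.collect, Instr.iw, h4, h5])).trans hv
        have hpe : τ'.iarr 7 p = N.eid p := by
          rw [h7]; exact hS'.eid (σ.ireg x) p (by simp [hl])
        refine (Runs.of_wp (Q := fun υ => ∀ i, υ.iarr arr i = if i = σ.ireg x ∨ ∃ q ∈ l1 ++ [p],
          N.eid q = i then σ.ireg val else σ.iarr arr i) ?_).mono fun t τ _ _ h => h
        simp only [wp, Instr.eval, Instr.Safe, Function.update_self, hp, hpe, true_and,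
          Function.update_of_ne h5, hval]
        intro i
        simp only [List.mem_append, List.mem_singleton, or_and_right, exists_or, exists_eq_left]
        by_cases hi : i = N.eid p
        · simp [hi]
        · rw [Function.update_of_ne hi, hinv]
          simp [Ne.symm hi])
    refine hfor.mono fun t υ _ _ h => ⟨?_, fun i => ?_⟩
    · have := h.1
      simp only [Program.cost] at hs
      omega
    · rw [h.2 i]
      simp only [Net.mem_star]

end Algo

end RealRAM

/-! ### Selecting elements at the branching vertices and blocking their conflicts -/

namespace RealRAM

local infixr:60 " ⨾ " => Program.seq
local prefix:max "◇" => Program.instr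

/-- The memory holds the graph `N`, the branching vertices and the linear arrangement. -/
structure Held (N : Net) (xs s : ℕ → ℕ) (p L : ℕ) (σ : State) : Prop extends Static N σ where
  r8 : σ.ireg 8 = p
  r9 : σ.ireg 9 = L
  a10 : σ.iarr 10 = xs
  a11 : σ.iarr 11 = s

/-- The program does not write the locations of `Held`. -/
abbrev Program.KeepsHeld (p : Program) : Prop :=
  p.Keeps ∧ 8 ∉ p.iw ∧ 9 ∉ p.iw ∧ 10 ∉ p.aw ∧ 11 ∉ p.aw

theorem Held.frame {N : Net} {xs s : ℕ → ℕ} {p L : ℕ} {σ τ : State} {P : Program}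
    (hS : Held N xs s p L σ) (h : Frame P σ τ) (hp : P.KeepsHeld) : Held N xs s p L τ := by
  obtain ⟨h0, h1, h2, h3, h4⟩ := hp
  exact { hS.toStatic.frame h h0 with
    r8 := (h.ireg _ h1).trans hS.r8
    r9 := (h.ireg _ h2).trans hS.r9
    a10 := (h.iarr _ h3).trans hS.a10
    a11 := (h.iarr _ h4).trans hS.a11 }

/-- The elements with stars at the first `p` branching vertices or among the first `L` entries
of the linear arrangement. -/
def Span (N : Net) (xs s : ℕ → ℕ) (p L i : ℕ) : Prop :=
  i ∈ N.els (Net.verts xs p) ∨ ∃ k < L, s k = i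

/-- The register value of digit `d` at vertex `x`. -/
def optVal (N : Net) (x d : ℕ) : ℕ := if d = 0 then 2 * N.m + 1 else (N.adj x).getD (d - 1) 0

/-- The codes `2 * N.m + 1`, the arc numbers from `1` to `2 * N.m`, and `0` are distinct, so
comparisons with registers `7` and `2` separate the three kinds of options. -/
theorem optVal_cases (N : Net) (x d : ℕ) :
    (d = 0 ∧ optVal N x d = 2 * N.m + 1 ∧ N.pick x d = {x}) ∨
      (∃ q ∈ N.adj x, optVal N x d = q ∧ N.pick x d = {N.eid q}) ∨
      ((N.adj x).length < d ∧ optVal N x d = 0 ∧ N.pick x d = ∅) := by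
  cases d with
  | zero => exact Or.inl ⟨rfl, rfl, Net.pick_zero⟩
  | succ d =>
    by_cases h : d < (N.adj x).length
    · refine Or.inr (Or.inl ⟨(N.adj x)[d], List.getElem_mem h, ?_, Net.pick_arc h⟩)
      simp [optVal, h]
    · refine Or.inr (Or.inr ⟨by omega, ?_, Net.pick_last (by omega)⟩)
      simp [optVal, not_lt.1 h]

namespace Algo

open scoped Classical

variable {W : ℕ} {N : Net} {σ : State} {xs s d : ℕ → ℕ} {p L K : ℕ}

/-- Clearing is confined to `Span`, so that its cost is that of the current group and not of the
whole graph. Elsewhere array `13` may hold stale marks, and array `14` holds the solutions of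
earlier components. -/
theorem runs_clearGroup {arr : ℕ} (harr : arr = 13 ∨ arr = 14) (hH : Held N xs s p L σ)
    (hK : ∀ k < p, (N.adj (xs k)).length ≤ K) :
    Runs W (clearGroup arr) σ fun t τ => t ≤ (4 * K + 6) * p + 4 * L + 4 ∧
      ∀ i, τ.iarr arr i = if Span N xs s p L i then 0 else σ.iarr arr i := by
  have h1 : Runs W (forUp 10 8 (◇(.load 11 10 10) ⨾ markStar arr 11 2)) σ fun t τ =>
      t ≤ (4 * K + 6) * p + 2 ∧ ∀ i, τ.iarr arr i =
        if i ∈ N.els (Net.verts xs p) then 0 else σ.iarr arr i := by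
    refine Runs.forUp (4 * K + 4) (fun k τ => ∀ i, τ.iarr arr i =
        if i ∈ N.els (Net.verts xs k) then 0 else σ.iarr arr i) hH.r3 hH.r8
        (by rcases harr with rfl | rfl <;> decide) (fun k τ x h => h)
        (by simp [Net.els, Net.verts]) ?_
    intro k τ hk hfr hfit hi hinv
    have hH' : Held N xs s p L τ := hH.frame hfr (by rcases harr with rfl | rfl <;> decide)
    refine Runs.seq_wp (R := fun τ' => τ'.ireg 11 = xs k) ?_ ?_
    · simp [wp, Instr.eval, Instr.Safe, hi, hH'.a10]
    · intro t τ' ht hfr' hfit' hx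
      have hH2 : Held N xs s p L τ' := hH'.frame hfr' (by decide)
      refine (runs_markStar hH2.toStatic (by rcases harr with rfl | rfl <;> decide)).mono ?_
      intro t' υ _ _ h
      rw [hx] at h
      refine ⟨?_, fun i => ?_⟩
      · have := hK k hk
        have := h.1
        simp only [Program.cost] at ht
        omega
      · rw [h.2 i, hH2.r2, hfr'.iarr arr (by rcases harr with rfl | rfl <;> decide), hinv i,
          Net.verts_succ]
        by_cases h1 : i ∈ N.star (xs k) <;> by_cases h2 : i ∈ N.els (Net.verts xs k) <;>
          simp_all [Net.mem_els]
  refine h1.seq fun t τ hfr hfit h => ?_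
  have hH' : Held N xs s p L τ := hH.frame hfr (by rcases harr with rfl | rfl <;> decide)
  refine (Runs.forUp 2 (fun k τ' => ∀ i, τ'.iarr arr i =
      if (∃ l < k, s l = i) then 0 else τ.iarr arr i) hH'.r3 hH'.r9
      (by rcases harr with rfl | rfl <;> decide) (fun k τ x h => h) (by simp) ?_).mono ?_
  · intro k τ' hk hfr' hfit' hi hinv
    have hH2 : Held N xs s p L τ' := hH'.frame hfr' (by rcases harr with rfl | rfl <;> decide)
    refine (Runs.of_wp (Q := fun υ => ∀ i, υ.iarr arr i =
      if (∃ l < k + 1, s l = i) then 0 else τ.iarr arr i) ?_).mono fun t τ _ _ h => h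
    simp only [wp, Instr.eval, Instr.Safe, Function.update_self, hi, hH2.a11, true_and]
    intro i
    rw [Function.update_of_ne (show 2 ≠ 11 by decide), hH2.r2, Function.update_apply, hinv]
    by_cases hik : i = s k
    · rw [if_pos hik, if_pos ⟨k, by omega, hik.symm⟩]
    · rw [if_neg hik]
      refine if_congr ⟨fun ⟨l, h1, h2⟩ => ⟨l, by omega, h2⟩, fun ⟨l, h1, h2⟩ => ⟨l, ?_, h2⟩⟩ rfl rfl
      rcases Nat.lt_succ_iff_lt_or_eq.1 h1 with h | rfl
      · exact h
      · exact absurd h2.symm hik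
  · intro t' υ _ _ h'
    refine ⟨by have := h.1; have := h'.1; omega, fun i => ?_⟩
    rw [h'.2 i, h.2 i]
    unfold Span
    by_cases h3 : ∃ k < L, s k = i
    · rw [if_pos h3, if_pos (Or.inr h3)]
    · rw [if_neg h3]
      simp only [h3, or_false]

/-- Once the star of `x` is marked, `conf_vertex` leaves the neighbours of `x` to be marked, and
`conf_edge` the star of the other endpoint. -/
theorem runs_blockConflicts {x e : ℕ} (hS : Static N σ) (hx : σ.ireg 11 = x) (hxn : x < N.n)
    (ho : (σ.ireg 17 = 2 * N.m + 1 ∧ e = x) ∨ ∃ q ∈ N.adj x, σ.ireg 17 = q ∧ e = N.eid q)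
    (hK : ∀ v, v = x ∨ N.Nbr x v → (N.adj v).length ≤ K) :
    Runs W blockConflicts σ fun t τ => t ≤ 8 * K + 8 ∧
      ∀ i, τ.iarr 13 i = if N.Conf e i then 1 else σ.iarr 13 i := by
  refine (runs_markStar hS (by decide)).seq fun t τ hfr hfit h => ?_
  have hS' : Static N τ := hS.frame hfr (by decide)
  have h17 : τ.ireg 17 = σ.ireg 17 := hfr.ireg _ (by decide)
  have h11 : τ.ireg 11 = x := (hfr.ireg _ (by decide)).trans hx
  have hKx := hK x (Or.inl rfl)
  rw [hx] at h
  have ht := h.1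
  have h2 := h.2
  rw [hS.r3] at h2
  refine Runs.ite (fun hb => ?_) (fun hb => ?_)
  · obtain ⟨-, rfl⟩ : σ.ireg 17 = 2 * N.m + 1 ∧ e = x := by
      rcases ho with ho | ⟨q, hq, ho, _⟩
      · exact ho
      · have := (N.mem_adj.1 hq).2.1
        simp only [Test.Holds, h17, hS'.r7] at hb
        omega
    refine (Runs.forArcs (l := N.adj e) 2 (fun l τ' => ∀ i, τ'.iarr 13 i =
      if ∃ q ∈ l, N.tgt q = i then 1 else τ.iarr 13 i) hS'.r2 (by rw [h11]; exact hS'.head _)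
      (fun l1 p l2 h => hS'.next_arc _ _ _ h) (by decide) (fun l τ' _ h => h) (by simp) ?_).mono ?_
    · intro l1 q l2 τ' hl hfr' hfit' hq hinv
      have hS2 : Static N τ' := hS'.frame hfr' (by decide)
      have htgt : τ'.iarr 6 q = N.tgt q := hS2.tgt e q (by simp [hl])
      refine (Runs.of_wp (Q := fun υ => ∀ i, υ.iarr 13 i = if ∃ q' ∈ l1 ++ [q], N.tgt q' = i then 1
        else τ.iarr 13 i) ?_).mono fun t τ _ _ h => h
      simp only [wp, Instr.eval, Instr.Safe, Function.update_self, hq, htgt, true_and]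
      intro i
      rw [Function.update_of_ne (show 3 ≠ 13 by decide), hS2.r3]
      simp only [List.mem_append, List.mem_singleton, or_and_right, exists_or, exists_eq_left]
      by_cases hi : i = N.tgt q
      · simp [hi]
      · rw [Function.update_of_ne hi, hinv]
        simp [Ne.symm hi]
    · intro t' υ _ _ h'
      refine ⟨by have := h'.1; omega, fun i => ?_⟩
      rw [h'.2 i, h2 i]
      have := Net.conf_vertex (j := i) hxn
      by_cases h3 : ∃ q ∈ N.adj e, N.tgt q = i
      · rw [if_pos h3, if_pos (this.2 (Or.inr h3))]
      · rw [if_neg h3]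
        refine if_congr ⟨fun h4 => this.2 (Or.inl h4), fun h4 => ?_⟩ rfl rfl
        exact (this.1 h4).resolve_right h3
  · obtain ⟨q, hq, hoq, rfl⟩ : ∃ q ∈ N.adj x, σ.ireg 17 = q ∧ e = N.eid q := by
      rcases ho with ho | ho
      · simp only [Test.Holds, h17, hS'.r7] at hb
        exact absurd ho.1 hb
      · exact ho
    refine Runs.seq_wp (R := fun τ' => τ'.ireg 13 = N.tgt q) ?_ ?_
    · simp [wp, Instr.eval, Instr.Safe, h17, hoq, hS'.tgt x q hq]
    · intro t1 τ' ht1 hfr' hfit' h13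
      have hS2 : Static N τ' := hS'.frame hfr' (by decide)
      refine (runs_markStar hS2 (by decide)).mono ?_
      intro t' υ _ _ h'
      rw [h13] at h'
      have hKq := hK (N.tgt q) (Or.inr ⟨q, hq, rfl⟩)
      refine ⟨by have := h'.1; simp only [Program.cost] at ht1; omega, fun i => ?_⟩
      rw [h'.2 i, hfr'.iarr 13 (by decide), h2 i, hS2.r3]
      have := Net.conf_edge (j := i) hq
      by_cases h3 : i ∈ N.star (N.tgt q)
      · rw [if_pos h3, if_pos (this.2 (Or.inr h3))]
      · rw [if_neg h3]
        refine if_congr ⟨fun h4 => this.2 (Or.inl h4), fun h4 => ?_⟩ rfl rfl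
        exact (this.1 h4).resolve_right h3

/-- The registers `19`, `2` and the array `13` describe the selection at the first `k` branching
vertices. -/
def Selected (N : Net) (xs s d : ℕ → ℕ) (p L k : ℕ) (σ : State) : Prop :=
  (σ.ireg 19 = 1 ∧ N.Valid xs d k ∧ σ.rreg 2 = ∑ i ∈ N.chosen xs d k, N.w i ∧
    ∀ i, Span N xs s p L i → (σ.iarr 13 i = 1 ↔ ∃ c ∈ N.chosen xs d k, N.Conf c i)) ∨
  (σ.ireg 19 = 0 ∧ ¬ N.Valid xs d k)

theorem wp_loadElement {x e o : ℕ} (hS : Static N σ) (hx : σ.iarr 10 (σ.ireg 10) = x)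
    (ho' : σ.ireg 17 = o)
    (ho : (o = 2 * N.m + 1 ∧ e = x) ∨ ∃ q ∈ N.adj x, o = q ∧ e = N.eid q) :
    wp W loadElement (fun τ => τ.ireg 11 = x ∧ τ.ireg 16 = e ∧ τ.ireg 17 = o) σ := by
  simp only [loadElement, wp, Instr.eval, Instr.Safe, Test.Holds, Function.update_apply, true_and]
  refine ⟨fun h => ?_, fun h => ?_⟩
  · simp only [Nat.reduceEqDiff, if_false, ho', hS.r7] at h
    rcases ho with ho | ⟨q, hq, ho, _⟩
    · simp [ho', hx, ho.2]
    · have := (N.mem_adj.1 hq).2.1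
      omega
  · simp only [Nat.reduceEqDiff, if_false, ho', hS.r7] at h
    rcases ho with ho | ⟨q, hq, ho, he⟩
    · exact absurd ho.1 h
    · simp [ho', hx, ho, he, hS.eid x q hq]

/-- Array `13` records the conflicts with all earlier choices, so a single look-up decides validity.
After a first conflict register `19` stays `0` and the other data become irrelevant. -/
theorem runs_selectStep {k : ℕ} (hH : Held N xs s p L σ) (hk : k < p) (hi : σ.ireg 10 = k)
    (hopt : σ.iarr 12 k = optVal N (xs k) (d k)) (hxn : xs k < N.n)
    (hK : ∀ v, v = xs k ∨ N.Nbr (xs k) v → (N.adj v).length ≤ K)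
    (hsel : Selected N xs s d p L k σ) :
    Runs W selectStep σ fun t τ => t ≤ 8 * K + 20 ∧ Selected N xs s d p L (k + 1) τ := by
  refine Runs.seq_wp (R := fun τ => τ.ireg 17 = optVal N (xs k) (d k)) ?_ ?_
  · simp [wp, Instr.eval, Instr.Safe, hi, hopt]
  intro t1 τ1 ht1 hfr1 hfit1 h17
  have hH1 : Held N xs s p L τ1 := hH.frame hfr1 (by decide)
  have hsel1 : Selected N xs s d p L k τ1 := by
    unfold Selected
    rw [hfr1.ireg 19 (by decide), hfr1.rreg 2 (by decide), hfr1.iarr 13 (by decide)]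
    exact hsel
  have hcost1 : t1 ≤ 1 := ht1
  refine Runs.ite (fun hb => ?_) (fun hb => ?_)
  · simp only [Test.Holds, hH1.r2] at hb
    rw [h17] at hb
    refine (Runs.of_wp (Q := fun τ => τ = τ1) (by simp [wp, Instr.eval, Instr.Safe])).mono ?_
    rintro t2 τ2 _ _ ⟨ht2, rfl⟩
    have hcost2 : t2 ≤ 1 := ht2
    refine ⟨by omega, ?_⟩
    have hpick : N.pick (xs k) (d k) = ∅ := by
      rcases optVal_cases N (xs k) (d k) with ⟨_, h, _⟩ | ⟨q, hq, h, _⟩ | h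
      · omega
      · have := (N.mem_adj.1 hq).1; omega
      · exact h.2.2
    unfold Selected
    rw [Net.valid_succ, Net.chosen_succ, hpick, Finset.union_empty]
    simpa [Selected] using hsel1
  · simp only [Test.Holds, hH1.r2] at hb
    obtain ⟨e, he, hpick⟩ : ∃ e, ((optVal N (xs k) (d k) = 2 * N.m + 1 ∧ e = xs k) ∨
        ∃ q ∈ N.adj (xs k), optVal N (xs k) (d k) = q ∧ e = N.eid q) ∧
        N.pick (xs k) (d k) = {e} := by
      rcases optVal_cases N (xs k) (d k) with ⟨_, h, h'⟩ | ⟨q, hq, h, h'⟩ | h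
      · exact ⟨xs k, Or.inl ⟨h, rfl⟩, h'⟩
      · exact ⟨N.eid q, Or.inr ⟨q, hq, h, rfl⟩, h'⟩
      · rw [h17] at hb; exact absurd h.2.1 hb
    have hestar : e ∈ N.star (xs k) := by
      apply Net.pick_subset_star (d := d k); simp [hpick]
    have hspan : Span N xs s p L e := Or.inl (Net.mem_els.2
      ⟨xs k, Finset.mem_image_of_mem _ (Finset.mem_range.2 hk), hestar⟩)
    refine Runs.seq_wp (wp_loadElement hH1.toStatic (by rw [hfr1.ireg 10 (by decide), hi, hH1.a10])
      h17 he) ?_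
    rintro t2 τ2 ht2 hfr2 hfit2 ⟨h11, h16, h17'⟩
    have hcost2 : t2 ≤ 3 := ht2
    refine Runs.seq_wp (R := fun τ => τ.ireg 18 = τ2.iarr 13 e) ?_ ?_
    · simp [wp, Instr.eval, Instr.Safe, h16]
    intro t3 τ3 ht3 hfr3 hfit3 h18
    have hcost3 : t3 ≤ 1 := ht3
    have hH3 : Held N xs s p L τ3 := (hH1.frame hfr2 (by decide)).frame hfr3 (by decide)
    have h13 : τ3.iarr 13 = τ1.iarr 13 :=
      (hfr3.iarr 13 (by decide)).trans (hfr2.iarr 13 (by decide))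
    have h19 : τ3.ireg 19 = τ1.ireg 19 :=
      (hfr3.ireg 19 (by decide)).trans (hfr2.ireg 19 (by decide))
    have hr2 : τ3.rreg 2 = τ1.rreg 2 :=
      (hfr3.rreg 2 (by decide)).trans (hfr2.rreg 2 (by decide))
    have h18' : τ3.ireg 18 = τ1.iarr 13 e := by rw [h18, hfr2.iarr 13 (by decide)]
    have h11' : τ3.ireg 11 = xs k := (hfr3.ireg 11 (by decide)).trans h11
    have h16' : τ3.ireg 16 = e := (hfr3.ireg 16 (by decide)).trans h16
    have h17'' : τ3.ireg 17 = optVal N (xs k) (d k) := (hfr3.ireg 17 (by decide)).trans h17'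
    refine Runs.ite (fun hb' => ?_) (fun hb' => ?_)
    · simp only [Test.Holds, hH3.r3, h18'] at hb'
      refine (Runs.of_wp (Q := fun τ => τ.ireg 19 = 0)
        (by simp [wp, Instr.eval, Instr.Safe, hH3.r2])).mono ?_
      rintro t4 τ4 _ _ ⟨ht4, h19'⟩
      have hcost4 : t4 ≤ 1 := ht4
      refine ⟨by omega, Or.inr ⟨h19', ?_⟩⟩
      rw [Net.valid_succ]
      rintro ⟨hv, hno⟩
      rcases hsel1 with ⟨_, _, _, hblk⟩ | ⟨_, hnv⟩
      · obtain ⟨c, hc, hconf⟩ := (hblk e hspan).1 hb'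
        exact hno c hc e (by simp [hpick]) hconf
      · exact hnv hv
    · simp only [Test.Holds, hH3.r3, h18'] at hb'
      refine Runs.seq_wp (R := fun τ => τ.rreg 3 = N.w e) ?_ ?_
      · simp [wp, Instr.eval, Instr.Safe, h16', hH3.w]
      intro t4 τ4 ht4 hfr4 hfit4 hr3
      have hcost4 : t4 ≤ 1 := ht4
      refine Runs.seq_wp (R := fun τ => τ.rreg 2 = τ1.rreg 2 + N.w e) ?_ ?_
      · simp [wp, Instr.eval, Instr.Safe, hr3, hfr4.rreg 2 (by decide), hr2]
      intro t5 τ5 ht5 hfr5 hfit5 hr2'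
      have hcost5 : t5 ≤ 1 := ht5
      have hH5 : Held N xs s p L τ5 := (hH3.frame hfr4 (by decide)).frame hfr5 (by decide)
      refine (runs_blockConflicts (x := xs k) (e := e) (K := K) hH5.toStatic
        (by rw [hfr5.ireg 11 (by decide), hfr4.ireg 11 (by decide), h11']) hxn
        (by rw [hfr5.ireg 17 (by decide), hfr4.ireg 17 (by decide), h17'']; exact he) hK).mono ?_
      rintro t6 τ6 hfr6 _ ⟨ht6, h6⟩
      refine ⟨by omega, ?_⟩
      have h19' : τ6.ireg 19 = τ1.ireg 19 := by
        rw [hfr6.ireg 19 (by decide), hfr5.ireg 19 (by decide), hfr4.ireg 19 (by decide), h19]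
      rw [hfr5.iarr 13 (by decide), hfr4.iarr 13 (by decide), h13] at h6
      rcases hsel1 with ⟨hok, hv, hsum, hblk⟩ | ⟨hok, hnv⟩
      · have hvalid : N.Valid xs d (k + 1) := by
          rw [Net.valid_succ]
          refine ⟨hv, fun i hi j hj hc => ?_⟩
          rw [hpick, Finset.mem_singleton] at hj
          subst hj
          exact hb' ((hblk _ hspan).2 ⟨i, hi, hc⟩)
        refine Or.inl ⟨h19'.trans hok, hvalid, ?_, fun i hi => ?_⟩
        -- An element of a star conflicts with itself, so a valid selection cannot have chosen `e`
        -- before and its weight is not counted twice.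
        · have hdis : e ∉ N.chosen xs d k := fun hmem =>
            (Net.valid_succ.1 hvalid).2 e hmem e (by simp [hpick])
              (Net.conf_of_star hxn hestar hestar)
          rw [hfr6.rreg 2 (by decide), hr2', hsum, Net.chosen_succ, hpick,
            Finset.sum_union (Finset.disjoint_singleton_right.2 hdis), Finset.sum_singleton]
        · rw [h6 i, Net.chosen_succ, hpick]
          simp only [Finset.mem_union, Finset.mem_singleton, or_and_right, exists_or,
            exists_eq_left]
          by_cases hc : N.Conf e i
          · simp [hc]
          · simp only [hc, if_false, or_false]
            exact hblk i hi
      · exact Or.inr ⟨h19'.trans hok, fun h => hnv (Net.valid_succ.1 h).1⟩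

theorem runs_select (hH : Held N xs s p L σ)
    (hopt : ∀ k < p, σ.iarr 12 k = optVal N (xs k) (d k)) (hxn : ∀ k < p, xs k < N.n)
    (hK : ∀ k < p, ∀ v, v = xs k ∨ N.Nbr (xs k) v → (N.adj v).length ≤ K) :
    Runs W select σ fun t τ => t ≤ (12 * K + 30) * p + 4 * L + 8 ∧ Selected N xs s d p L p τ := by
  refine (runs_clearGroup (Or.inl rfl) hH fun k hk => hK k hk _ (Or.inl rfl)).seq ?_
  rintro t1 τ1 hfr1 hfit1 ⟨ht1, h1⟩
  have hH1 : Held N xs s p L τ1 := hH.frame hfr1 (by decide)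
  refine Runs.seq_wp (R := fun τ => τ.ireg 19 = 1) (by simp [wp, Instr.eval, Instr.Safe, hH1.r3]) ?_
  intro t2 τ2 ht2 hfr2 hfit2 h19
  have hH2 : Held N xs s p L τ2 := hH1.frame hfr2 (by decide)
  refine Runs.seq_wp (R := fun τ => τ.rreg 2 = 0) (by simp [wp, Instr.eval, Instr.Safe, hH2.rz]) ?_
  intro t3 τ3 ht3 hfr3 hfit3 hr2
  have hH3 : Held N xs s p L τ3 := hH2.frame hfr3 (by decide)
  have hcost2 : t2 ≤ 1 := ht2
  have hcost3 : t3 ≤ 1 := ht3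
  refine (Runs.forUp (8 * K + 20) (fun k τ => Selected N xs s d p L k τ) hH3.r3 hH3.r8 (by decide)
    (fun k τ x h => by simpa [Selected, State.setI] using h) ?_ ?_).mono ?_
  · refine Or.inl ⟨by rw [hfr3.ireg 19 (by decide), h19], Net.valid_zero, ?_, fun i hi => ?_⟩
    · simp [hr2, Net.chosen_zero]
    · rw [hfr3.iarr 13 (by decide), hfr2.iarr 13 (by decide), h1 i, if_pos hi]
      simp [Net.chosen_zero]
  · intro k τ hk hfr hfit hi hinv
    refine runs_selectStep (hH3.frame hfr (by decide)) hk hi ?_ (hxn k hk) (hK k hk) hinv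
    rw [hfr.iarr 12 (by decide), hfr3.iarr 12 (by decide), hfr2.iarr 12 (by decide),
      hfr1.iarr 12 (by decide)]
    exact hopt k hk
  · rintro t4 τ4 _ _ ⟨ht4, h4⟩
    refine ⟨?_, h4⟩
    have : (12 * K + 30) * p = (4 * K + 6) * p + (8 * K + 20 + 2) * p + 2 * p := by ring
    omega

end Algo

end RealRAM

/-! ### The linear recursion and the evaluation of one selection -/

namespace RealRAM

local infixr:60 " ⨾ " => Program.seq
local prefix:max "◇" => Program.instr

namespace Algo

open scoped Classical

variable {W : ℕ} {N : Net} {σ : State} {xs s d : ℕ → ℕ} {p L K : ℕ}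

theorem wp_linStep {k : ℕ} {C : Finset ℕ} (hH : Held N xs s p L σ) (hk : k < L)
    (hi : σ.ireg 20 = k) (hL : L ≤ W) (hblk : σ.iarr 13 (s k) = 1 ↔ ¬ N.Free s C k)
    (h3 : ∀ j ≤ k, σ.rarr 3 j = N.completionWeight s j C)
    (h15 : ∀ j < k, σ.iarr 15 j = if Takes (fun k => N.w (s k)) (N.Free s C) j then 1 else 0) :
    wp W linStep (fun τ => (∀ j ≤ k + 1, τ.rarr 3 j = N.completionWeight s j C) ∧
      ∀ j < k + 1, τ.iarr 15 j = if Takes (fun k => N.w (s k)) (N.Free s C) j then 1 else 0) σ := by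
  -- Cell `k + 1` is written before cell `k - 2` is read; the two never coincide.
  have hk2 : Function.update (σ.rarr 3) (k + 1) (σ.rarr 3 k) (k - 2) =
      N.completionWeight s (k - 2) C := by
    rw [Function.update_of_ne (by omega), h3 _ (by omega)]
  have hkk := h3 k le_rfl
  have aux : ∀ (x : ℝ) (y : ℕ), x = N.completionWeight s (k + 1) C →
      (y = if Takes (fun k => N.w (s k)) (N.Free s C) k then 1 else 0) →
      (∀ j ≤ k + 1, Function.update (σ.rarr 3) (k + 1) x j = N.completionWeight s j C) ∧
      ∀ j < k + 1, Function.update (σ.iarr 15) k y j =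
        if Takes (fun k => N.w (s k)) (N.Free s C) j then 1 else 0 := by
    intro x y hx hy
    refine ⟨fun j hj => ?_, fun j hj => ?_⟩
    · rcases Nat.lt_or_ge k j with h | h
      · obtain rfl : j = k + 1 := by omega
        rw [Function.update_self, hx]
      · rw [Function.update_of_ne (by omega), h3 j h]
    · rcases Nat.lt_succ_iff_lt_or_eq.1 hj with h | rfl
      · rw [Function.update_of_ne (by omega), h15 j h]
      · rw [Function.update_self, hy]
  simp only [linStep, wp, Instr.eval, Instr.Safe, Test.Holds, hi, hH.r2, hH.r3, hH.r4, hH.a11,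
    hH.w, Function.update_self, ne_eq, not_false_eq_true,
    Function.update_of_ne, Nat.reduceEqDiff, hk2, true_and,
    Function.update_idem]
  refine ⟨by omega, fun hb => ?_, fun hb => ⟨fun hlt => ?_, fun hlt => ?_⟩⟩
  · have hnt : ¬ Takes (fun k => N.w (s k)) (N.Free s C) k := fun h => hblk.1 hb h.1
    exact aux _ _ (by rw [hkk]; exact (lin_succ_of_not_takes hnt).symm) (by rw [if_neg hnt])
  · have ht : Takes (fun k => N.w (s k)) (N.Free s C) k :=
      ⟨by_contra fun h => hb (hblk.2 h), by rw [hkk] at hlt; exact hlt⟩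
    exact aux _ _ (lin_succ_of_takes ht).symm (by rw [if_pos ht])
  · have hnt : ¬ Takes (fun k => N.w (s k)) (N.Free s C) k := fun h => hlt (by
      rw [hkk]; exact h.2)
    exact aux _ _ (by rw [hkk]; exact (lin_succ_of_not_takes hnt).symm) (by rw [if_neg hnt])

theorem runs_linear {C : Finset ℕ} (hH : Held N xs s p L σ)
    (hblk : ∀ k < L, (σ.iarr 13 (s k) = 1 ↔ ¬ N.Free s C k)) :
    Runs W linear σ fun t τ => t ≤ 16 * L + 5 ∧
      τ.rreg 6 = σ.rreg 2 + N.completionWeight s L C ∧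
      ∀ j < L, τ.iarr 15 j = if Takes (fun k => N.w (s k)) (N.Free s C) j then 1 else 0 := by
  refine Runs.of_fits fun hfit0 => ?_
  have hLW : L ≤ W := hH.r9 ▸ hfit0.1 9
  refine Runs.seq_wp (R := fun τ => τ.rarr 3 0 = 0) ?_ ?_
  · simp [wp, Instr.eval, Instr.Safe, hH.r2, hH.rz]
  intro t1 τ1 ht1 hfr1 _ h1
  have hH1 : Held N xs s p L τ1 := hH.frame hfr1 (by decide)
  have hcost1 : t1 ≤ 1 := ht1
  have hfor := Runs.forUp (W := W) (σ := τ1) (body := linStep) (i := 20) (lim := 9) 14 (fun k τ =>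
    (∀ j ≤ k, τ.rarr 3 j = N.completionWeight s j C) ∧
      ∀ j < k, τ.iarr 15 j = if Takes (fun k => N.w (s k)) (N.Free s C) j then 1 else 0)
    hH1.r3 hH1.r9 (by decide) (fun k τ x h => h)
    ⟨fun j hj => by obtain rfl : j = 0 := by omega
                    rw [h1]; exact lin_zero.symm, fun j hj => by omega⟩
    (fun k τ hk hfr _ hi hinv => by
      have hH2 : Held N xs s p L τ := hH1.frame hfr (by decide)
      refine (Runs.of_wp (wp_linStep hH2 hk hi hLW ?_ hinv.1 hinv.2)).mono fun t τ _ _ h => h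
      rw [hfr.iarr 13 (by decide), hfr1.iarr 13 (by decide)]
      exact hblk k hk)
  refine hfor.seq fun t2 τ2 hfr2 _ h2 => ?_
  have hH2 : Held N xs s p L τ2 := hH1.frame hfr2 (by decide)
  refine Runs.seq_wp (R := fun τ => τ.rreg 4 = N.completionWeight s L C) ?_ ?_
  · simp [wp, Instr.eval, Instr.Safe, hH2.r9, h2.2.1 L le_rfl]
  intro t3 τ3 ht3 hfr3 _ h3
  have hcost3 : t3 ≤ 1 := ht3
  refine Runs.instr trivial ⟨by have := h2.1; omega, ?_, ?_⟩
  · simp [Instr.eval, h3, hfr3.rreg 2 (by decide), hfr2.rreg 2 (by decide),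
      hfr1.rreg 2 (by decide)]
  · intro j hj
    rw [← h2.2.2 j hj]
    simp only [Instr.eval]
    rw [hfr3.iarr 15 (by decide)]

theorem runs_saveSelected (hH : Held N xs s p L σ)
    (hopt : ∀ k < p, σ.iarr 12 k = optVal N (xs k) (d k)) :
    Runs W saveSelected σ fun t τ => t ≤ 8 * p + 2 ∧
      ∀ i, τ.iarr 14 i = if i ∈ N.chosen xs d p then 1 else σ.iarr 14 i := by
  refine Runs.forUp 6 (fun k τ => ∀ i, τ.iarr 14 i = if i ∈ N.chosen xs d k then 1
    else σ.iarr 14 i) hH.r3 hH.r8 (by decide) (fun k τ x h => h) (by simp [Net.chosen_zero]) ?_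
  intro k τ hk hfr _ hi hinv
  have hH1 : Held N xs s p L τ := hH.frame hfr (by decide)
  have h12 : τ.iarr 12 k = optVal N (xs k) (d k) := by rw [hfr.iarr 12 (by decide), hopt k hk]
  refine (Runs.of_wp (Q := fun υ => ∀ i, υ.iarr 14 i = if i ∈ N.chosen xs d (k + 1) then 1
    else σ.iarr 14 i) ?_).mono fun t τ _ _ h => h
  have aux : ∀ e, N.pick (xs k) (d k) = {e} → ∀ i, Function.update (τ.iarr 14) e 1 i =
      if i ∈ N.chosen xs d (k + 1) then 1 else σ.iarr 14 i := by
    intro e he i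
    rw [Net.chosen_succ, he, Function.update_apply, hinv i]
    by_cases hie : i = e <;> simp [hie]
  simp only [loadElement, wp, Instr.eval, Instr.Safe, Test.Holds, hi, hH1.r2, hH1.r3, hH1.r7,
    hH1.a10, h12, Function.update_self, ne_eq, not_false_eq_true, Function.update_of_ne,
    Nat.reduceEqDiff, true_and]
  rcases optVal_cases N (xs k) (d k) with ⟨_, h, hpick⟩ | ⟨q, hq, h, hpick⟩ | ⟨_, h, hpick⟩
  · rw [h]
    exact ⟨fun hb => by omega, fun _ => ⟨fun _ => aux _ hpick, fun hb => absurd rfl hb⟩⟩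
  · rw [h]
    have hq' := N.mem_adj.1 hq
    refine ⟨fun hb => by omega, fun _ => ⟨fun hb => by omega, fun _ => ?_⟩⟩
    rw [hH1.eid _ q hq]
    exact aux _ hpick
  · rw [h]
    refine ⟨fun _ i => ?_, fun hb => absurd rfl hb⟩
    rw [hinv i, Net.chosen_succ, hpick, Finset.union_empty]

theorem runs_saveLinear {C : Finset ℕ} (hH : Held N xs s p L σ)
    (h15 : ∀ j < L, σ.iarr 15 j = if Takes (fun k => N.w (s k)) (N.Free s C) j then 1 else 0) :
    Runs W saveLinear σ fun t τ => t ≤ 7 * L + 2 ∧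
      ∀ i, τ.iarr 14 i = if i ∈ (N.completion s L C).image s then 1 else σ.iarr 14 i := by
  refine Runs.seq_wp (R := fun τ => τ.ireg 20 = L) (by simp [wp, Instr.eval, Instr.Safe, hH.r9]) ?_
  intro t1 τ1 ht1 hfr1 _ h1
  have hcost1 : t1 ≤ 1 := ht1
  have hH1 : Held N xs s p L τ1 := hH.frame hfr1 (by decide)
  -- `D` holds the positions already written and `k` is where the trace continues. A round costs six
  -- units and a test; seven units per position pay for it, since every round passes at least one
  -- position.
  refine (Runs.loop (W := W) (p := traceStep) (b := .ilt 2 20)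
    (Inv := fun q τ => ∃ k D, τ.ireg 20 = k ∧ k ≤ L ∧ q = 7 * k ∧
      D ∪ N.completion s k C = N.completion s L C ∧
      ∀ i, τ.iarr 14 i = if i ∈ D.image s then 1 else σ.iarr 14 i) (7 * L)
    ⟨L, ∅, h1, le_rfl, rfl, by simp, by simp [hfr1.iarr 14 (by decide)]⟩ ?_).mono ?_
  · rintro _ τ hfr _ ⟨k, D, hk, hkL, rfl, hD, h14⟩ hb
    have hH2 : Held N xs s p L τ := hH1.frame hfr (by decide)
    simp only [Test.Holds, hH2.r2, hk] at hb
    obtain ⟨k, rfl⟩ : ∃ k', k = k' + 1 := ⟨k - 1, by omega⟩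
    have h15' : τ.iarr 15 k = if Takes (fun k => N.w (s k)) (N.Free s C) k then 1 else 0 := by
      rw [hfr.iarr 15 (by decide), hfr1.iarr 15 (by decide), h15 k (by omega)]
    refine (Runs.of_wp (Q := fun υ => ∃ k' ≤ k, ∃ D, υ.ireg 20 = k' ∧
      D ∪ N.completion s k' C = N.completion s L C ∧
      ∀ i, υ.iarr 14 i = if i ∈ D.image s then 1 else σ.iarr 14 i) ?_).mono ?_
    · simp only [traceStep, wp, Instr.eval, Instr.Safe, Test.Holds, hk, hH2.r3, hH2.r4,
        hH2.a11, h15', Function.update_self, ne_eq, not_false_eq_true, Function.update_of_ne,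
        Nat.reduceEqDiff, true_and, add_tsub_cancel_right]
      by_cases ht : Takes (fun k => N.w (s k)) (N.Free s C) k
      · rw [if_pos ht]
        refine ⟨fun _ => ⟨k - 2, by omega, insert k D, rfl, ?_, fun i => ?_⟩, fun h => absurd rfl h⟩
        · rw [← hD, Net.completion, Net.completion, linTrace_succ_of_takes ht, Finset.insert_union,
            Finset.union_insert]
        · rw [Finset.image_insert, Function.update_apply, h14 i]
          by_cases hi : i = s k <;> simp [hi]
      · rw [if_neg ht]
        refine ⟨fun h => by omega, fun _ => ⟨k, le_rfl, D, rfl, ?_, h14⟩⟩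
        rw [← hD, Net.completion, Net.completion, linTrace_succ_of_not_takes ht]
    · rintro t υ _ _ ⟨ht, k', hk', D', h1, h2, h3⟩
      have hcost : t ≤ 6 := ht
      exact ⟨7 * k', ⟨k', D', h1, by omega, rfl, h2, h3⟩, by omega⟩
  · rintro t υ hfr _ ⟨_, ⟨k, D, hk, _, rfl, hD, h14⟩, hb, ht⟩
    have hH2 : Held N xs s p L υ := hH1.frame hfr (by decide)
    simp only [Test.Holds, hH2.r2, hk] at hb
    obtain rfl : k = 0 := by omega
    refine ⟨by omega, ?_⟩
    rw [← hD]
    simpa [Net.completion, linTrace_zero] using h14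

/-- The weight of the best solution that extends the selection `d`. -/
noncomputable def value (N : Net) (xs s d : ℕ → ℕ) (p L : ℕ) : ℝ :=
  ∑ i ∈ N.chosen xs d p, N.w i + N.completionWeight s L (N.chosen xs d p)

/-- The stored solution is replaced only by a strictly better one. The first alternative also covers
invalid selections, for which its last clause is vacuous. -/
theorem runs_evaluate (hH : Held N xs s p L σ)
    (hopt : ∀ k < p, σ.iarr 12 k = optVal N (xs k) (d k)) (hxn : ∀ k < p, xs k < N.n)
    (hK : ∀ k < p, ∀ v, v = xs k ∨ N.Nbr (xs k) v → (N.adj v).length ≤ K) :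
    Runs W evaluate σ fun t τ => t ≤ (16 * K + 44) * p + 31 * L + 30 ∧
      ((τ.rreg 1 = σ.rreg 1 ∧ τ.iarr 14 = σ.iarr 14 ∧
          (N.Valid xs d p → value N xs s d p L ≤ σ.rreg 1)) ∨
        (N.Valid xs d p ∧ σ.rreg 1 < value N xs s d p L ∧ τ.rreg 1 = value N xs s d p L ∧
          ∀ i, τ.iarr 14 i = if i ∈ N.chosen xs d p ∪
            (N.completion s L (N.chosen xs d p)).image s then 1
            else if Span N xs s p L i then 0 else σ.iarr 14 i)) := by
  have hmul : (16 * K + 44) * p = (12 * K + 30) * p + (4 * K + 6) * p + 8 * p := by ring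
  refine (runs_select hH hopt hxn hK).seq ?_
  rintro t1 τ1 hfr1 _ ⟨ht1, hsel⟩
  have hH1 : Held N xs s p L τ1 := hH.frame hfr1 (by decide)
  refine Runs.ite (fun hb => ?_) (fun hb => ?_)
  · simp only [Test.Holds, hH1.r3] at hb
    obtain ⟨_, hv, hsum, hblk⟩ := hsel.resolve_right fun h => by omega
    refine (runs_linear (C := N.chosen xs d p) hH1 fun k hk => ?_).seq ?_
    · rw [hblk (s k) (Or.inr ⟨k, hk, rfl⟩), Net.Free]
      push Not
      rfl
    rintro t2 τ2 hfr2 _ ⟨ht2, h6, h15⟩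
    have hH2 : Held N xs s p L τ2 := hH1.frame hfr2 (by decide)
    have hr1 : τ2.rreg 1 = σ.rreg 1 := by rw [hfr2.rreg 1 (by decide), hfr1.rreg 1 (by decide)]
    have ha14 : τ2.iarr 14 = σ.iarr 14 := by
      rw [hfr2.iarr 14 (by decide), hfr1.iarr 14 (by decide)]
    have h6' : τ2.rreg 6 = value N xs s d p L := by rw [h6, hsum, value]
    refine Runs.ite (fun hb2 => ?_) (fun hb2 => ?_)
    · simp only [Test.Holds, hr1, h6'] at hb2
      refine Runs.seq_wp (R := fun τ => τ.rreg 1 = value N xs s d p L)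
        (by simp [wp, Instr.eval, Instr.Safe, h6']) ?_
      intro t3 τ3 ht3 hfr3 _ h3
      have hcost3 : t3 ≤ 1 := ht3
      have hH3 : Held N xs s p L τ3 := hH2.frame hfr3 (by decide)
      refine (runs_clearGroup (Or.inr rfl) hH3 fun k hk => hK k hk _ (Or.inl rfl)).seq ?_
      rintro t4 τ4 hfr4 _ ⟨ht4, h4⟩
      have hH4 : Held N xs s p L τ4 := hH3.frame hfr4 (by decide)
      refine (runs_saveSelected (d := d) hH4 fun k hk => ?_).seq ?_
      · rw [hfr4.iarr 12 (by decide), hfr3.iarr 12 (by decide), hfr2.iarr 12 (by decide),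
          hfr1.iarr 12 (by decide), hopt k hk]
      rintro t5 τ5 hfr5 _ ⟨ht5, h5⟩
      have hH5 : Held N xs s p L τ5 := hH4.frame hfr5 (by decide)
      refine (runs_saveLinear (C := N.chosen xs d p) hH5 fun k hk => ?_).mono ?_
      · rw [hfr5.iarr 15 (by decide), hfr4.iarr 15 (by decide), hfr3.iarr 15 (by decide), h15 k hk]
      rintro t6 τ6 hfr6 _ ⟨ht6, h6⟩
      refine ⟨by omega, Or.inr ⟨hv, hb2, ?_, fun i => ?_⟩⟩
      · rw [hfr6.rreg 1 (by decide), hfr5.rreg 1 (by decide), hfr4.rreg 1 (by decide), h3]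
      · rw [h6 i, h5 i, h4 i, hfr3.iarr 14 (by decide), ha14]
        simp only [Finset.mem_union]
        by_cases hc1 : i ∈ N.chosen xs d p <;>
          by_cases hc2 : i ∈ (N.completion s L (N.chosen xs d p)).image s <;> simp [hc1, hc2]
    · simp only [Test.Holds, hr1, h6', not_lt] at hb2
      refine Runs.instr trivial ⟨by omega, Or.inl ⟨hr1, ha14, fun _ => hb2⟩⟩
  · simp only [Test.Holds, hH1.r3] at hb
    refine Runs.instr trivial ⟨by omega, Or.inl ⟨hfr1.rreg 1 (by decide),
      hfr1.iarr 14 (by decide), fun hv => ?_⟩⟩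
    rcases hsel with h | h
    · exact absurd h.1 hb
    · exact absurd hv h.2

end Algo

end RealRAM

/-! ### Enumeration of all selections -/

namespace RealRAM

local infixr:60 " ⨾ " => Program.seq
local prefix:max "◇" => Program.instr

/-- The number of options at branching vertex number `i`. -/
def radix (N : Net) (xs : ℕ → ℕ) (i : ℕ) : ℕ := (N.adj (xs i)).length + 2

/-- Array `12` holds the options given by the digits `d`. -/
structure Digits (N : Net) (xs d : ℕ → ℕ) (p : ℕ) (σ : State) : Prop where
  lt : ∀ k < p, d k < radix N xs k
  opt : ∀ k < p, σ.iarr 12 k = optVal N (xs k) (d k)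

/-- The options at a vertex follow the order of its linked list, so passing to the next one means
following a pointer; the end mark `0` doubles as the option to choose nothing. -/
theorem Static.optVal_succ {N : Net} {σ : State} (hS : Static N σ) {x d : ℕ} (h0 : d ≠ 0)
    (h1 : d ≤ (N.adj x).length) : σ.iarr 5 (optVal N x d) = optVal N x (d + 1) := by
  obtain ⟨d, rfl⟩ := Nat.exists_eq_succ_of_ne_zero h0
  have hd : d < (N.adj x).length := h1
  have hsplit : N.adj x = (N.adj x).take d ++ (N.adj x)[d] :: (N.adj x).drop (d + 1) := by
    rw [← List.drop_eq_getElem_cons hd, List.take_append_drop]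
  have h2 := hS.next x _ _ _ hsplit
  simp only [optVal, Nat.succ_eq_add_one, Nat.add_eq_zero_iff, one_ne_zero, and_false, if_false,
    Nat.add_sub_cancel]
  rw [List.getD_eq_getElem _ _ hd, h2]
  by_cases h3 : d + 1 < (N.adj x).length
  · rw [List.drop_eq_getElem_cons h3, List.headD_cons, List.getD_eq_getElem _ _ h3]
  · rw [List.drop_eq_nil_of_le (by omega), List.getD_eq_default _ _ (by omega), List.headD_nil]

theorem optVal_one (N : Net) (x : ℕ) : optVal N x 1 = (N.adj x).headD 0 := by
  cases h : N.adj x <;> simp [optVal, h]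

namespace Algo

open scoped Classical

variable {W : ℕ} {N : Net} {σ : State} {xs s d : ℕ → ℕ} {p L K : ℕ}

/-- The invariant of `increment`, which started with rank `R`. -/
def Carry (N : Net) (xs : ℕ → ℕ) (p R q : ℕ) (σ : State) : Prop :=
  ∃ d, Digits N xs d p σ ∧
    ((∃ i ≤ p, σ.ireg 10 = i ∧ σ.ireg 24 = p ∧ σ.ireg 23 = 0 ∧ q = 9 * (p - i) ∧
        (∀ l < i, d l = 0) ∧
        mixRank (radix N xs) d p + ∏ l ∈ Finset.range i, radix N xs l = R + 1) ∨
      (σ.ireg 24 = 0 ∧ σ.ireg 23 = 1 ∧ mixRank (radix N xs) d p = R + 1))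

/-- A carry pending at place `i` is counted with its place value, so that rank and carry together
always make `R + 1`. If digit `i` is maximal, resetting it passes the carry on; otherwise raising it
absorbs the carry. Nine units per place pay for the step and its test. -/
theorem runs_incrementStep {R q : ℕ} (hH : Held N xs s p L σ) (hc : Carry N xs p R q σ)
    (hb : (Test.ilt 10 24).Holds σ) (hW : p ≤ W) :
    Runs W incrementStep σ fun t τ => ∃ q', Carry N xs p R q' τ ∧ t + 1 + q' ≤ q := by
  obtain ⟨d, hd, ⟨i, hip, h10, h24, h23, rfl, hz, hR⟩ | ⟨h24, _⟩⟩ := hc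
  swap
  · simp only [Test.Holds, h24] at hb; omega
  simp only [Test.Holds, h24, h10] at hb
  have hopt := hd.opt i hb
  have hlt := hd.lt i hb
  set B := ∏ l ∈ Finset.range i, radix N xs l with hB
  have upd : ∀ v < radix N xs i, ∀ y, y = optVal N (xs i) v → ∀ τ : State,
      τ.iarr 12 = Function.update (σ.iarr 12) i y → Digits N xs (Function.update d i v) p τ := by
    intro v hv y hy τ hτ
    refine ⟨fun k hk => ?_, fun k hk => ?_⟩
    · by_cases hki : k = i
      · subst hki; rwa [Function.update_self]
      · rw [Function.update_of_ne hki]; exact hd.lt k hk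
    · rw [hτ]
      by_cases hki : k = i
      · subst hki; rw [Function.update_self, Function.update_self, hy]
      · rw [Function.update_of_ne hki, Function.update_of_ne hki]; exact hd.opt k hk
  by_cases h0 : optVal N (xs i) (d i) = 0
  · have hdi : d i = (N.adj (xs i)).length + 1 := by
      rcases optVal_cases N (xs i) (d i) with ⟨_, h, _⟩ | ⟨q, hq, h, _⟩ | h
      · omega
      · have := (N.mem_adj.1 hq).1; omega
      · have h1 := h.1
        unfold radix at hlt
        omega
    refine (Runs.of_wp (Q := fun τ => τ.ireg 10 = i + 1 ∧ τ.ireg 24 = p ∧ τ.ireg 23 = 0 ∧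
      τ.iarr 12 = Function.update (σ.iarr 12) i (2 * N.m + 1)) ?_).mono ?_
    · simp [incrementStep, wp, Instr.eval, Instr.Safe, Test.Holds, h10, hopt, h0, hH.r2, hH.r3,
        hH.r7, h24, h23]
      omega
    · rintro t τ _ _ ⟨ht, h1, h2, h3, h4⟩
      have hcost : t ≤ 8 := ht
      refine ⟨9 * (p - (i + 1)), ⟨Function.update d i 0,
        upd 0 (by unfold radix; omega) _ (by simp [optVal]) τ h4,
        Or.inl ⟨i + 1, by omega, h1, h2, h3, rfl, fun l hl => ?_, ?_⟩⟩, by omega⟩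
      · by_cases hli : l = i
        · subst hli; rw [Function.update_self]
        · rw [Function.update_of_ne hli]; exact hz l (by omega)
      · have h5 := mixRank_update (b := radix N xs) (d := d) hb 0
        rw [← hB, hdi, zero_mul, add_zero] at h5
        rw [Finset.prod_range_succ, ← hB, radix]
        rw [← hR, ← h5]
        ring
  · have hdi : d i ≤ (N.adj (xs i)).length := by
      rcases optVal_cases N (xs i) (d i) with ⟨h, _⟩ | ⟨q, hq, h, hp⟩ | h
      · omega
      · by_contra hcon
        obtain ⟨e, he⟩ : ∃ e, d i = e + 1 := ⟨d i - 1, by omega⟩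
        rw [he, Net.pick_last (by omega)] at hp
        exact absurd hp.symm (Finset.singleton_ne_empty _)
      · exact absurd h.2.1 h0
    refine (Runs.of_wp (Q := fun τ => τ.ireg 24 = 0 ∧ τ.ireg 23 = 1 ∧
      τ.iarr 12 = Function.update (σ.iarr 12) i (optVal N (xs i) (d i + 1))) ?_).mono ?_
    · by_cases hdz : d i = 0
      · have h6 : optVal N (xs i) (d i) = 2 * N.m + 1 := by simp [optVal, hdz]
        rw [h6] at hopt
        rw [hdz, zero_add, optVal_one]
        simp [incrementStep, wp, Instr.eval, Instr.Safe, Test.Holds, h10, hopt, hH.r2, hH.r3,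
          hH.r7, hH.a10, hH.head]
      · have h6 : optVal N (xs i) (d i) ≠ 2 * N.m + 1 := by
          rcases optVal_cases N (xs i) (d i) with ⟨h, _⟩ | ⟨q, hq, h, hp⟩ | h
          · exact absurd h hdz
          · have := (N.mem_adj.1 hq).2.1; omega
          · exact absurd h.2.1 h0
        simp [incrementStep, wp, Instr.eval, Instr.Safe, Test.Holds, h10, hopt, hH.r2, hH.r3,
          hH.r7, h6, h0, hH.optVal_succ hdz hdi]
    · rintro t τ _ _ ⟨ht, h1, h2, h3⟩
      have hcost : t ≤ 8 := ht
      refine ⟨0, ⟨Function.update d i (d i + 1),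
        upd (d i + 1) (by unfold radix; omega) _ rfl τ h3, Or.inr ⟨h1, h2, ?_⟩⟩, by omega⟩
      have h5 := mixRank_update (b := radix N xs) (d := d) hb (d i + 1)
      rw [← hB, Nat.add_mul] at h5
      omega

theorem runs_increment (hH : Held N xs s p L σ) (hd : Digits N xs d p σ) :
    Runs W increment σ fun t τ => t ≤ 9 * p + 4 ∧
      ((τ.ireg 23 = 1 ∧ ∃ d', Digits N xs d' p τ ∧
          mixRank (radix N xs) d' p = mixRank (radix N xs) d p + 1) ∨
        (τ.ireg 23 = 0 ∧
          mixRank (radix N xs) d p + 1 = ∏ l ∈ Finset.range p, radix N xs l)) := by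
  refine Runs.of_fits fun hfit0 => ?_
  have hW : p ≤ W := hH.r8 ▸ hfit0.1 8
  refine Runs.seq_wp (R := fun τ => τ.ireg 23 = 0) (by simp [wp, Instr.eval, Instr.Safe, hH.r2]) ?_
  intro t1 τ1 ht1 hfr1 _ h1
  have hcost1 : t1 ≤ 1 := ht1
  refine Runs.seq_wp (R := fun τ => τ.ireg 24 = p)
    (by simp [wp, Instr.eval, Instr.Safe, hfr1.ireg 8 (by decide), hH.r8]) ?_
  intro t2 τ2 ht2 hfr2 _ h2
  have hcost2 : t2 ≤ 1 := ht2
  refine Runs.seq_wp (R := fun τ => τ.ireg 10 = 0) (by simp [wp, Instr.eval, Instr.Safe]) ?_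
  intro t3 τ3 ht3 hfr3 _ h3
  have hcost3 : t3 ≤ 1 := ht3
  have hH3 : Held N xs s p L τ3 :=
    ((hH.frame hfr1 (by decide)).frame hfr2 (by decide)).frame hfr3 (by decide)
  refine (Runs.loop (W := W) (p := incrementStep) (b := .ilt 10 24)
    (Inv := Carry N xs p (mixRank (radix N xs) d p)) (9 * p) ?_ ?_).mono ?_
  · refine ⟨d, ⟨hd.lt, ?_⟩, Or.inl ⟨0, by omega, h3, ?_, ?_, by simp, by simp, by simp⟩⟩
    · rw [hfr3.iarr 12 (by decide), hfr2.iarr 12 (by decide), hfr1.iarr 12 (by decide)]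
      exact hd.opt
    · rw [hfr3.ireg 24 (by decide), h2]
    · rw [hfr3.ireg 23 (by decide), hfr2.ireg 23 (by decide), h1]
  · intro q τ hfr _ hc hb
    exact runs_incrementStep (hH3.frame hfr (by decide)) hc hb hW
  · rintro t τ _ _ ⟨q, ⟨d', hd', hc⟩, hb, ht⟩
    refine ⟨by omega, ?_⟩
    rcases hc with ⟨i, hip, h10, h24, h23, rfl, hz, hR⟩ | ⟨h24, h23, hR⟩
    · simp only [Test.Holds, h10, h24] at hb
      -- A carry beyond the last place means that all digits were maximal, so the old selection was
      -- the last one.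
      obtain rfl : i = p := by omega
      rw [mixRank_zero hz, zero_add] at hR
      exact Or.inr ⟨h23, hR.symm⟩
    · exact Or.inl ⟨h23, d', hd', hR⟩

/-- The part of the solution in `A`. -/
noncomputable def sol (A : Finset ℕ) (σ : State) : Finset ℕ := A.filter fun i => σ.iarr 14 i = 1

/-- The solution in `A` is independent, its weight is stored, it is at least as good as all
selections with rank less than `R`, and outside `A` it agrees with `σ₀`. -/
structure Search (N : Net) (xs s : ℕ → ℕ) (p L : ℕ) (A : Finset ℕ) (σ₀ : State) (R : ℕ)
    (σ : State) : Prop where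
  indep : N.Indep (sol A σ)
  weight : σ.rreg 1 = ∑ i ∈ sol A σ, N.w i
  best : ∀ d, (∀ k < p, d k < radix N xs k) → mixRank (radix N xs) d p < R → N.Valid xs d p →
    value N xs s d p L ≤ σ.rreg 1
  outside : ∀ i, ¬ Span N xs s p L i → σ.iarr 14 i = σ₀.iarr 14 i

/-- By `mixRank_inj` the only selection covered by the new bound and not by the old one is `d`, up
to digits that do not matter; its value is compared explicitly. -/
theorem Search.evaluate {A B : Finset ℕ} {σ₀ τ : State} (hs : N.PathSeq s L B)
    (hA : A = N.els (Net.verts xs p) ∪ B) (hdis : Disjoint (N.els (Net.verts xs p)) B)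
    (hI : Search N xs s p L A σ₀ (mixRank (radix N xs) d p) σ)
    (hd : ∀ k < p, d k < radix N xs k)
    (h : (τ.rreg 1 = σ.rreg 1 ∧ τ.iarr 14 = σ.iarr 14 ∧
          (N.Valid xs d p → value N xs s d p L ≤ σ.rreg 1)) ∨
        (N.Valid xs d p ∧ σ.rreg 1 < value N xs s d p L ∧ τ.rreg 1 = value N xs s d p L ∧
          ∀ i, τ.iarr 14 i = if i ∈ N.chosen xs d p ∪
            (N.completion s L (N.chosen xs d p)).image s then 1
            else if Span N xs s p L i then 0 else σ.iarr 14 i)) :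
    Search N xs s p L A σ₀ (mixRank (radix N xs) d p + 1) τ := by
  have split : ∀ e, (∀ k < p, e k < radix N xs k) →
      mixRank (radix N xs) e p < mixRank (radix N xs) d p + 1 → N.Valid xs e p →
      mixRank (radix N xs) e p < mixRank (radix N xs) d p ∨
        (N.Valid xs d p ∧ value N xs s e p L = value N xs s d p L) := by
    intro e he hlt hv
    rcases Nat.lt_succ_iff_lt_or_eq.1 hlt with h | h
    · exact Or.inl h
    · have heq := mixRank_inj he hd h
      exact Or.inr ⟨(Net.valid_congr heq).1 hv, by rw [value, value, Net.chosen_congr heq]⟩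
  rcases h with ⟨h1, h2, h3⟩ | ⟨hv, hlt, h1, h2⟩
  · have hsol : sol A τ = sol A σ := by rw [sol, sol, h2]
    refine ⟨hsol ▸ hI.indep, by rw [h1, hsol]; exact hI.weight, fun e he hlt hv => ?_,
      fun i hi => by rw [h2]; exact hI.outside i hi⟩
    rw [h1]
    rcases split e he hlt hv with h | ⟨hv', h⟩
    · exact hI.best e he h hv
    · rw [h]; exact h3 hv'
  · obtain ⟨hind, himg, hsum⟩ := hs.indep_union hdis Net.chosen_subset hv.indep
    have hsub : N.chosen xs d p ∪ (N.completion s L (N.chosen xs d p)).image s ⊆ A :=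
      hA ▸ Finset.union_subset_union Net.chosen_subset himg
    have hspan : ∀ i ∈ A, Span N xs s p L i := by
      intro i hi
      rw [hA, Finset.mem_union] at hi
      refine hi.imp id fun h => ?_
      obtain ⟨k, hk, h, _⟩ := (hs.mem i).1 h
      exact ⟨k, hk, h⟩
    have hsol : sol A τ = N.chosen xs d p ∪ (N.completion s L (N.chosen xs d p)).image s := by
      ext i
      rw [sol, Finset.mem_filter, h2 i]
      constructor
      · rintro ⟨hiA, h⟩
        by_contra hn
        rw [if_neg hn, if_pos (hspan i hiA)] at h
        exact zero_ne_one h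
      · exact fun h => ⟨hsub h, if_pos h⟩
    refine ⟨hsol ▸ hind, by rw [h1, hsol, hsum, value], fun e he hlt' hv' => ?_, fun i hi => ?_⟩
    · rw [h1]
      rcases split e he hlt' hv' with h | ⟨_, h⟩
      · exact (hI.best e he h hv').trans hlt.le
      · exact h.le
    · rw [h2 i, if_neg fun h => hi (hspan i (hsub h)), if_neg hi]
      exact hI.outside i hi

/-- Every admissible rank lies below the product of the radices, so all selections have been tried,
and one of them dominates any given independent set. -/
theorem Search.maxIndep {A B : Finset ℕ} {σ₀ : State} (hs : N.PathSeq s L B)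
    (hA : A = N.els (Net.verts xs p) ∪ B) (hdis : Disjoint (N.els (Net.verts xs p)) B)
    (hxn : ∀ k < p, xs k < N.n)
    (hI : Search N xs s p L A σ₀ (∏ l ∈ Finset.range p, radix N xs l) σ) :
    N.MaxIndep A (sol A σ) := by
  refine ⟨Finset.filter_subset _ _, hI.indep, fun J hJ hJi => ?_⟩
  obtain ⟨d, h1, h2, h3⟩ := Net.exists_digits_sum_le hs hxn hdis hJi (hA ▸ hJ)
  rw [← hI.weight]
  exact h3.trans (hI.best d h1 (mixRank_lt h1) h2)

theorem runs_search {A B : Finset ℕ} (hH : Held N xs s p L σ) (hs : N.PathSeq s L B)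
    (hA : A = N.els (Net.verts xs p) ∪ B) (hdis : Disjoint (N.els (Net.verts xs p)) B)
    (hxn : ∀ k < p, xs k < N.n)
    (hK : ∀ k < p, ∀ v, v = xs k ∨ N.Nbr (xs k) v → (N.adj v).length ≤ K)
    (h0 : ∀ i ∈ A, σ.iarr 14 i = 0) :
    Runs W search σ fun t τ => t ≤ (K + 2) ^ p * ((16 * K + 53) * p + 31 * L + 35) + 3 * p + 5 ∧
      N.MaxIndep A (sol A τ) ∧ ∀ i, ¬ Span N xs s p L i → τ.iarr 14 i = σ.iarr 14 i := by
  refine (Runs.forUp 1 (fun k τ => ∀ j < k, τ.iarr 12 j = 2 * N.m + 1) hH.r3 hH.r8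
    (by decide) (fun k τ x h => h) (by simp) ?_).seq ?_
  · intro k τ hk hfr _ hi hinv
    have hH1 : Held N xs s p L τ := hH.frame hfr (by decide)
    refine (Runs.of_wp (Q := fun τ => ∀ j < k + 1, τ.iarr 12 j = 2 * N.m + 1) ?_).mono
      fun t τ _ _ h => h
    simp only [wp, Instr.eval, Instr.Safe, hi, hH1.r7, Function.update_self, true_and]
    intro j hj
    rcases Nat.lt_succ_iff_lt_or_eq.1 hj with h | rfl
    · rw [Function.update_of_ne (by omega), hinv j h]
    · rw [Function.update_self]
  rintro t1 τ1 hfr1 _ ⟨ht1, h1⟩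
  have hH1 : Held N xs s p L τ1 := hH.frame hfr1 (by decide)
  refine Runs.seq_wp (R := fun τ => τ.rreg 1 = 0) (by simp [wp, Instr.eval, Instr.Safe, hH1.rz]) ?_
  intro t2 τ2 ht2 hfr2 _ h2
  have hcost2 : t2 ≤ 1 := ht2
  have hH2 : Held N xs s p L τ2 := hH1.frame hfr2 (by decide)
  refine Runs.seq_wp (R := fun τ => τ.ireg 23 = 1) (by simp [wp, Instr.eval, Instr.Safe, hH2.r3]) ?_
  intro t3 τ3 ht3 hfr3 _ h3
  have hcost3 : t3 ≤ 1 := ht3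
  have hH3 : Held N xs s p L τ3 := hH2.frame hfr3 (by decide)
  have h14 : τ3.iarr 14 = σ.iarr 14 := by
    rw [hfr3.iarr 14 (by decide), hfr2.iarr 14 (by decide), hfr1.iarr 14 (by decide)]
  -- `T` bounds one round: evaluation, increment and the loop test.
  set T := (16 * K + 53) * p + 31 * L + 35 with hT
  set M := ∏ l ∈ Finset.range p, radix N xs l with hM
  have hM0 : 0 < M := Finset.prod_pos fun i _ => by unfold radix; omega
  refine (Runs.loop (W := W) (p := evaluate ⨾ increment) (b := .ieq 23 3)
    (Inv := fun q τ => ∃ R, Search N xs s p L A σ R τ ∧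
      ((τ.ireg 23 = 1 ∧ R < M ∧ q = (M - R) * T ∧
        ∃ d, Digits N xs d p τ ∧ mixRank (radix N xs) d p = R) ∨
      (τ.ireg 23 = 0 ∧ R = M))) (M * T) ?_ ?_).mono ?_
  -- The search starts from the empty solution, whose weight zero is the initial content of real
  -- register `1`.
  · have hsol : sol A τ3 = ∅ := by
      rw [sol, Finset.filter_eq_empty_iff]
      intro i hi
      rw [h14, h0 i hi]
      exact zero_ne_one
    refine ⟨0, ⟨by simp [hsol, Net.Indep], ?_, fun d _ h => by omega, fun i _ => by rw [h14]⟩,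
      Or.inl ⟨h3, hM0, by simp, fun _ => 0, ⟨fun k _ => by unfold radix; omega, fun k hk => ?_⟩,
        mixRank_zero fun _ _ => rfl⟩⟩
    · rw [hsol, hfr3.rreg 1 (by decide), h2, Finset.sum_empty]
    · rw [hfr3.iarr 12 (by decide), hfr2.iarr 12 (by decide), h1 k hk]; simp [optVal]
  · rintro _ τ hfr _ ⟨R, hI, ⟨h23, hRM, rfl, d, hd, rfl⟩ | ⟨h23, _⟩⟩ hb
    swap
    · have hH4 : Held N xs s p L τ := hH3.frame hfr (by decide)
      simp only [Test.Holds, h23, hH4.r3] at hb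
      omega
    have hH4 : Held N xs s p L τ := hH3.frame hfr (by decide)
    refine (runs_evaluate hH4 hd.opt hxn hK).seq ?_
    rintro t4 τ4 hfr4 _ ⟨ht4, h4⟩
    have hI' := hI.evaluate hs hA hdis hd.lt h4
    have hH5 : Held N xs s p L τ4 := hH4.frame hfr4 (by decide)
    have hd' : Digits N xs d p τ4 := ⟨hd.lt, by rw [hfr4.iarr 12 (by decide)]; exact hd.opt⟩
    refine (runs_increment hH5 hd').mono ?_
    rintro t5 τ5 hfr5 _ ⟨ht5, h5⟩
    have hTle : t4 + t5 + 1 ≤ T := by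
      have : (16 * K + 53) * p = (16 * K + 44) * p + 9 * p := by ring
      omega
    have hI5 : Search N xs s p L A σ (mixRank (radix N xs) d p + 1) τ5 := by
      obtain ⟨a, b, c, e⟩ := hI'
      have h15 := hfr5.iarr 14 (by decide)
      have hsol : sol A τ5 = sol A τ4 := by rw [sol, sol, h15]
      have hr1 := hfr5.rreg 1 (by decide)
      exact ⟨hsol ▸ a, by rw [hr1, hsol]; exact b, by rw [hr1]; exact c, by rw [h15]; exact e⟩
    -- Each round spends the share `T` of the selection just treated.
    have hpay : (M - mixRank (radix N xs) d p) * T =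
        (M - (mixRank (radix N xs) d p + 1)) * T + T := by
      rw [← Nat.succ_mul]; congr 1; omega
    rcases h5 with ⟨h23', d', hd', hR⟩ | ⟨h23', hR⟩
    · rcases Nat.lt_or_ge (mixRank (radix N xs) d p + 1) M with hlt | hge
      · exact ⟨_, ⟨_, hI5, Or.inl ⟨h23', hlt, rfl, d', hd', hR⟩⟩, by omega⟩
      · have := mixRank_lt hd'.lt
        omega
    · exact ⟨0, ⟨_, hI5, Or.inr ⟨h23', hR⟩⟩, by omega⟩
  · rintro t τ hfr _ ⟨q, ⟨R, hI, h⟩, hb, ht⟩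
    have hH4 : Held N xs s p L τ := hH3.frame hfr (by decide)
    rcases h with ⟨h23, _⟩ | ⟨_, rfl⟩
    · simp only [Test.Holds, h23, hH4.r3] at hb
      exact absurd trivial hb
    · refine ⟨?_, hI.maxIndep hs hA hdis hxn, hI.outside⟩
      have hMle : M ≤ (K + 2) ^ p := by
        rw [hM]
        refine (Finset.prod_le_pow_card _ _ (K + 2) fun i hi => ?_).trans (by simp)
        have := hK i (Finset.mem_range.1 hi) _ (Or.inl rfl)
        unfold radix
        omega
      have := Nat.mul_le_mul_right T hMle
      omega

end Algo

end RealRAM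

namespace Net

variable {N : Net}

/-! ### Linear arrangements built by walks -/

/-- The visited vertices `U` contain `V ∪ X`, those outside `O` have only visited neighbours, and
the first `L` entries of `s` are dummies, the vertices of `U \ (V ∪ X)` and the edges between them,
where conflicts are the pairs at distance at most two. -/
structure Arranged (N : Net) (V X O U : Finset ℕ) (s : ℕ → ℕ) (L : ℕ) : Prop where
  sub : V ∪ X ⊆ U
  lt : ∀ u ∈ U, u < N.n
  closed : ∀ u ∈ U, u ∉ O → ∀ v, N.Nbr u v → v ∈ U
  mem : ∀ i, (∃ k < L, s k = i ∧ i ≠ N.n + N.m) ↔ (i ∈ U \ (V ∪ X) ∨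
    ∃ u ∈ U \ (V ∪ X), ∃ q ∈ N.adj u, N.tgt q ∈ U \ (V ∪ X) ∧ N.eid q = i)
  inj : ∀ k l, k < l → l < L → s k ≠ N.n + N.m → s k ≠ s l
  conf : ∀ k l, k < l → l < L → s k ≠ N.n + N.m → s l ≠ N.n + N.m →
    (N.Conf (s k) (s l) ↔ l ≤ k + 2)
  len : L + 3 * (V ∪ X).card ≤ 3 * U.card

/-- The last entry of the arrangement is the vertex `c`, which has a visited neighbour. -/
structure Tip (N : Net) (V X U : Finset ℕ) (s : ℕ → ℕ) (L c : ℕ) : Prop where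
  mem : c ∈ U \ (V ∪ X)
  pos : 0 < L
  last : s (L - 1) = c
  star : ∀ k < L, s k ≠ N.n + N.m → (s k ∈ N.star c ↔ L ≤ k + 2)
  parent : ∃ z ∈ U, N.Nbr c z

variable {V X O U : Finset ℕ} {s s' : ℕ → ℕ} {L c y p k : ℕ}

/-- Entries are visited vertices or edges between visited vertices, so they avoid the star of an
unvisited vertex. -/
theorem Arranged.not_mem_star (h : N.Arranged V X O U s L) (hy : y ∉ U) (hyn : y < N.n)
    (hk : k < L) (hs : s k ≠ N.n + N.m) : s k ∉ N.star y := by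
  intro hstar
  rcases (h.mem (s k)).1 ⟨k, hk, rfl, hs⟩ with hi | ⟨u, hu, q, hq, hv, he⟩
  · have hiU := (Finset.mem_sdiff.1 hi).1
    rw [mem_star_of_lt (h.lt _ hiU)] at hstar
    exact hy (hstar ▸ hiU)
  · rw [← he, eid_mem_star_iff hq hyn] at hstar
    rcases hstar with rfl | rfl
    · exact hy (Finset.mem_sdiff.1 hu).1
    · exact hy (Finset.mem_sdiff.1 hv).1

theorem Arranged.mem_of_nbr (h : N.Arranged V X O U s L) (hy : y ∉ U) {u : ℕ}
    (hu : u ∈ U) (hn : N.Nbr u y) : u ∈ O := by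
  by_contra hO
  exact hy (h.closed u hu hO y hn)

theorem Arranged.mem_of_lt (h : N.Arranged V X O U s L) (hk : k < L) (hs : s k < N.n) :
    s k ∈ U \ (V ∪ X) := by
  rcases (h.mem (s k)).1 ⟨k, hk, rfl, by omega⟩ with hi | ⟨u, hu, q, hq, hv, he⟩
  · exact hi
  · have := eid_range hq; omega

theorem insert_sdiff_of_not_mem {A : Finset ℕ} (hy : y ∉ A) :
    insert y U \ A = insert y (U \ A) := Finset.insert_sdiff_of_notMem _ hy

/-- The two dummies put `y` at distance three from the preceding entries. There is indeed no
conflict with them: only vertices of `X` may still have unvisited neighbours, so `y` is adjacent to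
no vertex of an earlier walk. -/
theorem Arranged.start (h : N.Arranged V X X U s L) (hy : y ∉ U) {x : ℕ} (hx : x ∈ X)
    (hxy : N.Nbr x y) (hs' : ∀ k < L, s' k = s k) (h0 : s' L = N.n + N.m)
    (h1 : s' (L + 1) = N.n + N.m) (h2 : s' (L + 2) = y) :
    N.Arranged V X (insert y X) (insert y U) s' (L + 3) ∧
      N.Tip V X (insert y U) s' (L + 3) y := by
  have hyn : y < N.n := hxy.lt_right
  have hyA : y ∉ V ∪ X := fun hh => hy (h.sub hh)
  have hnew : ∀ k < L + 3, s' k ≠ N.n + N.m → k < L ∨ k = L + 2 := by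
    intro k hk hne
    by_contra hcon
    have : k = L ∨ k = L + 1 := by omega
    rcases this with rfl | rfl
    · exact hne h0
    · exact hne h1
  have hno : ∀ u ∈ U \ (V ∪ X), ¬ N.Nbr u y := by
    intro u hu hn
    obtain ⟨hu1, hu2⟩ := Finset.mem_sdiff.1 hu
    exact hu2 (Finset.mem_union_right _ (h.mem_of_nbr hy hu1 hn))
  have hstar : ∀ k < L, s k ≠ N.n + N.m → ¬ N.Conf (s k) y ∧ s k ≠ y := by
    intro k hk hs
    have hns := h.not_mem_star hy hyn hk hs
    refine ⟨fun hc => ?_, fun hh => hns (hh ▸ N.self_mem_star _)⟩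
    rcases (conf_vertex hyn).1 hc.symm with hh | hh
    · exact hns hh
    · exact hno _ (h.mem_of_lt hk hh.lt_right) hh.symm
  refine ⟨⟨?_, ?_, ?_, ?_, ?_, ?_, ?_⟩, ⟨?_, by omega, ?_, ?_, ?_⟩⟩
  · exact h.sub.trans (Finset.subset_insert _ _)
  · intro u hu
    rcases Finset.mem_insert.1 hu with rfl | hu
    · exact hyn
    · exact h.lt u hu
  · intro u hu hO v hv
    have hne : u ≠ y := fun hh => hO (hh ▸ Finset.mem_insert_self _ _)
    exact Finset.mem_insert_of_mem (h.closed u ((Finset.mem_insert.1 hu).resolve_left hne)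
      (fun hh => hO (Finset.mem_insert_of_mem hh)) v hv)
  · intro i
    rw [insert_sdiff_of_not_mem hyA]
    constructor
    · rintro ⟨k, hk, rfl, hi⟩
      rcases hnew k hk hi with hkL | rfl
      · rw [hs' k hkL] at hi ⊢
        rcases (h.mem (s k)).1 ⟨k, hkL, rfl, hi⟩ with hh | ⟨u, hu, q, hq, hv, he⟩
        · exact Or.inl (Finset.mem_insert_of_mem hh)
        · exact Or.inr ⟨u, Finset.mem_insert_of_mem hu, q, hq, Finset.mem_insert_of_mem hv, he⟩
      · rw [h2]; exact Or.inl (Finset.mem_insert_self _ _)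
    · have old : (∃ k < L, s k = i ∧ i ≠ N.n + N.m) →
          ∃ k < L + 3, s' k = i ∧ i ≠ N.n + N.m := by
        rintro ⟨k, hk, hh⟩
        exact ⟨k, by omega, by rw [hs' k hk]; exact hh⟩
      rintro (hi | ⟨u, hu, q, hq, hv, he⟩)
      · rcases Finset.mem_insert.1 hi with rfl | hi
        · exact ⟨L + 2, by omega, h2, by omega⟩
        · exact old ((h.mem i).2 (Or.inl hi))
      · rcases Finset.mem_insert.1 hu with rfl | hu
        · rcases Finset.mem_insert.1 hv with hv | hv
          · exact absurd hv (tgt_ne hq)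
          · exact absurd (Nbr.symm ⟨q, hq, rfl⟩) (hno _ hv)
        · rcases Finset.mem_insert.1 hv with hv | hv
          · exact absurd ⟨q, hq, hv⟩ (hno _ hu)
          · exact old ((h.mem i).2 (Or.inr ⟨u, hu, q, hq, hv, he⟩))
  · intro k l hkl hl hk
    rcases hnew k (by omega) hk with hkL | rfl
    · rw [hs' k hkL] at hk ⊢
      by_cases hlD : s' l = N.n + N.m
      · rwa [hlD]
      rcases hnew l hl hlD with hlL | rfl
      · rw [hs' l hlL]; exact h.inj k l hkl hlL hk
      · rw [h2]; exact (hstar k hkL hk).2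
    · omega
  · intro k l hkl hl hk hlD
    rcases hnew k (by omega) hk with hkL | rfl
    · rw [hs' k hkL] at hk ⊢
      rcases hnew l hl hlD with hlL | rfl
      · rw [hs' l hlL] at hlD ⊢; exact h.conf k l hkl hlL hk hlD
      · rw [h2]
        exact ⟨fun hc => absurd hc (hstar k hkL hk).1, fun hc => by omega⟩
    · omega
  · rw [Finset.card_insert_of_notMem hy]
    have := h.len
    omega
  · exact Finset.mem_sdiff.2 ⟨Finset.mem_insert_self _ _, hyA⟩
  · exact h2
  · intro k hk hne
    rcases hnew k hk hne with hkL | rfl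
    · rw [hs' k hkL] at hne ⊢
      exact ⟨fun hh => absurd hh (h.not_mem_star hy hyn hkL hne), fun hh => by omega⟩
    · rw [h2]; exact ⟨fun _ => by omega, fun _ => N.self_mem_star y⟩
  · exact ⟨x, Finset.mem_insert_of_mem (h.sub (Finset.mem_union_right _ hx)), hxy.symm⟩

theorem eq_or_eq_of_length_le_two {α : Type*} {l : List α} {a b r : α} (h : l.length ≤ 2)
    (ha : a ∈ l) (hb : b ∈ l) (hab : a ≠ b) (hr : r ∈ l) : r = a ∨ r = b := by
  match l, h with
  | [], _ => simp at ha
  | [x], _ => simp_all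
  | [x, y], _ =>
    simp only [List.mem_cons, List.not_mem_nil, or_false] at ha hb hr
    rcases ha with rfl | rfl <;> rcases hb with rfl | rfl <;> simp_all [or_comm]

/-- Besides `X`, only the tip `c` may have unvisited neighbours, so `c` is the only arranged vertex
adjacent to the new vertex `y`. Hence the edge from `c` to `y` conflicts with the earlier entries in
the star of `c`, which occupy the last two positions up to a dummy, and `y` conflicts only with `c`.
This is the pattern of distance at most two. -/
theorem Arranged.step (h : N.Arranged V X (insert c X) U s L) (ht : N.Tip V X U s L c)
    (hdeg : (N.adj c).length ≤ 2) (hp : p ∈ N.adj c) (hy : N.tgt p ∉ U)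
    (hs' : ∀ k < L, s' k = s k) (h0 : s' L = N.eid p) (h1 : s' (L + 1) = N.tgt p) :
    N.Arranged V X (insert (N.tgt p) X) (insert (N.tgt p) U) s' (L + 2) ∧
      N.Tip V X (insert (N.tgt p) U) s' (L + 2) (N.tgt p) := by
  set y := N.tgt p with hydef
  have hyn : y < N.n := tgt_lt hp
  have hyA : y ∉ V ∪ X := fun hh => hy (h.sub hh)
  have her := eid_range hp
  obtain ⟨hcU, hcA⟩ := Finset.mem_sdiff.1 ht.mem
  have hcn : c < N.n := h.lt c hcU
  have hcy : N.Nbr c y := ⟨p, hp, rfl⟩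
  have hpos := ht.pos
  have hnbr : ∀ u ∈ U \ (V ∪ X), N.Nbr u y → u = c := by
    intro u hu hn
    obtain ⟨hu1, hu2⟩ := Finset.mem_sdiff.1 hu
    rcases Finset.mem_insert.1 (h.mem_of_nbr hy hu1 hn) with hh | hh
    · exact hh
    · exact absurd (Finset.mem_union_right _ hh) hu2
  have hestar : N.eid p ∈ N.star y := (eid_mem_star_iff hp hyn).2 (Or.inr rfl)
  have hns : ∀ k < L, s k ≠ N.n + N.m → s k ∉ N.star y := fun k hk hs =>
    h.not_mem_star hy hyn hk hs
  have hne_e : ∀ k < L, s k ≠ N.n + N.m → s k ≠ N.eid p := fun k hk hs hh =>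
    hns k hk hs (hh ▸ hestar)
  have hne_y : ∀ k < L, s k ≠ N.n + N.m → s k ≠ y := fun k hk hs hh =>
    hns k hk hs (hh ▸ N.self_mem_star _)
  have hconf_e : ∀ k < L, s k ≠ N.n + N.m → (N.Conf (s k) (N.eid p) ↔ L ≤ k + 2) := by
    intro k hk hs
    rw [← ht.star k hk hs]
    constructor
    · intro hc
      exact ((conf_edge hp).1 hc.symm).resolve_right (hns k hk hs)
    · exact fun hc => ((conf_edge hp).2 (Or.inl hc)).symm
  have hconf_y : ∀ k < L, s k ≠ N.n + N.m → (N.Conf (s k) y ↔ L + 1 ≤ k + 2) := by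
    intro k hk hs
    constructor
    · intro hc
      have hn := ((conf_vertex hyn).1 hc.symm).resolve_left (hns k hk hs)
      have hkc : s k = c := hnbr _ (h.mem_of_lt hk hn.lt_right) hn.symm
      by_contra hcon
      exact h.inj k (L - 1) (by omega) (by omega) hs (hkc.trans ht.last.symm)
    · intro hle
      obtain rfl : k = L - 1 := by omega
      rw [ht.last]
      exact Or.inr hcy
  have hold : ∀ k < L + 2, k < L ∨ k = L ∨ k = L + 1 := fun k hk => by omega
  refine ⟨⟨?_, ?_, ?_, ?_, ?_, ?_, ?_⟩, ⟨?_, by omega, ?_, ?_, ?_⟩⟩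
  · exact h.sub.trans (Finset.subset_insert _ _)
  · intro u hu
    rcases Finset.mem_insert.1 hu with rfl | hu
    · exact hyn
    · exact h.lt u hu
  · intro u hu hO v hv
    have hne : u ≠ y := fun hh => hO (hh ▸ Finset.mem_insert_self _ _)
    have huU := (Finset.mem_insert.1 hu).resolve_left hne
    by_cases huc : u = c
    · subst huc
      obtain ⟨z, hz, q, hq, rfl⟩ := ht.parent
      obtain ⟨r, hr, rfl⟩ := hv
      -- The arc `q` leads to the visited neighbour from which `c` was reached, and `p` to an
      -- unvisited vertex. As the degree is at most two, `c` has no further neighbour.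
      have hqp : q ≠ p := fun hh => hy (by rw [hydef, ← hh]; exact hz)
      rcases eq_or_eq_of_length_le_two hdeg hq hp hqp hr with rfl | rfl
      · exact Finset.mem_insert_of_mem hz
      · exact Finset.mem_insert_self _ _
    · refine Finset.mem_insert_of_mem (h.closed u huU (fun hh => ?_) v hv)
      rcases Finset.mem_insert.1 hh with hh | hh
      · exact huc hh
      · exact hO (Finset.mem_insert_of_mem hh)
  · intro i
    rw [insert_sdiff_of_not_mem hyA]
    constructor
    · rintro ⟨k, hk, rfl, hi⟩
      rcases hold k hk with hkL | rfl | rfl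
      · rw [hs' k hkL] at hi ⊢
        rcases (h.mem (s k)).1 ⟨k, hkL, rfl, hi⟩ with hh | ⟨u, hu, q, hq, hv, he⟩
        · exact Or.inl (Finset.mem_insert_of_mem hh)
        · exact Or.inr ⟨u, Finset.mem_insert_of_mem hu, q, hq, Finset.mem_insert_of_mem hv, he⟩
      · rw [h0]
        exact Or.inr ⟨c, Finset.mem_insert_of_mem ht.mem, p, hp, Finset.mem_insert_self _ _, rfl⟩
      · rw [h1]; exact Or.inl (Finset.mem_insert_self _ _)
    · have old : (∃ k < L, s k = i ∧ i ≠ N.n + N.m) →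
          ∃ k < L + 2, s' k = i ∧ i ≠ N.n + N.m := by
        rintro ⟨k, hk, hh⟩
        exact ⟨k, by omega, by rw [hs' k hk]; exact hh⟩
      rintro (hi | ⟨u, hu, q, hq, hv, he⟩)
      · rcases Finset.mem_insert.1 hi with rfl | hi
        · exact ⟨L + 1, by omega, h1, by omega⟩
        · exact old ((h.mem i).2 (Or.inl hi))
      · have new : N.eid q = N.eid p → ∃ k < L + 2, s' k = i ∧ i ≠ N.n + N.m := fun hh =>
          ⟨L, by omega, by rw [h0, ← hh, he], by omega⟩
        rcases Finset.mem_insert.1 hu with rfl | hu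
        · rcases Finset.mem_insert.1 hv with hv | hv
          · exact absurd hv (tgt_ne hq)
          -- An edge from `y` back to an arranged vertex must end in `c`, so it is the edge of `p`.
          · obtain ⟨r, hr, hr1, hr2⟩ := exists_rev hq
            have hc : N.tgt q = c := hnbr _ hv ⟨r, hr, hr1⟩
            rw [hc] at hr
            exact new (hr2 ▸ congrArg N.eid (eq_of_tgt_eq hr hp hr1))
        · rcases Finset.mem_insert.1 hv with hv | hv
          · obtain rfl := hnbr _ hu ⟨q, hq, hv⟩
            exact new (congrArg N.eid (eq_of_tgt_eq hq hp hv))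
          · exact old ((h.mem i).2 (Or.inr ⟨u, hu, q, hq, hv, he⟩))
  · intro k l hkl hl hk
    rcases hold k (by omega) with hkL | rfl | rfl
    · rw [hs' k hkL] at hk ⊢
      rcases hold l hl with hlL | rfl | rfl
      · rw [hs' l hlL]; exact h.inj k l hkl hlL hk
      · rw [h0]; exact hne_e k hkL hk
      · rw [h1]; exact hne_y k hkL hk
    · obtain rfl : l = k + 1 := by omega
      rw [h0, h1]; omega
    · omega
  · intro k l hkl hl hk hlD
    rcases hold k (by omega) with hkL | rfl | rfl
    · rw [hs' k hkL] at hk ⊢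
      rcases hold l hl with hlL | rfl | rfl
      · rw [hs' l hlL] at hlD ⊢; exact h.conf k l hkl hlL hk hlD
      · rw [h0]; exact hconf_e k hkL hk
      · rw [h1]; exact hconf_y k hkL hk
    · obtain rfl : l = k + 1 := by omega
      rw [h0, h1]
      exact ⟨fun _ => by omega, fun _ => (conf_edge hp).2 (Or.inr (N.self_mem_star _))⟩
    · omega
  · rw [Finset.card_insert_of_notMem hy]
    have := h.len
    omega
  · exact Finset.mem_sdiff.2 ⟨Finset.mem_insert_self _ _, hyA⟩
  · exact h1
  · intro k hk hne
    rcases hold k hk with hkL | rfl | rfl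
    · rw [hs' k hkL] at hne ⊢
      exact ⟨fun hh => absurd hh (hns k hkL hne), fun hh => by omega⟩
    · rw [h0]; exact ⟨fun _ => by omega, fun _ => hestar⟩
    · rw [h1]; exact ⟨fun _ => by omega, fun _ => N.self_mem_star y⟩
  · exact ⟨c, Finset.mem_insert_of_mem hcU, hcy.symm⟩

theorem Arranged.finish (h : N.Arranged V X (insert c X) U s L)
    (hc : ∀ v, N.Nbr c v → v ∈ U) : N.Arranged V X X U s L :=
  { h with
    closed := fun u hu hX v hv => by
      by_cases huc : u = c
      · exact hc v (huc ▸ hv)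
      · exact h.closed u hu (by simp [huc, hX]) v hv }

theorem Arranged.init (hVX : ∀ u ∈ V ∪ X, u < N.n) (hV : N.Closed V) :
    N.Arranged V X X (V ∪ X) s 0 := by
  refine ⟨subset_rfl, hVX, fun u hu hX v hv => ?_, fun i => ?_, by omega, by omega, by omega⟩
  · exact Finset.mem_union_left _ (hV u ((Finset.mem_union.1 hu).resolve_right hX) v hv)
  · simp

theorem Arranged.closed_all (h : N.Arranged V X X U s L)
    (hX : ∀ x ∈ X, ∀ v, N.Nbr x v → v ∈ U) : N.Closed U := fun u hu v hv => by
  by_cases hux : u ∈ X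
  · exact hX u hux v hv
  · exact h.closed u hu hux v hv

/-- Edges meeting `X` lie in the stars treated by the selection. Every other edge of `U \ V` joins
two arranged vertices, because `V` and `U` are closed. -/
theorem Arranged.pathSeq (h : N.Arranged V X X U s L) (hV : N.Closed V)
    (hX : ∀ x ∈ X, ∀ v, N.Nbr x v → v ∈ U) :
    N.PathSeq s L (N.els (U \ V) \ N.els X) := by
  refine ⟨fun i => ?_, h.inj, h.conf⟩
  rw [h.mem i, Finset.mem_sdiff, mem_els]
  constructor
  · rintro ⟨⟨v, hv, hi⟩, hn⟩
    obtain ⟨hvU, hvV⟩ := Finset.mem_sdiff.1 hv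
    have hX' : ∀ u, i ∈ N.star u → u ∉ X := fun u hu huX => hn (mem_els.2 ⟨u, huX, hu⟩)
    have hmem : v ∈ U \ (V ∪ X) := Finset.mem_sdiff.2 ⟨hvU, fun hh =>
      (Finset.mem_union.1 hh).elim hvV (hX' v hi)⟩
    rcases mem_star.1 hi with rfl | ⟨q, hq, rfl⟩
    · exact Or.inl hmem
    · refine Or.inr ⟨v, hmem, q, hq, Finset.mem_sdiff.2 ⟨h.closed_all hX v hvU _ ⟨q, hq, rfl⟩,
        fun hh => (Finset.mem_union.1 hh).elim (fun hh => hvV ?_) (hX' _ ?_)⟩, rfl⟩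
      · exact hV _ hh v (Nbr.symm ⟨q, hq, rfl⟩)
      · exact (eid_mem_star_iff hq (tgt_lt hq)).2 (Or.inr rfl)
  · have hXn : ∀ x ∈ X, x < N.n := fun x hx => h.lt x (h.sub (Finset.mem_union_right _ hx))
    rintro (hi | ⟨u, hu, q, hq, hv, rfl⟩)
    · obtain ⟨h1, h2⟩ := Finset.mem_sdiff.1 hi
      rw [Finset.mem_union, not_or] at h2
      refine ⟨⟨i, Finset.mem_sdiff.2 ⟨h1, h2.1⟩, N.self_mem_star i⟩, fun hh => ?_⟩
      obtain ⟨x, hx, hix⟩ := mem_els.1 hh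
      rw [mem_star_of_lt (h.lt i h1)] at hix
      exact h2.2 (hix ▸ hx)
    · obtain ⟨h1, h2⟩ := Finset.mem_sdiff.1 hu
      obtain ⟨h3, h4⟩ := Finset.mem_sdiff.1 hv
      rw [Finset.mem_union, not_or] at h2 h4
      refine ⟨⟨u, Finset.mem_sdiff.2 ⟨h1, h2.1⟩, eid_mem_star hq⟩, fun hh => ?_⟩
      obtain ⟨x, hx, hix⟩ := mem_els.1 hh
      rcases (eid_mem_star_iff hq (hXn x hx)).1 hix with rfl | rfl
      · exact h2.2 hx
      · exact h4.2 hx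

end Net

/-! ### Running time and correctness of the walks -/

namespace RealRAM

local infixr:60 " ⨾ " => Program.seq
local prefix:max "◇" => Program.instr

namespace Algo

open scoped Classical

/-- Array `9` marks the vertices in `U`. -/
def Visited (U : Finset ℕ) (σ : State) : Prop := ∀ v, σ.iarr 9 v = if v ∈ U then 1 else 0

variable {W : ℕ} {N : Net} {σ : State} {V X O U : Finset ℕ} {xs : ℕ → ℕ} {p L K : ℕ}

theorem Visited.insert {y : ℕ} {τ : State} (h : Visited U σ)
    (hτ : τ.iarr 9 = Function.update (σ.iarr 9) y 1) : Visited (insert y U) τ := by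
  intro v
  rw [hτ, Function.update_apply, h v]
  by_cases hv : v = y <;> simp [hv]

/-- The arcs in register `15` are the last arcs `l` of `c`, and the others have visited targets. -/
def AtArc (N : Net) (U : Finset ℕ) (c : ℕ) (l : List ℕ) (σ : State) : Prop :=
  σ.ireg 15 = l.headD 0 ∧ ∃ l', N.adj c = l' ++ l ∧ ∀ q ∈ l', N.tgt q ∈ U

/-- Amortised time: skipping an arc costs five units, visiting a vertex eleven. The at most two arcs
of the new vertex are prepaid with ten, which makes twenty-one units per vertex. -/
theorem runs_walkStep {c q : ℕ} {l : List ℕ} (hS : Static N σ) (hU : Visited U σ)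
    (hA : N.Arranged V X (insert c X) U (σ.iarr 11) (σ.ireg 9))
    (hT : N.Tip V X U (σ.iarr 11) (σ.ireg 9) c)
    (hdeg : ∀ v < N.n, v ∉ V ∪ X → (N.adj v).length ≤ 2)
    (hl : AtArc N U c (q :: l) σ) (hW : 3 * N.n ≤ W) :
    Runs W walkStep σ fun t τ => ∃ U' c' l', U ⊆ U' ∧ Visited U' τ ∧
      N.Arranged V X (insert c' X) U' (τ.iarr 11) (τ.ireg 9) ∧
      N.Tip V X U' (τ.iarr 11) (τ.ireg 9) c' ∧ AtArc N U' c' l' τ ∧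
      t + 1 + 21 * U.card + 5 * l'.length ≤ 21 * U'.card + 5 * (l.length + 1) := by
  obtain ⟨h15, l0, hadj, hl0⟩ := hl
  have hq : q ∈ N.adj c := by simp [hadj]
  have hcost : walkStep.cost = 10 := rfl
  simp only [List.headD_cons] at h15
  have h6 := hS.tgt c q hq
  have h7 := hS.eid c q hq
  have h5 := hS.next c _ _ _ hadj
  have her := Net.eid_range hq
  refine Runs.seq_wp (R := fun τ => τ.ireg 13 = N.tgt q)
    (by simp [wp, Instr.eval, Instr.Safe, h15, h6]) ?_
  intro t1 τ1 ht1 hfr1 _ h13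
  have hcost1 : t1 ≤ 1 := ht1
  refine Runs.seq_wp (R := fun τ => τ.ireg 14 = if N.tgt q ∈ U then 1 else 0)
    (by simp [wp, Instr.eval, Instr.Safe, h13, hfr1.iarr 9 (by decide), hU (N.tgt q)]) ?_
  intro t2 τ2 ht2 hfr2 _ h14
  have hcost2 : t2 ≤ 1 := ht2
  have hS2 : Static N τ2 := (hS.frame hfr1 (by decide)).frame hfr2 (by decide)
  have h13' : τ2.ireg 13 = N.tgt q := (hfr2.ireg 13 (by decide)).trans h13
  have h15' : τ2.ireg 15 = q := by rw [hfr2.ireg 15 (by decide), hfr1.ireg 15 (by decide), h15]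
  have h9 : τ2.ireg 9 = σ.ireg 9 := by rw [hfr2.ireg 9 (by decide), hfr1.ireg 9 (by decide)]
  have ha9 : τ2.iarr 9 = σ.iarr 9 := by rw [hfr2.iarr 9 (by decide), hfr1.iarr 9 (by decide)]
  have ha11 : τ2.iarr 11 = σ.iarr 11 := by
    rw [hfr2.iarr 11 (by decide), hfr1.iarr 11 (by decide)]
  refine Runs.ite (fun hb => ?_) (fun hb => ?_)
  · simp only [Test.Holds, h14, hS2.r2] at hb
    have hy : N.tgt q ∉ U := fun h => by rw [if_pos h] at hb; omega
    have hcn : c < N.n := Net.src_lt hq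
    have hcA := (Finset.mem_sdiff.1 hT.mem).2
    have hstep := fun s' => hA.step (s' := s') hT (hdeg c hcn hcA) hq hy
    have hcard : (insert (N.tgt q) U).card ≤ N.n := by
      have := Finset.card_le_card (s := insert (N.tgt q) U) (t := Finset.range N.n) fun u hu => by
        rcases Finset.mem_insert.1 hu with rfl | hu
        · exact Finset.mem_range.2 (Net.tgt_lt hq)
        · exact Finset.mem_range.2 (hA.lt u hu)
      simpa using this
    rw [Finset.card_insert_of_notMem hy] at hcard
    have hlen := hA.len
    -- The arrangement has at most three entries per visited vertex.
    have h9W : σ.ireg 9 + 2 ≤ W := by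
      have := (hstep (Function.update (Function.update (σ.iarr 11) (σ.ireg 9) (N.eid q))
        (σ.ireg 9 + 1) (N.tgt q)) (fun k hk => by
          rw [Function.update_of_ne (by omega), Function.update_of_ne (by omega)])
        (by rw [Function.update_of_ne (by omega), Function.update_self])
        (by rw [Function.update_self])).1.len
      rw [Finset.card_insert_of_notMem hy] at this
      omega
    refine (Runs.of_wp (Q := fun τ => τ.ireg 9 = σ.ireg 9 + 2 ∧ τ.ireg 15 = (N.adj (N.tgt q)).headD 0 ∧
      τ.iarr 9 = Function.update (σ.iarr 9) (N.tgt q) 1 ∧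
      τ.iarr 11 = Function.update (Function.update (σ.iarr 11) (σ.ireg 9) (N.eid q))
        (σ.ireg 9 + 1) (N.tgt q)) ?_).mono ?_
    · simp [append, wp, Instr.eval, Instr.Safe, h13', h15', hS2.eid c q hq, h9, hS2.r3, ha9, ha11,
        hS2.head]
      omega
    · rintro t3 τ3 _ _ ⟨ht3, g1, g2, g3, g4⟩
      have hcost3 : t3 ≤ 7 := ht3
      obtain ⟨hA', hT'⟩ := hstep (τ3.iarr 11)
        (fun k hk => by
          rw [g4, Function.update_of_ne (by omega), Function.update_of_ne (by omega)])
        (by rw [g4, Function.update_of_ne (by omega), Function.update_self])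
        (by rw [g4, Function.update_self])
      have hdy := hdeg _ (Net.tgt_lt hq) (Finset.mem_sdiff.1 hT'.mem).2
      refine ⟨insert (N.tgt q) U, N.tgt q, N.adj (N.tgt q), Finset.subset_insert _ _, ?_,
        by rw [g1]; exact hA', by rw [g1]; exact hT', ⟨g2, [], rfl, by simp⟩, ?_⟩
      · exact hU.insert g3
      · rw [Finset.card_insert_of_notMem hy]
        omega
  · simp only [Test.Holds, h14, hS2.r2] at hb
    have hy : N.tgt q ∈ U := by
      by_contra h
      exact hb (if_neg h)
    refine (Runs.of_wp (Q := fun τ => τ.ireg 9 = σ.ireg 9 ∧ τ.ireg 15 = l.headD 0 ∧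
      τ.iarr 9 = σ.iarr 9 ∧ τ.iarr 11 = σ.iarr 11) ?_).mono ?_
    · simp [wp, Instr.eval, Instr.Safe, h15', hS2.next c _ _ _ hadj, h9, ha9, ha11]
    · rintro t3 τ3 _ _ ⟨ht3, g1, g2, g3, g4⟩
      have hcost3 : t3 ≤ 1 := ht3
      refine ⟨U, c, l, subset_rfl, fun v => by rw [g3]; exact hU v, by rw [g1, g4]; exact hA,
        by rw [g1, g4]; exact hT, ⟨g2, l0 ++ [q], by simp [hadj], fun r hr => ?_⟩, by omega⟩
      rcases List.mem_append.1 hr with hr | hr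
      · exact hl0 r hr
      · rw [List.mem_singleton.1 hr]; exact hy

/-- The twenty-one units of the first vertex cover the eight instructions of `walkStart`, its at
most two arcs and the final test. -/
theorem runs_walk {x y : ℕ} (hS : Static N σ) (hU : Visited U σ)
    (hA : N.Arranged V X X U (σ.iarr 11) (σ.ireg 9)) (hx : x ∈ X) (hxy : N.Nbr x y) (hy : y ∉ U)
    (h13 : σ.ireg 13 = y) (hdeg : ∀ v < N.n, v ∉ V ∪ X → (N.adj v).length ≤ 2)
    (hW : 3 * N.n ≤ W) :
    Runs W walk σ fun t τ => ∃ U', insert y U ⊆ U' ∧ Visited U' τ ∧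
      N.Arranged V X X U' (τ.iarr 11) (τ.ireg 9) ∧ t + 21 * U.card ≤ 21 * U'.card := by
  have hyn := hxy.lt_right
  have hcard : U.card + 1 ≤ N.n := by
    rw [← Finset.card_insert_of_notMem hy]
    have := Finset.card_le_card (s := insert y U) (t := Finset.range N.n) fun u hu => by
      rcases Finset.mem_insert.1 hu with rfl | hu
      · exact Finset.mem_range.2 hyn
      · exact Finset.mem_range.2 (hA.lt u hu)
    simpa using this
  have hlen := hA.len
  have hdy := hdeg y hyn fun h => hy (hA.sub h)
  set a := Function.update (Function.update (Function.update (σ.iarr 11) (σ.ireg 9) (N.n + N.m))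
        (σ.ireg 9 + 1) (N.n + N.m)) (σ.ireg 9 + 2) y with ha
  obtain ⟨hA1, hT1⟩ := hA.start (s' := a) hy hx hxy
    (fun k hk => by rw [ha, Function.update_of_ne (by omega), Function.update_of_ne (by omega),
      Function.update_of_ne (by omega)])
    (by rw [ha, Function.update_of_ne (by omega), Function.update_of_ne (by omega),
      Function.update_self])
    (by rw [ha, Function.update_of_ne (by omega), Function.update_self])
    (by rw [ha, Function.update_self])
  refine Runs.seq_wp (R := fun τ => τ.ireg 9 = σ.ireg 9 + 3 ∧ τ.ireg 15 = (N.adj y).headD 0 ∧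
      τ.iarr 9 = Function.update (σ.iarr 9) y 1 ∧ τ.iarr 11 = a) ?_ ?_
  · simp [walkStart, append, wp, Instr.eval, Instr.Safe, h13, hS.r3, hS.r6, hS.head, ha]
    omega
  rintro t1 τ1 ht1 hfr1 _ ⟨g1, g2, g3, g4⟩
  have hcost1 : t1 ≤ 8 := ht1
  have hS1 : Static N τ1 := hS.frame hfr1 (by decide)
  refine (Runs.loop (W := W) (p := walkStep) (b := .ine 15 2)
    (Inv := fun q τ => ∃ U' c l, insert y U ⊆ U' ∧ Visited U' τ ∧
      N.Arranged V X (insert c X) U' (τ.iarr 11) (τ.ireg 9) ∧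
      N.Tip V X U' (τ.iarr 11) (τ.ireg 9) c ∧ AtArc N U' c l τ ∧
      q + 21 * U'.card = 21 * N.n + 5 * l.length)
    (21 * N.n + 5 * (N.adj y).length - 21 * (U.card + 1)) ?_ ?_).mono ?_
  · refine ⟨insert y U, y, N.adj y, subset_rfl, hU.insert g3, by rw [g1, g4]; exact hA1,
      by rw [g1, g4]; exact hT1, ⟨g2, [], rfl, by simp⟩, ?_⟩
    rw [Finset.card_insert_of_notMem hy]
    omega
  · rintro q τ hfr _ ⟨U', c, l, hsub, hU', hA', hT', hl, hq⟩ hb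
    have hS2 : Static N τ := hS1.frame hfr (by decide)
    cases l with
    | nil =>
      simp only [Test.Holds, hS2.r2, hl.1] at hb
      exact absurd rfl hb
    | cons r l =>
      refine (runs_walkStep hS2 hU' hA' hT' hdeg hl hW).mono ?_
      rintro t τ' _ _ ⟨U'', c', l', hsub', hU'', hA'', hT'', hl'', ht⟩
      have hcard2 : U''.card ≤ N.n := by
        have := Finset.card_le_card (s := U'') (t := Finset.range N.n) fun u hu =>
          Finset.mem_range.2 (hA''.lt u hu)
        simpa using this
      rw [List.length_cons] at hq
      exact ⟨21 * N.n + 5 * l'.length - 21 * U''.card,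
        ⟨U'', c', l', hsub.trans hsub', hU'', hA'', hT'', hl'', by omega⟩, by omega⟩
  · rintro t τ hfr _ ⟨q, ⟨U', c, l, hsub, hU', hA', hT', ⟨hl1, l0, hl2, hl3⟩, hq⟩, hb, ht⟩
    have hS2 : Static N τ := hS1.frame hfr (by decide)
    simp only [Test.Holds, hS2.r2, hl1, not_not] at hb
    have hl : l = [] := by
      cases l with
      | nil => rfl
      | cons r l =>
        have : r ∈ N.adj c := by simp [hl2]
        have := (N.mem_adj.1 this).1
        simp only [List.headD_cons] at hb
        omega
    subst hl
    rw [List.append_nil] at hl2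
    refine ⟨U', hsub, hU', hA'.finish ?_, ?_⟩
    · rintro _ ⟨r, hr, rfl⟩
      exact hl3 r (hl2 ▸ hr)
    · simp only [List.length_nil] at hq
      omega

/-- Walks are paid for by the vertices they visit; the rest of the time is spent on the arcs of the
branching vertices, six units each, and on constant overhead per branching vertex. -/
theorem runs_walks (hS : Static N σ) (h8 : σ.ireg 8 = p) (h10 : σ.iarr 10 = xs)
    (hU : Visited (V ∪ Net.verts xs p) σ) (hVn : ∀ u ∈ V ∪ Net.verts xs p, u < N.n)
    (hV : N.Closed V) (hdeg : ∀ v < N.n, v ∉ V ∪ Net.verts xs p → (N.adj v).length ≤ 2)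
    (hK : ∀ k < p, (N.adj (xs k)).length ≤ K) (hW : 3 * N.n ≤ W) :
    Runs W walks σ fun t τ => ∃ U s L, Visited U τ ∧ Held N xs s p L τ ∧
      N.Arranged V (Net.verts xs p) (Net.verts xs p) U s L ∧
      (∀ x ∈ Net.verts xs p, ∀ v, N.Nbr x v → v ∈ U) ∧
      t + 21 * (V ∪ Net.verts xs p).card ≤ 21 * U.card + (6 * K + 5) * p + 3 := by
  set X := Net.verts xs p with hX
  refine Runs.seq_wp (R := fun τ => τ.ireg 9 = 0) (by simp [wp, Instr.eval, Instr.Safe]) ?_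
  intro t1 τ1 ht1 hfr1 _ h9
  have hcost1 : t1 ≤ 1 := ht1
  have hS1 : Static N τ1 := hS.frame hfr1 (by decide)
  refine (Runs.forUp_time (W := W) (L := p) (fun k T τ => ∃ U, Visited U τ ∧
    N.Arranged V X X U (τ.iarr 11) (τ.ireg 9) ∧ (∀ l < k, ∀ v, N.Nbr (xs l) v → v ∈ U) ∧
    T + 21 * (V ∪ X).card ≤ 21 * U.card + (6 * K + 3) * k) hS1.r3
    (by rw [hfr1.ireg 8 (by decide), h8]) (by decide)
    (fun k T τ x h => by simpa [State.setI, Visited] using h) ?_ ?_).mono ?_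
  · refine ⟨V ∪ X, fun v => ?_, ?_, fun l hl => by omega, by omega⟩
    · rw [hfr1.iarr 9 (by decide)]; exact hU v
    · rw [h9]; exact Net.Arranged.init hVn hV
  · rintro k T τ hk hfr _ hi ⟨U, hU, hA, hcl, hT⟩
    have hS2 : Static N τ := hS1.frame hfr (by decide)
    have hxk : xs k ∈ X := Finset.mem_image_of_mem _ (Finset.mem_range.2 hk)
    refine Runs.seq_wp (R := fun τ' => τ'.ireg 11 = xs k) ?_ ?_
    · simp [wp, Instr.eval, Instr.Safe, hi, hfr.iarr 10 (by decide), hfr1.iarr 10 (by decide), h10]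
    intro t2 τ2 ht2 hfr2 _ h11
    have hcost2 : t2 ≤ 1 := ht2
    have hS3 : Static N τ2 := hS2.frame hfr2 (by decide)
    refine (Runs.forArcs_time (W := W) (l := N.adj (xs k)) (fun l T' τ' => ∃ U', U ⊆ U' ∧
      Visited U' τ' ∧ N.Arranged V X X U' (τ'.iarr 11) (τ'.ireg 9) ∧ (∀ q ∈ l, N.tgt q ∈ U') ∧
      T' + 21 * U.card ≤ 21 * U'.card + 4 * l.length) hS3.r2 (by rw [h11]; exact hS3.head _)
      (fun l1 q l2 h => hS3.next_arc _ _ _ h) (by decide)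
      (fun l T τ x h => by simpa [State.setI, Visited] using h) ?_ ?_).mono ?_
    · refine ⟨U, subset_rfl, fun v => ?_, ?_, by simp, by omega⟩
      · rw [hfr2.iarr 9 (by decide)]; exact hU v
      · rw [hfr2.iarr 11 (by decide), hfr2.ireg 9 (by decide)]; exact hA
    · rintro l1 q l2 T' τ' hl hfr3 _ hq ⟨U', hsub, hU', hA', hl1, hT'⟩
      have hS4 : Static N τ' := hS3.frame hfr3 (by decide)
      have hqa : q ∈ N.adj (xs k) := by simp [hl]
      refine Runs.seq_wp (R := fun τ => τ.ireg 13 = N.tgt q)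
        (by simp [wp, Instr.eval, Instr.Safe, hq, hS4.tgt _ q hqa]) ?_
      intro t3 τ3 ht3 hfr3 _ h13
      have hcost3 : t3 ≤ 1 := ht3
      refine Runs.seq_wp (R := fun τ => τ.ireg 14 = if N.tgt q ∈ U' then 1 else 0)
        (by simp [wp, Instr.eval, Instr.Safe, h13, hfr3.iarr 9 (by decide), hU' (N.tgt q)]) ?_
      intro t4 τ4 ht4 hfr4 _ h14
      have hcost4 : t4 ≤ 1 := ht4
      have hS5 : Static N τ4 := (hS4.frame hfr3 (by decide)).frame hfr4 (by decide)
      have hU4 : Visited U' τ4 := fun v => by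
        rw [hfr4.iarr 9 (by decide), hfr3.iarr 9 (by decide)]; exact hU' v
      have hA4 : N.Arranged V X X U' (τ4.iarr 11) (τ4.ireg 9) := by
        rw [hfr4.iarr 11 (by decide), hfr3.iarr 11 (by decide), hfr4.ireg 9 (by decide),
          hfr3.ireg 9 (by decide)]
        exact hA'
      refine Runs.ite (fun hb => ?_) (fun hb => ?_)
      · simp only [Test.Holds, h14, hS5.r2] at hb
        have hy : N.tgt q ∉ U' := fun h => by rw [if_pos h] at hb; omega
        refine (runs_walk hS5 hU4 hA4 hxk ⟨q, hqa, rfl⟩ hy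
          (by rw [hfr4.ireg 13 (by decide), h13]) hdeg hW).mono ?_
        rintro t5 τ5 _ _ ⟨U'', hsub', hU'', hA'', ht5⟩
        refine ⟨U'', hsub.trans ((Finset.subset_insert _ _).trans hsub'), hU'', hA'',
          fun r hr => ?_, ?_⟩
        · rcases List.mem_append.1 hr with hr | hr
          · exact hsub' (Finset.mem_insert_of_mem (hl1 r hr))
          · rw [List.mem_singleton.1 hr]; exact hsub' (Finset.mem_insert_self _ _)
        · rw [List.length_append, List.length_singleton]; omega
      · simp only [Test.Holds, h14, hS5.r2] at hb
        have hy : N.tgt q ∈ U' := by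
          by_contra h
          exact hb (if_neg h)
        refine Runs.instr trivial ⟨U', hsub, hU4, hA4, fun r hr => ?_, ?_⟩
        · rcases List.mem_append.1 hr with hr | hr
          · exact hl1 r hr
          · rw [List.mem_singleton.1 hr]; exact hy
        · rw [List.length_append, List.length_singleton]; omega
    · rintro t5 τ5 _ _ ⟨T', ht5, U', hsub, hU', hA', hl, hT'⟩
      refine ⟨U', hU', hA', fun l hlk v hv => ?_, ?_⟩
      · rcases Nat.lt_succ_iff_lt_or_eq.1 hlk with h | rfl
        · exact hsub (hcl l h v hv)
        · obtain ⟨r, hr, rfl⟩ := hv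
          exact hl r hr
      · have := hK k hk
        rw [Nat.mul_succ]
        omega
  · rintro t τ hfr _ ⟨T, ht, U, hU, hA, hcl, hT⟩
    have hS2 : Static N τ := hS1.frame hfr (by decide)
    refine ⟨U, τ.iarr 11, τ.ireg 9, hU, { hS2 with r8 := ?_, r9 := rfl, a10 := ?_, a11 := rfl },
      hA, fun x hx v hv => ?_, ?_⟩
    · rw [hfr.ireg 8 (by decide), hfr1.ireg 8 (by decide), h8]
    · rw [hfr.iarr 10 (by decide), hfr1.iarr 10 (by decide), h10]
    · obtain ⟨l, hl, rfl⟩ := Finset.mem_image.1 hx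
      exact hcl l (Finset.mem_range.1 hl) v hv
    · have : (6 * K + 5) * p = (6 * K + 3) * p + 2 * p := by ring
      omega

end Algo

end RealRAM

/-! ### Solving whole components -/

namespace RealRAM

local infixr:60 " ⨾ " => Program.seq
local prefix:max "◇" => Program.instr

namespace Algo

open scoped Classical

variable {W : ℕ} {N : Net} {σ : State} {V : Finset ℕ} {xs : ℕ → ℕ} {p K : ℕ}

theorem runs_visitBranching (hS : Static N σ) (h8 : σ.ireg 8 = p) (h10 : σ.iarr 10 = xs)
    (hV : Visited V σ) :
    Runs W visitBranching σ fun t τ => t ≤ 4 * p + 2 ∧ Visited (V ∪ Net.verts xs p) τ := by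
  refine Runs.forUp 2 (fun k τ => Visited (V ∪ Net.verts xs k) τ) hS.r3 h8 (by decide)
    (fun k τ x h => h) (by simpa [Net.verts] using hV) ?_
  intro k τ hk hfr _ hi hinv
  have hS' : Static N τ := hS.frame hfr (by decide)
  refine (Runs.of_wp (Q := fun υ => υ.iarr 9 = Function.update (τ.iarr 9) (xs k) 1) ?_).mono
    fun t υ _ _ h => ⟨h.1, ?_⟩
  · simp [wp, Instr.eval, Instr.Safe, hi, hfr.iarr 10 (by decide), h10, hS'.r3]
  · have := hinv.insert h.2
    rwa [← Finset.union_insert, ← Net.verts_succ] at this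

/-- The visited vertices `V` are a union of components with an optimal solution in array `14`. -/
structure Solved (N : Net) (V : Finset ℕ) (σ : State) : Prop where
  visited : Visited V σ
  lt : ∀ v ∈ V, v < N.n
  closed : N.Closed V
  maxIndep : N.MaxIndep (N.els V) (sol (N.els V) σ)
  zero : ∀ i, i ∉ N.els V → i ≠ N.n + N.m → σ.iarr 14 i = 0

/-- As `V` is closed, the new elements neither meet nor conflict with the old ones, so both
solutions can be joined. The dummy is exempt in `hout`, because it may occur in the arrangement and
its cell may then be cleared. -/
theorem Solved.union {τ : State} {U A : Finset ℕ} (h : Solved N V σ) (hVU : V ⊆ U)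
    (hU : Visited U τ) (hlt : ∀ u ∈ U, u < N.n) (hcl : N.Closed U) (hA : A = N.els (U \ V))
    (hI : N.MaxIndep A (sol A τ))
    (hout : ∀ i, i ∉ A → i ≠ N.n + N.m → τ.iarr 14 i = σ.iarr 14 i) : Solved N U τ := by
  have hels : N.els U = N.els V ∪ A := by
    rw [hA, ← Net.els_union, Finset.union_sdiff_of_subset hVU]
  have hlt' : ∀ u ∈ U \ V, u < N.n := fun u hu => hlt u (Finset.mem_sdiff.1 hu).1
  have hdis : Disjoint (N.els V) A := hA ▸
    Net.disjoint_els_of_closed h.closed Finset.disjoint_sdiff h.lt hlt'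
  have hne : ∀ i ∈ N.els U, i ≠ N.n + N.m := fun i hi => by
    obtain ⟨v, hv, hi⟩ := Net.mem_els.1 hi
    exact (Net.lt_of_mem_star (hlt v hv) hi).ne
  refine ⟨hU, hlt, hcl, ?_, fun i hi hi' => ?_⟩
  · have hsol : sol (N.els U) τ = sol (N.els V) σ ∪ sol A τ := by
      rw [hels, sol, Finset.filter_union]
      congr 1
      refine Finset.filter_congr fun i hi => ?_
      rw [hout i (Finset.disjoint_left.1 hdis hi)
        (hne i (hels ▸ Finset.mem_union_left _ hi))]
    rw [hsol, hels]
    refine h.maxIndep.union hI hdis fun i hi j hj => ?_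
    rw [hA] at hj
    exact Net.not_conf_of_closed h.closed Finset.disjoint_sdiff h.lt hlt' hi hj
  · rw [hels, Finset.mem_union, not_or] at hi
    rw [hout i hi.2 hi', h.zero i hi.1 hi']

theorem runs_group (hS : Static N σ) (h8 : σ.ireg 8 = p) (h10 : σ.iarr 10 = xs)
    (hV : Solved N V σ) (hxn : ∀ k < p, xs k < N.n) (hxV : ∀ k < p, xs k ∉ V)
    (hdeg : ∀ v < N.n, v ∉ V ∪ Net.verts xs p → (N.adj v).length ≤ 2)
    (hK : ∀ v < N.n, v ∉ V → (N.adj v).length ≤ K) (hW : 3 * N.n ≤ W) :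
    Runs W group σ fun t τ => ∃ U, V ∪ Net.verts xs p ⊆ U ∧ Solved N U τ ∧
      t ≤ (K + 2) ^ p *
        ((22 * K + 65) * p + 114 * (U.card - (V ∪ Net.verts xs p).card) + 45) := by
  set X := Net.verts xs p with hX
  have hXn : ∀ x ∈ X, ∃ k < p, x = xs k := fun x hx => by
    obtain ⟨k, hk, rfl⟩ := Finset.mem_image.1 hx
    exact ⟨k, Finset.mem_range.1 hk, rfl⟩
  have hVn : ∀ u ∈ V ∪ X, u < N.n := fun u hu => by
    rcases Finset.mem_union.1 hu with hu | hu
    · exact hV.lt u hu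
    · obtain ⟨k, hk, rfl⟩ := hXn u hu
      exact hxn k hk
  refine (runs_visitBranching hS h8 h10 hV.visited).seq ?_
  rintro t1 τ1 hfr1 _ ⟨ht1, h1⟩
  have hS1 : Static N τ1 := hS.frame hfr1 (by decide)
  refine (runs_walks hS1 (by rw [hfr1.ireg 8 (by decide), h8])
    (by rw [hfr1.iarr 10 (by decide), h10]) h1 hVn hV.closed hdeg
    (fun k hk => hK _ (hxn k hk) (hxV k hk)) hW).seq ?_
  rintro t2 τ2 hfr2 _ ⟨U, s, L, hU, hH, hA, hcl, ht2⟩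
  have hVU : V ⊆ U := Finset.union_subset_left hA.sub
  have hXU : X ⊆ U := Finset.union_subset_right hA.sub
  have hXUV : X ⊆ U \ V := fun x hx => Finset.mem_sdiff.2 ⟨hXU hx, fun h => by
    obtain ⟨k, hk, rfl⟩ := hXn x hx
    exact hxV k hk h⟩
  have hsub : N.els X ⊆ N.els (U \ V) := Finset.biUnion_subset_biUnion_of_subset_left _ hXUV
  have hp := hA.pathSeq hV.closed hcl
  have h14 : τ2.iarr 14 = σ.iarr 14 := by rw [hfr2.iarr 14 (by decide), hfr1.iarr 14 (by decide)]
  have hltU : ∀ u ∈ U \ V, u < N.n := fun u hu => hA.lt u (Finset.mem_sdiff.1 hu).1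
  refine (runs_search (K := K) hH hp (A := N.els (U \ V))
    (Finset.union_sdiff_of_subset hsub).symm Finset.disjoint_sdiff hxn ?_ ?_).mono ?_
  -- A neighbour of a branching vertex lies outside the closed set `V`, so its degree is bounded as
  -- well.
  · rintro k hk v (rfl | hv)
    · exact hK _ (hxn k hk) (hxV k hk)
    · exact hK _ hv.lt_right fun h => hxV k hk (hV.closed _ h _ hv.symm)
  · intro i hi
    rw [h14]
    refine hV.zero i (fun h => ?_) ?_
    · exact Finset.disjoint_left.1 (Net.disjoint_els_of_closed hV.closed Finset.disjoint_sdiff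
        hV.lt hltU) h hi
    · obtain ⟨v, hv, hi⟩ := Net.mem_els.1 hi
      exact (Net.lt_of_mem_star (hltU v hv) hi).ne
  · rintro t3 τ3 hfr3 _ ⟨ht3, hI, hout⟩
    refine ⟨U, hA.sub, hV.union hVU ?_ hA.lt (hA.closed_all hcl) rfl hI ?_, ?_⟩
    · intro v
      rw [hfr3.iarr 9 (by decide)]; exact hU v
    · intro i hi hi'
      rw [hout i ?_, h14]
      rintro (h | ⟨k, hk, hki⟩)
      · exact hi (hsub h)
      · exact hi (Finset.mem_sdiff.1 ((hp.mem i).2 ⟨k, hk, hki, hi'⟩)).1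
    · have hlen := hA.len
      have hcard := Finset.card_le_card hA.sub
      obtain ⟨g, hg⟩ := Nat.exists_eq_add_of_le hcard
      have hL : L ≤ 3 * g := by omega
      rw [hg, Nat.add_sub_cancel_left]
      have hone : 1 ≤ (K + 2) ^ p := Nat.one_le_pow _ _ (by omega)
      -- The factor 93 is 3 * 31, from `L ≤ 3 * g`. The second summand absorbs the walks and the
      -- initialisation, which happen only once.
      have e1 : (K + 2) ^ p * ((22 * K + 65) * p + 114 * g + 45) =
          (K + 2) ^ p * ((16 * K + 53) * p + 93 * g + 35) +
            (K + 2) ^ p * ((6 * K + 12) * p + 21 * g + 10) := by ring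
      have e2 : (K + 2) ^ p * ((16 * K + 53) * p + 31 * L + 35) ≤
          (K + 2) ^ p * ((16 * K + 53) * p + 93 * g + 35) := Nat.mul_le_mul_left _ (by omega)
      have e3 := Nat.le_mul_of_pos_left ((6 * K + 12) * p + 21 * g + 10) hone
      have e4 : (6 * K + 12) * p = (6 * K + 5) * p + 7 * p := by ring
      omega

end Algo

end RealRAM

/-! ### Reading the input into linked lists -/

namespace Net

variable {N : Net} {k v : ℕ}

theorem adjTo_succ (hk : k < N.m) : N.adjTo (k + 1) v =
    if v = N.snd k then (N.m + k + 1) :: N.adjTo k v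
    else if v = N.fst k then (k + 1) :: N.adjTo k v else N.adjTo k v := by
  have := N.ne k hk
  rw [adjTo]
  by_cases h1 : v = N.snd k
  · simp [h1, this]
  · by_cases h2 : v = N.fst k
    · simp [h2, this, this.symm]
    · simp [h1, h2, Ne.symm h1, Ne.symm h2]

end Net

namespace RealRAM

local infixr:60 " ⨾ " => Program.seq
local prefix:max "◇" => Program.instr

/-- The memory holds only the graph `N`. -/
structure Loaded (N : Net) (σ : State) : Prop where
  r0 : σ.ireg 0 = N.n
  r1 : σ.ireg 1 = N.m
  r2 : σ.ireg 2 = 0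
  fst : ∀ j < N.m, σ.iarr 0 j = N.fst j
  snd : ∀ j < N.m, σ.iarr 1 j = N.snd j
  arr : ∀ a, 2 ≤ a → ∀ i, σ.iarr a i = 0
  wV : ∀ i < N.n, σ.rarr 0 i = N.w i
  wE : ∀ j < N.m, σ.rarr 1 j = N.w (N.n + j)
  w_zero : ∀ i, N.n + N.m ≤ i → N.w i = 0
  rarr : ∀ i, σ.rarr 2 i = 0
  rz : σ.rreg 0 = 0

/-- Arrays `4` to `7` hold the linked lists of the first `k` edges, real array `2` the weights of
the vertices and of the first `k` edges. -/
structure Linked (N : Net) (k : ℕ) (σ : State) : Prop where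
  head : ∀ v, σ.iarr 4 v = (N.adjTo k v).headD 0
  next : ∀ v l1 p l2, N.adjTo k v = l1 ++ p :: l2 → σ.iarr 5 p = l2.headD 0
  next_zero : σ.iarr 5 0 = 0
  tgt : ∀ v, ∀ p ∈ N.adjTo k v, σ.iarr 6 p = N.tgt p
  eid : ∀ v, ∀ p ∈ N.adjTo k v, σ.iarr 7 p = N.eid p
  w : ∀ i, σ.rarr 2 i = if i < N.n + k then N.w i else 0

/-- The two new arcs are put in front of the lists of two distinct vertices, and their numbers occur
in no earlier list, so the old entries survive. -/
theorem Linked.succ {N : Net} {k : ℕ} {σ τ : State} (h : Linked N k σ) (hk : k < N.m)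
    (h4 : τ.iarr 4 = Function.update (Function.update (σ.iarr 4) (N.fst k) (k + 1)) (N.snd k)
      (N.m + k + 1))
    (h5 : τ.iarr 5 = Function.update (Function.update (σ.iarr 5) (k + 1) (σ.iarr 4 (N.fst k)))
      (N.m + k + 1) (σ.iarr 4 (N.snd k)))
    (h6 : τ.iarr 6 = Function.update (Function.update (σ.iarr 6) (k + 1) (N.snd k))
      (N.m + k + 1) (N.fst k))
    (h7 : τ.iarr 7 = Function.update (Function.update (σ.iarr 7) (k + 1) (N.n + k))
      (N.m + k + 1) (N.n + k))
    (hw : τ.rarr 2 = Function.update (σ.rarr 2) (N.n + k) (N.w (N.n + k))) :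
    Linked N (k + 1) τ := by
  have hne := N.ne k hk
  have hold : ∀ v, ∀ p ∈ N.adjTo k v, p ≠ 0 ∧ p ≠ k + 1 ∧ p ≠ N.m + k + 1 := by
    intro v p hp
    have := N.mem_adjTo.1 hp
    omega
  have hmem : ∀ v, ∀ p ∈ N.adjTo (k + 1) v, p = N.m + k + 1 ∨ p = k + 1 ∨ p ∈ N.adjTo k v := by
    intro v p hp
    rw [Net.adjTo_succ hk] at hp
    split_ifs at hp <;> (try rw [List.mem_cons] at hp) <;> tauto
  refine ⟨fun v => ?_, fun v l1 p l2 hl => ?_, ?_, fun v p hp => ?_, fun v p hp => ?_, fun i => ?_⟩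
  · rw [h4, Net.adjTo_succ hk, Function.update_apply, Function.update_apply, h.head]
    split_ifs <;> rfl
  · have hcase : p ∈ N.adjTo k v → (∃ l, N.adjTo k v = l ++ p :: l2) →
        τ.iarr 5 p = l2.headD 0 := by
      rintro hp ⟨l, hl⟩
      rw [h5, Function.update_of_ne (hold v p hp).2.2, Function.update_of_ne (hold v p hp).2.1,
        h.next v l p l2 hl]
    rw [Net.adjTo_succ hk] at hl
    cases l1 with
    | nil =>
      split_ifs at hl with h1 h2
      · obtain ⟨rfl, rfl⟩ := List.cons.inj hl
        rw [h5, Function.update_self, ← h1, h.head]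
      · obtain ⟨rfl, rfl⟩ := List.cons.inj hl
        rw [h5, Function.update_of_ne (by omega), Function.update_self, ← h2, h.head]
      · exact hcase (by simp [hl]) ⟨[], hl⟩
    | cons a l1 =>
      split_ifs at hl with h1 h2
      · obtain ⟨rfl, hl'⟩ := List.cons.inj hl
        exact hcase (by simp [hl']) ⟨_, hl'⟩
      · obtain ⟨rfl, hl'⟩ := List.cons.inj hl
        exact hcase (by simp [hl']) ⟨_, hl'⟩
      · exact hcase (by simp [hl]) ⟨_, hl⟩
  · rw [h5, Function.update_of_ne (by omega), Function.update_of_ne (by omega), h.next_zero]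
  · rw [h6]
    rcases hmem v p hp with rfl | rfl | hp
    · rw [Function.update_self, Net.tgt, if_neg (by omega)]
      congr 1; omega
    · rw [Function.update_of_ne (by omega), Function.update_self, Net.tgt, if_pos (by omega)]
      rfl
    · rw [Function.update_of_ne (hold v p hp).2.2, Function.update_of_ne (hold v p hp).2.1,
        h.tgt v p hp]
  · rw [h7]
    rcases hmem v p hp with rfl | rfl | hp
    · rw [Function.update_self, Net.eid, if_neg (by omega)]
      omega
    · rw [Function.update_of_ne (by omega), Function.update_self, Net.eid, if_pos (by omega)]
      rfl
    · rw [Function.update_of_ne (hold v p hp).2.2, Function.update_of_ne (hold v p hp).2.1,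
        h.eid v p hp]
  · rw [hw, Function.update_apply, h.w]
    split_ifs <;> first | omega | rfl | simp_all

namespace Algo

variable {W : ℕ} {N : Net} {σ : State} {k K : ℕ}

theorem runs_addEdge (h0 : σ.ireg 0 = N.n) (h1 : σ.ireg 1 = N.m) (h3 : σ.ireg 3 = 1)
    (hf : σ.iarr 0 k = N.fst k) (hs : σ.iarr 1 k = N.snd k) (hw : σ.rarr 1 k = N.w (N.n + k))
    (hk : k < N.m) (hi : σ.ireg 10 = k) (hL : Linked N k σ) (hW : N.n + 2 * N.m ≤ W) :
    Runs W addEdge σ fun t τ => t ≤ 17 ∧ Linked N (k + 1) τ := by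
  have hne := N.ne k hk
  have hadd : k + 1 + N.m = N.m + k + 1 := by omega
  refine (Runs.of_wp (Q := fun τ =>
    τ.iarr 4 = Function.update (Function.update (σ.iarr 4) (N.fst k) (k + 1)) (N.snd k)
      (N.m + k + 1) ∧
    τ.iarr 5 = Function.update (Function.update (σ.iarr 5) (k + 1) (σ.iarr 4 (N.fst k)))
      (N.m + k + 1) (σ.iarr 4 (N.snd k)) ∧
    τ.iarr 6 = Function.update (Function.update (σ.iarr 6) (k + 1) (N.snd k))
      (N.m + k + 1) (N.fst k) ∧
    τ.iarr 7 = Function.update (Function.update (σ.iarr 7) (k + 1) (N.n + k))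
      (N.m + k + 1) (N.n + k) ∧
    τ.rarr 2 = Function.update (σ.rarr 2) (N.n + k) (N.w (N.n + k))) ?_).mono
    fun t τ _ _ h => ⟨h.1, hL.succ hk h.2.1 h.2.2.1 h.2.2.2.1 h.2.2.2.2.1 h.2.2.2.2.2⟩
  simp [addEdge, wp, Instr.eval, Instr.Safe, h0, h1, h3, hf, hs, hw, hi, hne.symm, hadd]
  omega

theorem runs_setup (hL : Loaded N σ) (hn : 1 ≤ N.n) (hW : 3 * N.n + 2 * N.m ≤ W) :
    Runs W setup σ fun t τ => t ≤ 4 * N.n + 19 * N.m + 10 ∧ Static N τ ∧ τ.iarr 5 0 = 0 ∧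
      (∀ i, τ.iarr 9 i = 0) ∧ ∀ i, τ.iarr 14 i = 0 := by
  refine Runs.mono (Q := fun t τ => t ≤ 4 * N.n + 19 * N.m + 10 ∧ Static N τ ∧ τ.iarr 5 0 = 0)
    ?_ fun t τ hfr _ h => ⟨h.1, h.2.1, h.2.2, fun i => ?_, fun i => ?_⟩
  rotate_left
  · rw [hfr.iarr 9 (by decide), hL.arr 9 (by omega)]
  · rw [hfr.iarr 14 (by decide), hL.arr 14 (by omega)]
  refine Runs.seq_wp (R := fun τ => τ.ireg 3 = 1)
    (by simp [wp, Instr.eval, Instr.Safe]; omega) ?_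
  intro t1 τ1 ht1 hfr1 _ h3
  have hcost1 : t1 ≤ 1 := ht1
  refine Runs.seq_wp (R := fun τ => τ.ireg 4 = 2)
    (by simp [wp, Instr.eval, Instr.Safe]; omega) ?_
  intro t2 τ2 ht2 hfr2 _ h4
  have hcost2 : t2 ≤ 1 := ht2
  have g0 : τ2.ireg 0 = N.n := by rw [hfr2.ireg 0 (by decide), hfr1.ireg 0 (by decide), hL.r0]
  have g1 : τ2.ireg 1 = N.m := by rw [hfr2.ireg 1 (by decide), hfr1.ireg 1 (by decide), hL.r1]
  refine Runs.seq_wp (R := fun τ => τ.ireg 6 = N.n + N.m)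
    (by simp [wp, Instr.eval, Instr.Safe, g0, g1]; omega) ?_
  intro t3 τ3 ht3 hfr3 _ h6
  have hcost3 : t3 ≤ 1 := ht3
  have k0 := (hfr3.ireg 0 (by decide)).trans g0
  have k1 := (hfr3.ireg 1 (by decide)).trans g1
  have k3 : τ3.ireg 3 = 1 := by rw [hfr3.ireg 3 (by decide), hfr2.ireg 3 (by decide), h3]
  have k4 : τ3.ireg 4 = 2 := by rw [hfr3.ireg 4 (by decide), h4]
  -- The code `2 * N.m + 1` is reached from `N.n + N.m` by adding `N.m`, subtracting `N.n` and
  -- adding one.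
  refine Runs.seq_wp (R := fun τ => τ.ireg 7 = N.n + 2 * N.m)
    (by simp [wp, Instr.eval, Instr.Safe, k1, h6]; omega) ?_
  intro t4 τ4 ht4 hfr4 _ h7
  have hcost4 : t4 ≤ 1 := ht4
  refine Runs.seq_wp (R := fun τ => τ.ireg 7 = 2 * N.m)
    (by simp [wp, Instr.eval, Instr.Safe, h7, hfr4.ireg 0 (by decide), k0]) ?_
  intro t5 τ5 ht5 hfr5 _ h7
  have hcost5 : t5 ≤ 1 := ht5
  refine Runs.seq_wp (R := fun τ => τ.ireg 7 = 2 * N.m + 1)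
    (by simp [wp, Instr.eval, Instr.Safe, h7, hfr5.ireg 3 (by decide), hfr4.ireg 3 (by decide), k3]
        omega) ?_
  intro t6 τ6 ht6 hfr6 _ h7
  have hcost6 : t6 ≤ 1 := ht6
  have hfr : Frame (◇(.const 3 1) ⨾ ◇(.const 4 2) ⨾ ◇(.add 6 0 1) ⨾ ◇(.add 7 6 1) ⨾
    ◇(.sub 7 7 0) ⨾ ◇(.add 7 7 3)) σ τ6 :=
    hfr1.seq (hfr2.seq (hfr3.seq (hfr4.seq (hfr5.seq hfr6))))
  have hfr46 : Frame (◇(.add 7 6 1) ⨾ ◇(.sub 7 7 0) ⨾ ◇(.add 7 7 3)) τ3 τ6 :=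
    hfr4.seq (hfr5.seq hfr6)
  have q0 := (hfr46.ireg 0 (by decide)).trans k0
  have q1 := (hfr46.ireg 1 (by decide)).trans k1
  have q3 := (hfr46.ireg 3 (by decide)).trans k3
  have q4 := (hfr46.ireg 4 (by decide)).trans k4
  have q6 := (hfr46.ireg 6 (by decide)).trans h6
  have harr : τ6.iarr = σ.iarr := by
    funext a
    exact hfr.iarr a (by simp [Program.collect, Instr.aw])
  have hrarr : τ6.rarr = σ.rarr := by
    funext a
    exact hfr.rarr a (by simp [Program.collect, Instr.raw])
  refine (Runs.forUp (W := W) (L := N.n) 2 (fun k τ => ∀ i, τ.rarr 2 i = if i < k then N.w i else 0)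
    q3 q0 (by decide) (fun k τ x h => h) (by simp [hrarr, hL.rarr]) ?_).seq ?_
  · intro k τ hk hfr' _ hi hinv
    refine (Runs.of_wp (Q := fun υ => υ.rarr 2 = Function.update (τ.rarr 2) k (N.w k)) ?_).mono
      fun t υ _ _ h => ⟨h.1, fun i => ?_⟩
    · simp [wp, Instr.eval, Instr.Safe, hi, hfr'.rarr 0 (by decide), hrarr, hL.wV k hk]
    · rw [h.2, Function.update_apply, hinv]
      split_ifs <;> first | omega | rfl | simp_all
  rintro t7 τ7 hfr7 _ ⟨ht7, h7w⟩
  have r0 := (hfr7.ireg 0 (by decide)).trans q0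
  have r1 := (hfr7.ireg 1 (by decide)).trans q1
  have r3 := (hfr7.ireg 3 (by decide)).trans q3
  have harr7 : ∀ a, τ7.iarr a = σ.iarr a := by
    intro a
    rw [hfr7.iarr a (by simp [forUp, Program.collect, Instr.aw]), harr]
  refine (Runs.forUp (W := W) (L := N.m) 17 (fun k τ => Linked N k τ) r3 r1 (by decide)
    (fun k τ x h => ⟨h.1, h.2, h.3, h.4, h.5, h.6⟩) ?_ ?_).mono ?_
  · have h4 := hL.arr 4 (by omega)
    have h5 := hL.arr 5 (by omega)
    refine ⟨?_, ?_, ?_, ?_, ?_, ?_⟩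
    · simp [harr7, h4, Net.adjTo]
    · simp [Net.adjTo]
    · simp [harr7, h5]
    · simp [Net.adjTo]
    · simp [Net.adjTo]
    · simpa using h7w
  · intro k τ hk hfr8 _ hi hinv
    refine runs_addEdge ?_ ?_ ?_ ?_ ?_ ?_ hk hi hinv (by omega)
    · rw [hfr8.ireg 0 (by decide), r0]
    · rw [hfr8.ireg 1 (by decide), r1]
    · rw [hfr8.ireg 3 (by decide), r3]
    · rw [hfr8.iarr 0 (by decide), harr7, hL.fst k hk]
    · rw [hfr8.iarr 1 (by decide), harr7, hL.snd k hk]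
    · rw [hfr8.rarr 1 (by decide), hfr7.rarr 1 (by decide), hrarr, hL.wE k hk]
  · rintro t8 τ8 hfr8 _ ⟨ht8, h⟩
    have hreg : ∀ x ∈ [0, 1, 2, 3, 4, 6, 7], τ8.ireg x = τ6.ireg x := by
      intro x hx
      simp only [List.mem_cons, List.not_mem_nil, or_false] at hx
      rcases hx with rfl | rfl | rfl | rfl | rfl | rfl | rfl <;>
        rw [hfr8.ireg _ (by decide), hfr7.ireg _ (by decide)]
    refine ⟨by omega, ⟨?_, ?_, ?_, ?_, ?_, ?_, ?_, h.head, h.next, h.tgt, h.eid, fun i => ?_, ?_⟩,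
      h.next_zero⟩
    · rw [hreg _ (by simp), q0]
    · rw [hreg _ (by simp), q1]
    · rw [hreg _ (by simp), hfr.ireg 2 (by decide), hL.r2]
    · rw [hreg _ (by simp), q3]
    · rw [hreg _ (by simp), q4]
    · rw [hreg _ (by simp), q6]
    · rw [hreg _ (by simp), h7]
    · rw [h.w]
      split_ifs with hi
      · rfl
      · exact (hL.w_zero i (by omega)).symm
    · rw [hfr8.rreg 0 (by decide), hfr7.rreg 0 (by decide), hfr.rreg 0 (by decide), hL.rz]

/-- Following two pointers from the head tests for degree at least three in constant time. Short
lists cause no harm, because the successor of the end mark `0` is `0`. -/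
theorem third_arc {v : ℕ} (hS : Static N σ) (hz : σ.iarr 5 0 = 0) :
    σ.iarr 5 (σ.iarr 5 (σ.iarr 4 v)) = ((N.adj v).drop 2).headD 0 := by
  have key : ∀ l1 l2, N.adj v = l1 ++ l2 → σ.iarr 5 (l2.headD 0) = (l2.drop 1).headD 0 := by
    intro l1 l2 hl
    cases l2 with
    | nil => simpa using hz
    | cons p l2 => simpa using hS.next v l1 p l2 hl
  rw [hS.head, key [] (N.adj v) rfl, key _ _ (List.take_append_drop 1 (N.adj v)).symm,
    List.drop_drop]

theorem runs_findBranching (hS : Static N σ) (hz : σ.iarr 5 0 = 0) (hW : N.n ≤ W) :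
    Runs W findBranching σ fun t τ => t ≤ 8 * N.n + 3 ∧
      τ.ireg 8 = ((Finset.range N.n).filter fun v => 3 ≤ (N.adj v).length).card ∧
      Net.verts (τ.iarr 10) (τ.ireg 8) =
        (Finset.range N.n).filter fun v => 3 ≤ (N.adj v).length := by
  refine Runs.seq_wp (R := fun τ => τ.ireg 8 = 0)
    (by simp [wp, Instr.eval, Instr.Safe]) ?_
  intro t1 τ1 ht1 hfr1 _ h8
  have hcost1 : t1 ≤ 1 := ht1
  have hS1 : Static N τ1 := hS.frame hfr1 (by decide)
  refine (Runs.forUp (W := W) (L := N.n) 6 (fun k τ =>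
      τ.ireg 8 = ((Finset.range k).filter fun v => 3 ≤ (N.adj v).length).card ∧
      Net.verts (τ.iarr 10) (τ.ireg 8) =
        (Finset.range k).filter fun v => 3 ≤ (N.adj v).length) hS1.r3 hS1.r0 (by decide)
    (fun k τ x h => by simpa [State.setI] using h) (by simp [h8, Net.verts]) ?_).mono
    fun t τ _ _ h => ⟨by have := h.1; omega, h.2⟩
  rintro k τ hk hfr _ hi ⟨g1, g2⟩
  have hS2 : Static N τ := hS1.frame hfr (by decide)
  have hz2 : τ.iarr 5 0 = 0 := by rw [hfr.iarr 5 (by decide), hfr1.iarr 5 (by decide), hz]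
  have hthird := third_arc (v := k) hS2 hz2
  have hiff : ((N.adj k).drop 2).headD 0 = 0 ↔ ¬ 3 ≤ (N.adj k).length := by
    rcases hd : (N.adj k).drop 2 with _ | ⟨p, l⟩
    · have := List.drop_eq_nil_iff.1 hd
      simp; omega
    · have hlen := congrArg List.length hd
      have hp : p ∈ N.adj k := List.mem_of_mem_drop (i := 2) (by simp [hd])
      have := (N.mem_adj.1 hp).1
      simp at hlen ⊢; omega
  have hcard : τ.ireg 8 ≤ k := by
    rw [g1]
    exact (Finset.card_filter_le _ _).trans (by simp)
  refine (Runs.of_wp (Q := fun υ => if 3 ≤ (N.adj k).length then υ.ireg 8 = τ.ireg 8 + 1 ∧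
    υ.iarr 10 = Function.update (τ.iarr 10) (τ.ireg 8) k else υ.ireg 8 = τ.ireg 8 ∧
    υ.iarr 10 = τ.iarr 10) ?_).mono fun t υ _ _ h => ⟨h.1.trans (by decide), ?_⟩
  · obtain ⟨c, hc⟩ : ∃ c, c = ((N.adj k).drop 2).headD 0 := ⟨_, rfl⟩
    rw [← hc] at hthird hiff
    by_cases h : 3 ≤ (N.adj k).length
    · have hc0 : c ≠ 0 := fun h' => hiff.1 h' h
      simp [wp, Instr.eval, Instr.Safe, Test.Holds, hi, hthird, hS2.r2, hS2.r3, h, hc0]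
      omega
    · simp [wp, Instr.eval, Instr.Safe, Test.Holds, hi, hthird, hS2.r2, h, hiff.2 h]
  · obtain ⟨_, h⟩ := h
    rw [Finset.range_add_one, Finset.filter_insert]
    split_ifs at h ⊢ with hd
    · rw [Finset.card_insert_of_notMem (by simp), h.1, g1, Net.verts_succ, h.2, ← g1,
        Function.update_self, ← g2]
      refine ⟨rfl, ?_⟩
      congr 1
      refine Finset.image_congr fun i hi => ?_
      rw [Function.update_of_ne (by simp at hi; omega)]
    · rw [h.1, h.2]
      exact ⟨g1, g2⟩

theorem runs_output (hS : Static N σ) (hW : N.n + N.m ≤ W) :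
    Runs W output σ fun t τ => t ≤ 4 * N.n + 5 * N.m + 4 ∧ τ.iarr 14 = σ.iarr 14 ∧
      (∀ v < N.n, τ.iarr 2 v = σ.iarr 14 v) ∧ ∀ j < N.m, τ.iarr 3 j = σ.iarr 14 (N.n + j) := by
  refine (Runs.forUp (W := W) (L := N.n) 2 (fun k τ => ∀ v < k, τ.iarr 2 v = σ.iarr 14 v) hS.r3
    hS.r0 (by decide) (fun k τ x h => h) (by simp) ?_).seq ?_
  · intro k τ hk hfr _ hi hinv
    refine (Runs.of_wp (Q := fun υ => υ.iarr 2 = Function.update (τ.iarr 2) k (σ.iarr 14 k)) ?_).mono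
      fun t υ _ _ h => ⟨h.1, fun v hv => ?_⟩
    · simp [wp, Instr.eval, Instr.Safe, hi, hfr.iarr 14 (by decide)]
    · rw [h.2, Function.update_apply]
      split_ifs with hvk
      · rw [hvk]
      · exact hinv v (by omega)
  rintro t1 τ1 hfr1 _ ⟨ht1, h1⟩
  have hS1 : Static N τ1 := hS.frame hfr1 (by decide)
  refine (Runs.forUp (W := W) (L := N.m) 3 (fun k τ => ∀ v < k, τ.iarr 3 v = σ.iarr 14 (N.n + v))
    hS1.r3 hS1.r1 (by decide) (fun k τ x h => h) (by simp) ?_).mono ?_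
  · intro k τ hk hfr _ hi hinv
    refine (Runs.of_wp (Q := fun υ =>
      υ.iarr 3 = Function.update (τ.iarr 3) k (σ.iarr 14 (N.n + k))) ?_).mono
      fun t υ _ _ h => ⟨h.1, fun v hv => ?_⟩
    · have hS2 : Static N τ := hS1.frame hfr (by decide)
      simp [wp, Instr.eval, Instr.Safe, hi, hfr.iarr 14 (by decide), hfr1.iarr 14 (by decide),
        hS2.r0]
      omega
    · rw [h.2, Function.update_apply]
      split_ifs with hvk
      · rw [hvk]
      · exact hinv v (by omega)
  · rintro t2 τ2 hfr2 _ ⟨ht2, h2⟩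
    refine ⟨by omega, ?_, fun v hv => ?_, h2⟩
    · rw [hfr2.iarr 14 (by decide), hfr1.iarr 14 (by decide)]
    · rw [hfr2.iarr 2 (by decide), h1 v hv]

end Algo

end RealRAM

/-! ### The components without branching vertices and the whole program -/

namespace RealRAM

local infixr:60 " ⨾ " => Program.seq
local prefix:max "◇" => Program.instr

namespace Algo

variable {W : ℕ} {N : Net} {σ τ : State} {V : Finset ℕ} {K r : ℕ}

theorem Solved.congr (h : Solved N V σ) (h9 : τ.iarr 9 = σ.iarr 9) (h14 : τ.iarr 14 = σ.iarr 14) :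
    Solved N V τ := by
  refine ⟨fun v => by rw [h9]; exact h.visited v, h.lt, h.closed, ?_, fun i hi hi' => by
    rw [h14]; exact h.zero i hi hi'⟩
  rw [sol, h14]
  exact h.maxIndep

theorem Solved.card_le (h : Solved N V σ) : V.card ≤ N.n := by
  simpa using Finset.card_le_card (s := V) (t := Finset.range N.n) fun u hu =>
    Finset.mem_range.2 (h.lt u hu)

/-- All unvisited vertices have degree at most two, so removing the star of `r` leaves paths in its
component. With `K = 2` and `p = 1` the bound of `runs_group` is 4 * (109 + 45) = 616 units for `r`
and 4 * 114 = 456 for each further vertex, hence at most 616 per newly visited vertex. -/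
theorem runs_component (hS : Static N σ) (hV : Solved N V σ) (h25 : σ.ireg 25 = r)
    (hr : r < N.n) (hdeg : ∀ v < N.n, v ∉ V → (N.adj v).length ≤ 2) (hW : 3 * N.n ≤ W) :
    Runs W component σ fun t τ => ∃ U, V ⊆ U ∧ r ∈ U ∧ Solved N U τ ∧
      t + 616 * V.card ≤ 616 * U.card + 5 := by
  refine Runs.seq_wp (R := fun τ => τ.ireg 11 = if r ∈ V then 1 else 0)
    (by simp [wp, Instr.eval, Instr.Safe, h25, hV.visited r]) ?_
  intro t1 τ1 ht1 hfr1 _ h11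
  have hcost1 : t1 ≤ 1 := ht1
  have hS1 : Static N τ1 := hS.frame hfr1 (by decide)
  have hV1 : Solved N V τ1 := hV.congr (hfr1.iarr 9 (by decide)) (hfr1.iarr 14 (by decide))
  refine Runs.ite (fun hb => ?_) (fun hb => ?_)
  · simp only [Test.Holds, h11, hS1.r2] at hb
    have hrV : r ∉ V := fun h => by rw [if_pos h] at hb; omega
    refine Runs.seq_wp (R := fun τ => τ.iarr 10 0 = r)
      (by simp [wp, Instr.eval, Instr.Safe, hS1.r2, hfr1.ireg 25 (by decide), h25]) ?_
    intro t2 τ2 ht2 hfr2 _ h10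
    have hcost2 : t2 ≤ 1 := ht2
    refine Runs.seq_wp (R := fun τ => τ.ireg 8 = 1)
      (by simp [wp, Instr.eval, Instr.Safe, hfr2.ireg 3 (by decide), hS1.r3]) ?_
    intro t3 τ3 ht3 hfr3 _ h8
    have hcost3 : t3 ≤ 1 := ht3
    have hS3 : Static N τ3 := (hS1.frame hfr2 (by decide)).frame hfr3 (by decide)
    have hV3 : Solved N V τ3 := (hV1.congr (hfr2.iarr 9 (by decide))
      (hfr2.iarr 14 (by decide))).congr (hfr3.iarr 9 (by decide)) (hfr3.iarr 14 (by decide))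
    have h10' : τ3.iarr 10 0 = r := by rw [hfr3.iarr 10 (by decide), h10]
    have hverts : Net.verts (τ3.iarr 10) 1 = {r} := by simp [Net.verts, h10']
    refine (runs_group (K := 2) hS3 h8 rfl hV3 ?_ ?_ ?_ hdeg hW).mono ?_
    · intro k hk
      obtain rfl : k = 0 := by omega
      rwa [h10']
    · intro k hk
      obtain rfl : k = 0 := by omega
      rwa [h10']
    · exact fun v hv hvV => hdeg v hv fun h => hvV (Finset.mem_union_left _ h)
    · rintro t4 τ4 _ _ ⟨U, hsub, hU, ht4⟩
      rw [hverts] at hsub ht4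
      have hcard := Finset.card_le_card hsub
      have hr' : (V ∪ {r}).card = V.card + 1 := by
        rw [Finset.union_comm, ← Finset.insert_eq, Finset.card_insert_of_notMem hrV]
      exact ⟨U, Finset.union_subset_left hsub, hsub (by simp), hU, by omega⟩
  · simp only [Test.Holds, h11, hS1.r2] at hb
    have hrV : r ∈ V := by
      by_contra h
      exact hb (if_neg h)
    exact Runs.instr trivial ⟨V, subset_rfl, hrV, hV1.congr rfl rfl, by omega⟩

/-- The first group visits all vertices of degree at least three, so the loop over all vertices
meets only the easy components. Its time telescopes, since each vertex becomes visited only once. -/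
theorem runs_program (hL : Loaded N σ) (hn : 1 ≤ N.n) (hK : ∀ v < N.n, (N.adj v).length ≤ K)
    {p : ℕ} (hp : ((Finset.range N.n).filter fun v => 3 ≤ (N.adj v).length).card = p)
    (hW : 3 * N.n + 2 * N.m ≤ W) :
    Runs W program σ fun t τ =>
      t ≤ (K + 2) ^ p * ((22 * K + 65) * p + 114 * N.n + 45) + 639 * N.n + 24 * N.m + 19 ∧
      ∃ I, N.MaxIndep (N.els (Finset.range N.n)) I ∧
        (∀ v < N.n, v ∈ I ↔ τ.iarr 2 v = 1) ∧ ∀ j < N.m, N.n + j ∈ I ↔ τ.iarr 3 j = 1 := by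
  set X := (Finset.range N.n).filter fun v => 3 ≤ (N.adj v).length with hX
  refine (runs_setup hL hn hW).seq ?_
  rintro t1 τ1 hfr1 _ ⟨ht1, hS1, hz, h9, h14⟩
  refine (runs_findBranching hS1 hz (by omega)).seq ?_
  rintro t2 τ2 hfr2 _ ⟨ht2, h8, hverts⟩
  rw [hp] at h8
  rw [h8, ← hX] at hverts
  have hS2 : Static N τ2 := hS1.frame hfr2 (by decide)
  have hV2 : Solved N ∅ τ2 := by
    have g9 := hfr2.iarr 9 (by decide)
    have g14 := hfr2.iarr 14 (by decide)
    refine ⟨fun v => by simp [g9, h9], by simp, by simp [Net.Closed],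
      ⟨by simp [sol, Net.els], by simp [sol, Net.els, Net.Indep], fun J hJ _ => ?_⟩,
      fun i _ _ => by rw [g14, h14]⟩
    simp only [Net.els, Finset.biUnion_empty, Finset.subset_empty] at hJ
    simp [hJ, sol, Net.els]
  have hxX : ∀ k < p, τ2.iarr 10 k ∈ X := fun k hk => by
    rw [← hverts]
    exact Finset.mem_image_of_mem _ (Finset.mem_range.2 hk)
  refine (runs_group (K := K) hS2 h8 rfl hV2
    (fun k hk => Finset.mem_range.1 (Finset.mem_filter.1 (hxX k hk)).1) (by simp) ?_
    (fun v hv _ => hK v hv) (by omega)).seq ?_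
  · intro v hv hvX
    rw [hverts, Finset.empty_union, Finset.mem_filter, Finset.mem_range] at hvX
    by_contra h
    exact hvX ⟨hv, by omega⟩
  rintro t3 τ3 hfr3 _ ⟨U, hXU, hU, ht3⟩
  rw [hverts, Finset.empty_union] at hXU ht3
  have hS3 : Static N τ3 := hS2.frame hfr3 (by decide)
  refine (Runs.forUp_time (W := W) (L := N.n) (fun k T τ => ∃ V, U ⊆ V ∧ Solved N V τ ∧
    (∀ r < k, r ∈ V) ∧ T ≤ 616 * V.card + 5 * k) hS3.r3 hS3.r0 (by decide) ?_
    ⟨U, subset_rfl, hU, by omega, by omega⟩ ?_).seq ?_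
  · rintro k T τ x ⟨V, h1, h2, h3⟩
    exact ⟨V, h1, h2.congr rfl rfl, h3⟩
  · rintro k T τ hk hfr _ hi ⟨V, h1, h2, h3, h4⟩
    refine (runs_component (hS3.frame hfr (by decide)) h2 hi hk ?_ (by omega)).mono ?_
    · intro v hv hvV
      by_contra h
      exact hvV (h1 (hXU (Finset.mem_filter.2 ⟨Finset.mem_range.2 hv, by omega⟩)))
    · rintro t τ' _ _ ⟨V', hsub, hkV, hV', ht⟩
      refine ⟨V', h1.trans hsub, hV', fun r hr => ?_, by omega⟩
      rcases Nat.lt_succ_iff_lt_or_eq.1 hr with h | rfl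
      · exact hsub (h3 r h)
      · exact hkV
  rintro t4 τ4 hfr4 _ ⟨T, ht4, V, _, hV, hall, hT⟩
  have hS4 : Static N τ4 := hS3.frame hfr4 (by decide)
  refine (runs_output hS4 (by omega)).mono ?_
  rintro t5 τ5 _ _ ⟨ht5, h14', hv, he⟩
  obtain rfl : V = Finset.range N.n := by
    ext v
    rw [Finset.mem_range]
    exact ⟨hV.lt v, hall v⟩
  refine ⟨?_, _, hV.maxIndep, fun v hvn => ?_, fun j hj => ?_⟩
  · have hg := hU.card_le
    have hVc : (Finset.range N.n).card = N.n := Finset.card_range _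
    have : (K + 2) ^ p * ((22 * K + 65) * p + 114 * (U.card - X.card) + 45) ≤
        (K + 2) ^ p * ((22 * K + 65) * p + 114 * N.n + 45) :=
      Nat.mul_le_mul_left _ (by omega)
    omega
  · rw [hv v hvn, sol, Finset.mem_filter, and_iff_right]
    exact Net.mem_els.2 ⟨v, Finset.mem_range.2 hvn, N.self_mem_star v⟩
  · rw [he j hj, sol, Finset.mem_filter, and_iff_right]
    obtain ⟨h1, _, h3⟩ := Net.exists_adj_eid hj
    exact Net.mem_els.2 ⟨N.fst j, Finset.mem_range.2 (N.fst_lt j hj), h3 ▸ Net.eid_mem_star h1⟩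

end Algo

end RealRAM

namespace SimpleGraph

open scoped Classical

variable {V : Type*} [Fintype V] (G : SimpleGraph V)

/-! ### Subdeterminants and degrees -/

/-- The submatrix on `I` and all edges has the identity as its edge block, so its determinant is
that of the Schur complement `1 - B * B.transpose`. Diagonal entries of `B * B.transpose` count
incident edges; the others vanish, as an edge through two vertices of `I` would join them. The
absolute value is taken over the integers, so that isolated vertices contribute the factor one. -/
theorem prod_degree_sub_one_le_maxSubdet {I : Finset V} (hI : ∀ u ∈ I, ∀ v ∈ I, ¬ G.Adj u v) :
    ∏ v ∈ I, ((G.degree v : ℤ) - 1).natAbs ≤ G.maxSubdet := by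
  set B : Matrix I G.edgeSet ℤ := G.vertexEdgeMatrix.submatrix Subtype.val id with hB
  have hBB : 1 - B * B.transpose = Matrix.diagonal fun v : I => 1 - (G.degree v : ℤ) := by
    ext u v
    have hentry : (B * B.transpose) u v = if u = v then (G.degree v : ℤ) else 0 := by
      simp only [Matrix.mul_apply, Matrix.transpose_apply, hB, Matrix.submatrix_apply,
        vertexEdgeMatrix, Matrix.of_apply, id, mul_ite, mul_one, mul_zero, ← ite_and]
      rw [Finset.sum_boole]
      split_ifs with huv
      · subst huv
        rw [← card_incidenceFinset_eq_degree]
        congr 1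
        refine Finset.card_bij (fun e _ => (e : Sym2 V)) ?_ (fun e _ f _ h => Subtype.ext h) ?_
        · intro e he
          rw [mem_incidenceFinset]
          exact ⟨e.2, (Finset.mem_filter.1 he).2.1⟩
        · intro e he
          rw [mem_incidenceFinset] at he
          exact ⟨⟨e, he.1⟩, by simp [he.2], rfl⟩
      · rw [Nat.cast_eq_zero, Finset.card_eq_zero, Finset.filter_eq_empty_iff]
        rintro ⟨e, he⟩ _ ⟨h1, h2⟩
        have huv' : (u : V) ≠ v := fun h => huv (Subtype.ext h)
        have hee : e = s(↑v, ↑u) := (Sym2.mem_and_mem_iff huv'.symm).1 ⟨h1, h2⟩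
        rw [hee] at he
        exact hI v v.2 u u.2 he
    rw [Matrix.sub_apply, hentry, Matrix.one_apply, Matrix.diagonal_apply]
    split_ifs with h
    · rw [h]
    · simp
  have hdet : (Matrix.fromBlocks 1 B B.transpose 1).det = ∏ v : I, (1 - (G.degree v : ℤ)) := by
    rw [Matrix.det_fromBlocks_one₂₂, hBB, Matrix.det_diagonal]
  let e := Fintype.equivFin (I ⊕ G.edgeSet)
  let f : Fin (Fintype.card (I ⊕ G.edgeSet)) ↪ V ⊕ G.edgeSet :=
    e.symm.toEmbedding.trans ((Function.Embedding.subtype _).sumMap (Function.Embedding.refl _))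
  have hsub : G.totalMatchingMatrix.submatrix f f =
      (Matrix.fromBlocks 1 B B.transpose 1).submatrix e.symm e.symm := by
    ext i j
    simp only [Matrix.submatrix_apply, totalMatchingMatrix, f, Function.Embedding.trans_apply,
      Equiv.coe_toEmbedding]
    rcases e.symm i with a | a <;> rcases e.symm j with b | b
    · change (1 : Matrix V V ℤ) a b = (1 : Matrix I I ℤ) a b
      simp [Matrix.one_apply]
    all_goals rfl
  have hmem : (G.totalMatchingMatrix.submatrix f f).det.natAbs ∈ G.subdets := ⟨_, f, f, rfl⟩
  refine le_of_eq_of_le ?_ (G.isGreatest_maxSubdet.2 hmem)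
  rw [hsub, Matrix.det_submatrix_equiv_self, hdet, ← Int.natAbsHom_apply, map_prod,
    ← Finset.prod_coe_sort I fun v => ((G.degree v : ℤ) - 1).natAbs]
  exact Finset.prod_congr rfl fun v _ => by rw [Int.natAbsHom_apply]; omega

theorem degree_le_maxSubdet_add_one (v : V) : G.degree v ≤ G.maxSubdet + 1 := by
  have := G.prod_degree_sub_one_le_maxSubdet (I := {v}) (by simp)
  rw [Finset.prod_singleton] at this
  omega

/-- Two numbers that are at least two satisfy a + b ≤ a * b. -/
theorem _root_.Finset.sum_le_prod_of_two_le {ι : Type*} (s : Finset ι) (f : ι → ℕ)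
    (h : ∀ i ∈ s, 2 ≤ f i) : ∑ i ∈ s, f i ≤ ∏ i ∈ s, f i := by
  induction s using Finset.induction_on with
  | empty => simp
  | insert a s ha ih =>
    rw [Finset.sum_insert ha, Finset.prod_insert ha]
    have h1 := h a (Finset.mem_insert_self _ _)
    have h2 := ih fun i hi => h i (Finset.mem_insert_of_mem hi)
    rcases s.eq_empty_or_nonempty with rfl | ⟨b, hb⟩
    · simp
    · have h3 : 2 ≤ ∑ i ∈ s, f i := (h b (Finset.mem_insert_of_mem hb)).trans
        (Finset.single_le_sum (fun _ _ => Nat.zero_le _) hb)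
      nlinarith

/-- The vertices of degree at least three. -/
noncomputable def branching : Finset V := Finset.univ.filter fun v => 3 ≤ G.degree v

/-- A stable subset of `X` of maximum size dominates `X`, since an undominated vertex could be added
to it; hence closed neighbourhoods of its members cover `X`. -/
theorem exists_stable_card_le (X : Finset V) : ∃ I ⊆ X, (∀ u ∈ I, ∀ v ∈ I, ¬ G.Adj u v) ∧
    X.card ≤ ∑ v ∈ I, (G.degree v + 1) := by
  obtain ⟨I, hI, hmax⟩ := (X.powerset.filter fun I => ∀ u ∈ I, ∀ v ∈ I, ¬ G.Adj u v).exists_max_image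
    Finset.card ⟨∅, by simp⟩
  rw [Finset.mem_filter, Finset.mem_powerset] at hI
  refine ⟨I, hI.1, hI.2, ?_⟩
  have hcover : X ⊆ I.biUnion fun v => insert v (G.neighborFinset v) := by
    intro x hx
    rw [Finset.mem_biUnion]
    by_contra! h
    have hxI : x ∉ I := fun hxI => h x hxI (Finset.mem_insert_self _ _)
    have hadj : ∀ v ∈ I, ¬ G.Adj v x := fun v hv hvx => h v hv
      (Finset.mem_insert_of_mem ((G.mem_neighborFinset _ _).2 hvx))
    have := hmax (insert x I) (by
      rw [Finset.mem_filter, Finset.mem_powerset]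
      refine ⟨Finset.insert_subset hx hI.1, fun u hu v hv huv => ?_⟩
      rcases Finset.mem_insert.1 hu with rfl | hu' <;>
        rcases Finset.mem_insert.1 hv with rfl | hv'
      · exact huv.ne rfl
      · exact hadj v hv' huv.symm
      · exact hadj u hu' huv
      · exact hI.2 u hu' v hv' huv)
    rw [Finset.card_insert_of_notMem hxI] at this
    omega
  refine (Finset.card_le_card hcover).trans (Finset.card_biUnion_le.trans ?_)
  exact Finset.sum_le_sum fun v _ => (Finset.card_insert_le _ _).trans
    (by rw [card_neighborFinset_eq_degree])

/-- From degree three on, deg + 1 ≤ 2 * (deg - 1) and each factor deg - 1 is at least two, so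
domination, the comparison of sum and product, and the determinant bound combine. The second part is
needed for Δ = 1, where the exponential factor in the time bound is one. -/
theorem card_branching_le : G.branching.card ≤ 2 * G.maxSubdet ∧
    (G.branching.Nonempty → 2 ≤ G.maxSubdet) := by
  have hdeg : ∀ v ∈ G.branching, 3 ≤ G.degree v := fun v hv => (Finset.mem_filter.1 hv).2
  have hprod : ∀ I ⊆ G.branching, ∏ v ∈ I, ((G.degree v : ℤ) - 1).natAbs =
      ∏ v ∈ I, (G.degree v - 1) := fun I hI => Finset.prod_congr rfl fun v hv => by
    have := hdeg v (hI hv)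
    omega
  constructor
  · obtain ⟨I, hI, hst, hcard⟩ := G.exists_stable_card_le G.branching
    have h1 := G.prod_degree_sub_one_le_maxSubdet hst
    rw [hprod I hI] at h1
    have h2 := I.sum_le_prod_of_two_le (fun v => G.degree v - 1) fun v hv => by
      have := hdeg v (hI hv)
      omega
    have h3 : ∑ v ∈ I, (G.degree v + 1) ≤ ∑ v ∈ I, 2 * (G.degree v - 1) :=
      Finset.sum_le_sum fun v hv => by
        have := hdeg v (hI hv)
        omega
    rw [← Finset.mul_sum] at h3
    omega
  · rintro ⟨v, hv⟩
    have h1 := G.prod_degree_sub_one_le_maxSubdet (I := {v}) (by simp)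
    have := hdeg v hv
    rw [Finset.prod_singleton] at h1
    omega

end SimpleGraph

/-! ### Agreement with the given simple graph -/

namespace Net

variable {N : Net} {u v i j k : ℕ}

theorem edge_mem_star (hj : j < N.m) (hv : v < N.n) :
    N.n + j ∈ N.star v ↔ v = N.fst j ∨ v = N.snd j := by
  obtain ⟨h1, h2, h3⟩ := exists_adj_eid hj
  rw [← h3, eid_mem_star_iff h1 hv, h2]

theorem nbr_iff : N.Nbr u v ↔
    ∃ j < N.m, (N.fst j = u ∧ N.snd j = v) ∨ (N.fst j = v ∧ N.snd j = u) := by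
  constructor
  · rintro ⟨p, hp, rfl⟩
    rw [mem_adj] at hp
    obtain ⟨h1, h2, rfl⟩ := hp
    unfold src tgt
    split_ifs with h
    · exact ⟨p - 1, by omega, Or.inl ⟨rfl, rfl⟩⟩
    · exact ⟨p - N.m - 1, by omega, Or.inr ⟨rfl, rfl⟩⟩
  · rintro ⟨j, hj, ⟨rfl, rfl⟩ | ⟨rfl, rfl⟩⟩
    · exact ⟨j + 1, (exists_adj_eid hj).1, (exists_adj_eid hj).2.1⟩
    · exact Nbr.symm ⟨j + 1, (exists_adj_eid hj).1, (exists_adj_eid hj).2.1⟩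

theorem nodup_adjTo (hk : k ≤ N.m) : (N.adjTo k v).Nodup := by
  induction k with
  | zero => simp [adjTo]
  | succ k ih =>
    have h := ih (by omega)
    have hold : ∀ p ∈ N.adjTo k v, p ≠ k + 1 ∧ p ≠ N.m + k + 1 := fun p hp => by
      have := N.mem_adjTo.1 hp
      omega
    rw [adjTo_succ (by omega)]
    split_ifs
    · exact List.nodup_cons.2 ⟨fun hp => (hold _ hp).2 rfl, h⟩
    · exact List.nodup_cons.2 ⟨fun hp => (hold _ hp).1 rfl, h⟩
    · exact h

/-- Distinct arcs at `v` have distinct targets, so the list is as long as the neighbourhood is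
large; this transfers the degree bounds to the machine. -/
theorem length_adj (s : Finset ℕ) (hs : ∀ u, u ∈ s ↔ N.Nbr v u) : (N.adj v).length = s.card := by
  have hnd : (N.adj v).Nodup := nodup_adjTo le_rfl
  have : s = ((N.adj v).map N.tgt).toFinset := by
    ext u
    simp [hs, Nbr]
  rw [this, List.toFinset_card_of_nodup, List.length_map]
  exact hnd.map_on fun p hp q hq h => eq_of_tgt_eq hp hq h

end Net

namespace TotalMatchingIO

variable {n m : ℕ} {G : SimpleGraph (Fin n)} {ends : Fin m → Fin n × Fin n}

/-- An edge in the list. -/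
def edge (ends : Fin m → Fin n × Fin n) (j : Fin m) : Sym2 (Fin n) := s((ends j).1, (ends j).2)

theorem IsEdgeList.adj_iff (h : IsEdgeList G ends) {u v : Fin n} :
    G.Adj u v ↔ ∃ j, edge ends j = s(u, v) := by
  rw [← SimpleGraph.mem_edgeSet, ← h.2]
  rfl

/-- The input as a `Net`. -/
noncomputable def toNet (h : IsEdgeList G ends) (wV : Fin n → ℝ) (wE : Sym2 (Fin n) → ℝ) : Net where
  n := n
  m := m
  fst j := if hj : j < m then (ends ⟨j, hj⟩).1 else 0
  snd j := if hj : j < m then (ends ⟨j, hj⟩).2 else 0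
  w i := if hi : i < n then wV ⟨i, hi⟩
    else if hi : i - n < m then wE (edge ends ⟨i - n, hi⟩) else 0
  fst_lt j hj := by rw [dif_pos hj]; exact (ends ⟨j, hj⟩).1.2
  snd_lt j hj := by rw [dif_pos hj]; exact (ends ⟨j, hj⟩).2.2
  ne j hj := by
    rw [dif_pos hj, dif_pos hj]
    intro he
    exact (h.adj_iff.2 ⟨⟨j, hj⟩, rfl⟩).ne (Fin.ext he)
  inj i hi j hj := by
    simp only [dif_pos hi, dif_pos hj, Fin.val_inj]
    intro he
    have := @h.1 ⟨i, hi⟩ ⟨j, hj⟩ (Sym2.eq_iff.2 he)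
    exact congrArg Fin.val this
  w_dummy := by simp

variable (hE : IsEdgeList G ends) (wV : Fin n → ℝ) (wE : Sym2 (Fin n) → ℝ)

theorem toNet_fst (j : Fin m) : (toNet hE wV wE).fst j = (ends j).1 := by
  simp [toNet]

theorem toNet_snd (j : Fin m) : (toNet hE wV wE).snd j = (ends j).2 := by
  simp [toNet]

theorem loaded_input : RealRAM.Loaded (toNet hE wV wE) (input ends wV wE) := by
  constructor
  · rfl
  · rfl
  · rfl
  · intro j (hj : j < m)
    simp [input, toNet, hj]
  · intro j (hj : j < m)
    simp [input, toNet, hj]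
  · intro a ha i
    have h0 : a ≠ 0 := by omega
    have h1 : a ≠ 1 := by omega
    simp [input, h0, h1]
  · intro i (hi : i < n)
    simp [input, toNet, hi]
  · intro j (hj : j < m)
    simp [input, toNet, hj, edge]
  · intro i (hi : n + m ≤ i)
    have h0 : ¬ i < n := by omega
    have h1 : ¬ i - n < m := by omega
    simp [toNet, h0, h1]
  · intro i
    simp [input]
  · rfl

theorem fits_input {W : ℕ} (hW : n + m ≤ W) : (input ends wV wE).Fits W := by
  constructor
  · intro x
    simp only [input]
    split_ifs <;> omega
  · intro a i
    simp only [input]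
    split_ifs with h1 h2 h3
    · have := (ends ⟨i, h1⟩).1.2
      omega
    · have := (ends ⟨i, h1⟩).2.2
      omega
    · omega
    · omega

theorem toNet_nbr {u v : Fin n} : (toNet hE wV wE).Nbr u v ↔ G.Adj u v := by
  rw [Net.nbr_iff, hE.adj_iff]
  constructor
  · rintro ⟨j, hj : j < m, h⟩
    refine ⟨⟨j, hj⟩, ?_⟩
    have h1 := toNet_fst hE wV wE ⟨j, hj⟩
    have h2 := toNet_snd hE wV wE ⟨j, hj⟩
    simp only at h1 h2
    rw [h1, h2] at h
    simp only [Fin.val_inj] at h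
    exact Sym2.eq_iff.2 h
  · rintro ⟨j, h⟩
    refine ⟨j, j.2, ?_⟩
    rw [toNet_fst, toNet_snd]
    simp only [Fin.val_inj]
    exact Sym2.eq_iff.1 h

theorem toNet_edge_mem_star {v : Fin n} {j : Fin m} :
    n + (j : ℕ) ∈ (toNet hE wV wE).star v ↔ v ∈ edge ends j := by
  have := Net.edge_mem_star (N := toNet hE wV wE) (j := j) (v := v) j.2 v.2
  rw [toNet_fst, toNet_snd, Fin.val_inj, Fin.val_inj] at this
  exact this.trans Sym2.mem_iff.symm

open scoped Classical in
theorem length_toNet_adj (v : Fin n) : ((toNet hE wV wE).adj v).length = G.degree v := by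
  rw [Net.length_adj ((G.neighborFinset v).map Fin.valEmbedding), Finset.card_map,
    SimpleGraph.card_neighborFinset_eq_degree]
  intro u
  constructor
  · rw [Finset.mem_map]
    rintro ⟨u, hu, rfl⟩
    exact (toNet_nbr hE wV wE).2 ((G.mem_neighborFinset _ _).1 hu)
  · intro hu
    have hun : u < n := hu.lt_right
    exact Finset.mem_map.2 ⟨⟨u, hun⟩, (G.mem_neighborFinset _ _).2
      ((toNet_nbr hE wV wE (v := ⟨u, hun⟩)).1 hu), rfl⟩

/-- The elements belonging to the vertices in `S` and the edges with indices in `T`. -/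
def elements (S : Finset (Fin n)) (T : Finset (Fin m)) : Finset ℕ :=
  S.image (fun v : Fin n => (v : ℕ)) ∪ T.image (fun j : Fin m => n + (j : ℕ))

theorem vertex_mem_elements {S : Finset (Fin n)} {T : Finset (Fin m)} {v : Fin n} :
    (v : ℕ) ∈ elements S T ↔ v ∈ S := by
  simp only [elements, Finset.mem_union, Finset.mem_image, Fin.val_inj, exists_eq_right, or_iff_left_iff_imp]
  rintro ⟨j, _, h⟩
  have := v.2
  omega

theorem edge_mem_elements {S : Finset (Fin n)} {T : Finset (Fin m)} {j : Fin m} :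
    n + (j : ℕ) ∈ elements S T ↔ j ∈ T := by
  simp only [elements, Finset.mem_union, Finset.mem_image, add_right_inj, Fin.val_inj,
    exists_eq_right, or_iff_right_iff_imp]
  rintro ⟨v, _, h⟩
  have := v.2
  omega

theorem eq_elements {I : Finset ℕ} (hI : ∀ i ∈ I, i < n + m) {S : Finset (Fin n)}
    {T : Finset (Fin m)} (hS : ∀ v : Fin n, (v : ℕ) ∈ I ↔ v ∈ S)
    (hT : ∀ j : Fin m, n + (j : ℕ) ∈ I ↔ j ∈ T) : I = elements S T := by
  have key : ∀ i < n + m, (i ∈ I ↔ i ∈ elements S T) := by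
    intro i hi
    rcases Nat.lt_or_ge i n with h | h
    · rw [show i = ((⟨i, h⟩ : Fin n) : ℕ) from rfl, hS, vertex_mem_elements]
    · obtain ⟨j, rfl⟩ := Nat.exists_eq_add_of_le h
      rw [show j = ((⟨j, by omega⟩ : Fin m) : ℕ) from rfl, hT, edge_mem_elements]
  ext i
  by_cases hi : i < n + m
  · exact key i hi
  · refine iff_of_false (fun h => hi (hI i h)) fun h => hi ?_
    simp only [elements, Finset.mem_union, Finset.mem_image] at h
    rcases h with ⟨v, _, rfl⟩ | ⟨j, _, rfl⟩
    · have := v.2; omega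
    · have := j.2; omega

theorem sum_elements (S : Finset (Fin n)) (T : Finset (Fin m)) :
    ∑ i ∈ elements S T, (toNet hE wV wE).w i =
      SimpleGraph.totalWeight wV wE S (T.image (edge ends)) := by
  have hdis : Disjoint (S.image (fun v : Fin n => (v : ℕ))) (T.image (fun j : Fin m => n + (j : ℕ))) := by
    rw [Finset.disjoint_left]
    intro i h1 h2
    obtain ⟨v, _, rfl⟩ := Finset.mem_image.1 h1
    obtain ⟨j, _, h⟩ := Finset.mem_image.1 h2
    have := v.2
    omega
  have hinj : Function.Injective (edge ends) := hE.1
  rw [elements, Finset.sum_union hdis, Finset.sum_image (fun u _ v _ h => Fin.ext h),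
    Finset.sum_image (fun i _ j _ h => Fin.ext (by simpa using h)), SimpleGraph.totalWeight,
    Finset.sum_image (fun i _ j _ h => hinj h)]
  congr 1
  · exact Finset.sum_congr rfl fun v _ => by simp [toNet]
  · exact Finset.sum_congr rfl fun j _ => by simp [toNet]

/-- Two vertices conflict when adjacent, a vertex and an edge when incident, and two edges when they
share an endpoint; for distinct elements these are the prohibitions in `IsTotalMatching`. -/
theorem indep_elements (S : Finset (Fin n)) (T : Finset (Fin m)) :
    (toNet hE wV wE).Indep (elements S T) ↔ G.IsTotalMatching S (T.image (edge ends)) := by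
  have hinj : Function.Injective (edge ends) := hE.1
  have hn : ∀ v : Fin n, (v : ℕ) < (toNet hE wV wE).n := fun v => v.2
  constructor
  · intro hI
    refine ⟨?_, ?_, ?_, ?_⟩
    · intro e he
      obtain ⟨j, _, rfl⟩ := Finset.mem_image.1 he
      exact hE.adj_iff.2 ⟨j, rfl⟩
    · intro u hu v hv huv
      exact hI u (vertex_mem_elements.2 hu) v (vertex_mem_elements.2 hv)
        (fun h => huv.ne (Fin.ext h)) (Or.inr ((toNet_nbr hE wV wE).2 huv))
    · intro e he f hf hef v hv
      obtain ⟨i, hi, rfl⟩ := Finset.mem_image.1 he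
      obtain ⟨j, hj, rfl⟩ := Finset.mem_image.1 hf
      refine hI _ (edge_mem_elements.2 hi) _ (edge_mem_elements.2 hj) (fun h => hef ?_)
        (Or.inl ⟨v, v.2, (toNet_edge_mem_star hE wV wE).2 hv.1,
          (toNet_edge_mem_star hE wV wE).2 hv.2⟩)
      rw [show i = j from Fin.ext (by simpa using h)]
    · intro v hv e he hve
      obtain ⟨j, hj, rfl⟩ := Finset.mem_image.1 he
      exact hI v (vertex_mem_elements.2 hv) _ (edge_mem_elements.2 hj)
        (fun h => by have := v.2; omega)
        (Or.inl ⟨v, v.2, Net.self_mem_star _ _, (toNet_edge_mem_star hE wV wE).2 hve⟩)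
  · intro hM
    have hve : ∀ v ∈ S, ∀ j ∈ T, ¬ (toNet hE wV wE).Conf (v : ℕ) (n + (j : ℕ)) := by
      intro v hv j hj hc
      rcases (Net.conf_vertex (hn v)).1 hc with h | h
      · exact hM.nonincident v hv _ (Finset.mem_image_of_mem _ hj)
          ((toNet_edge_mem_star hE wV wE).1 h)
      · have : n + (j : ℕ) < n := h.lt_right
        omega
    intro a ha b hb hab hc
    simp only [elements, Finset.mem_union, Finset.mem_image] at ha hb
    rcases ha with ⟨u, hu, rfl⟩ | ⟨i, hi, rfl⟩ <;> rcases hb with ⟨v, hv, rfl⟩ | ⟨j, hj, rfl⟩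
    · rcases (Net.conf_vertex (hn u)).1 hc with h | h
      · exact hab ((Net.mem_star_of_lt (hn v)).1 h).symm
      · exact hM.stable u hu v hv ((toNet_nbr hE wV wE).1 h)
    · exact hve u hu j hj hc
    · exact hve v hv i hi hc.symm
    · rcases hc with ⟨v, hv, h1, h2⟩ | h
      · exact hM.matching _ (Finset.mem_image_of_mem _ hi) _ (Finset.mem_image_of_mem _ hj)
          (fun h => hab (by rw [hinj h])) ⟨v, hv⟩
          ⟨(toNet_edge_mem_star hE wV wE).1 h1, (toNet_edge_mem_star hE wV wE).1 h2⟩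
      · have : n + (i : ℕ) < n := h.lt_left
        omega

theorem elements_subset (S : Finset (Fin n)) (T : Finset (Fin m)) :
    elements S T ⊆ (toNet hE wV wE).els (Finset.range n) := by
  intro i hi
  simp only [elements, Finset.mem_union, Finset.mem_image] at hi
  rcases hi with ⟨v, _, rfl⟩ | ⟨j, _, rfl⟩
  · exact Net.mem_els.2 ⟨v, Finset.mem_range.2 v.2, Net.self_mem_star _ _⟩
  · exact Net.mem_els.2 ⟨(ends j).1, Finset.mem_range.2 (ends j).1.2,
      (toNet_edge_mem_star hE wV wE).2 (by simp [edge])⟩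

theorem isMaxWeightTotalMatching_of_maxIndep {I : Finset ℕ}
    (hI : (toNet hE wV wE).MaxIndep ((toNet hE wV wE).els (Finset.range n)) I)
    {S : Finset (Fin n)} {T : Finset (Fin m)} (hS : ∀ v : Fin n, (v : ℕ) ∈ I ↔ v ∈ S)
    (hT : ∀ j : Fin m, n + (j : ℕ) ∈ I ↔ j ∈ T) :
    G.IsMaxWeightTotalMatching wV wE S (T.image (edge ends)) := by
  have hlt : ∀ i ∈ I, i < n + m := fun i hi => by
    obtain ⟨v, hv, hi⟩ := Net.mem_els.1 (hI.subset hi)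
    exact Net.lt_of_mem_star (N := toNet hE wV wE) (Finset.mem_range.1 hv) hi
  obtain rfl := eq_elements hlt hS hT
  refine ⟨(indep_elements hE wV wE S T).1 hI.indep, fun S' F' h' => ?_⟩
  -- A competitor consists of edges of `G`, all of which are listed, so it is given by a set of
  -- indices.
  obtain ⟨T', rfl⟩ : ∃ T' : Finset (Fin m), T'.image (edge ends) = F' := by
    refine ⟨Finset.univ.filter fun j => edge ends j ∈ F', ?_⟩
    ext e
    rw [Finset.mem_image]
    constructor
    · rintro ⟨j, hj, rfl⟩
      exact (Finset.mem_filter.1 hj).2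
    · intro he
      have := h'.edges e he
      rw [← hE.2] at this
      obtain ⟨j, hj⟩ := this
      have hj' : edge ends j = e := hj
      exact ⟨j, by simp [hj', he], hj'⟩
  rw [← sum_elements hE, ← sum_elements hE]
  exact hI.le _ (elements_subset hE wV wE S' T') ((indep_elements hE wV wE S' T').2 h')

end TotalMatchingIO

/-! ### The time bound and the theorem -/

/-- The running time of the algorithm on a graph with maximum subdeterminant at most `d`, where `p`
is the number of branching vertices. -/
theorem time_bound {d n m p t : ℕ} (hd : 1 ≤ d) (hn : 1 ≤ n) (hp : p ≤ 2 * d)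
    (hp' : p ≠ 0 → 2 ≤ d)
    (ht : t ≤ (d + 1 + 2) ^ p * ((22 * (d + 1) + 65) * p + 114 * n + 45) + 639 * n + 24 * m + 19) :
    (t : ℝ) ≤ ((1000 : ℕ) : ℝ) * (2 : ℝ) ^ (((16 : ℕ) : ℝ) * ((d : ℝ) * Real.log (d : ℝ))) *
      ((n : ℝ) + (m : ℝ)) := by
  -- The logarithm is natural, so the left side is exp (8 * d * log d); the constant 16 suffices
  -- because 16 * log 2 > 8.
  have hpow : (d : ℝ) ^ (8 * d) ≤ (2 : ℝ) ^ (((16 : ℕ) : ℝ) * ((d : ℝ) * Real.log (d : ℝ))) := by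
    have hd0 : (0 : ℝ) < d := by exact_mod_cast hd
    have hlog : 0 ≤ Real.log (d : ℝ) := Real.log_natCast_nonneg d
    rw [← Real.rpow_natCast, Real.rpow_def_of_pos hd0, Real.rpow_def_of_pos two_pos]
    refine Real.exp_le_exp.2 ?_
    have h2 := Real.log_two_gt_d9
    have h3 : 0 ≤ (d : ℝ) * Real.log (d : ℝ) := mul_nonneg hd0.le hlog
    push_cast
    nlinarith
  have hmain : t ≤ 1000 * d ^ (8 * d) * (n + m) := by
    -- For `d = 1` the logarithm vanishes and no exponential factor is available, but then there are
    -- no branching vertices.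
    rcases Nat.lt_or_ge d 2 with h | h
    · obtain rfl : d = 1 := by omega
      obtain rfl : p = 0 := by
        by_contra h0
        exact absurd (hp' h0) (by omega)
      simp only [pow_zero, one_pow] at ht ⊢
      omega
    -- For `d ≥ 2` one has d + 3 ≤ d ^ 3, and 3 * p ≤ 6 * d. The remaining polynomial factor `d ^ 2`
    -- is at most `d ^ (2 * d)`, which leads to the exponent `8 * d`.
    · have h1 : (d + 1 + 2) ^ p ≤ d ^ (6 * d) := calc
        (d + 1 + 2) ^ p ≤ (d ^ 3) ^ p := Nat.pow_le_pow_left (by nlinarith [Nat.mul_le_mul h h]) p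
        _ = d ^ (3 * p) := (pow_mul _ _ _).symm
        _ ≤ d ^ (6 * d) := Nat.pow_le_pow_right (by omega) (by omega)
      have h2 : (22 * (d + 1) + 65) * p + 114 * n + 45 + 639 * n + 24 * m + 19 ≤
          1000 * d ^ 2 * (n + m) := by
        have h3 : (22 * (d + 1) + 65) * p ≤ (22 * (d + 1) + 65) * (2 * d) :=
          Nat.mul_le_mul_left _ hp
        have h4 : 4 ≤ d ^ 2 := by nlinarith
        have h5 : 2 * d ≤ d ^ 2 := by nlinarith
        have h6 : (22 * (d + 1) + 65) * (2 * d) ≤ 131 * d ^ 2 := by nlinarith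
        have h7 : d ^ 2 ≤ d ^ 2 * n := Nat.le_mul_of_pos_right _ hn
        have h8 : 4 * n ≤ d ^ 2 * n := Nat.mul_le_mul_right _ h4
        have h9 : 4 * m ≤ d ^ 2 * m := Nat.mul_le_mul_right _ h4
        have h10 : 1000 * d ^ 2 * (n + m) = 1000 * (d ^ 2 * n) + 1000 * (d ^ 2 * m) := by ring
        omega
      have h3 : 1 ≤ d ^ (6 * d) := Nat.one_le_pow _ _ (by omega)
      calc t ≤ (d + 1 + 2) ^ p * ((22 * (d + 1) + 65) * p + 114 * n + 45) +
            639 * n + 24 * m + 19 := ht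
        _ ≤ d ^ (6 * d) * ((22 * (d + 1) + 65) * p + 114 * n + 45) +
            d ^ (6 * d) * (639 * n + 24 * m + 19) := by
          have := Nat.mul_le_mul_right ((22 * (d + 1) + 65) * p + 114 * n + 45) h1
          have := Nat.le_mul_of_pos_left (639 * n + 24 * m + 19) h3
          omega
        _ = d ^ (6 * d) *
            ((22 * (d + 1) + 65) * p + 114 * n + 45 + 639 * n + 24 * m + 19) := by ring
        _ ≤ d ^ (6 * d) * (1000 * d ^ 2 * (n + m)) := Nat.mul_le_mul_left _ h2
        _ = 1000 * d ^ (6 * d + 2) * (n + m) := by ring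
        _ ≤ 1000 * d ^ (8 * d) * (n + m) :=
          Nat.mul_le_mul_right _ (Nat.mul_le_mul_left _
            (Nat.pow_le_pow_right (by omega) (by omega)))
  calc (t : ℝ) ≤ ((1000 * d ^ (8 * d) * (n + m) : ℕ) : ℝ) := by exact_mod_cast hmain
    _ = ((1000 : ℕ) : ℝ) * (d : ℝ) ^ (8 * d) * ((n : ℝ) + (m : ℝ)) := by push_cast; ring
    _ ≤ _ := by gcongr

/-- One program finds maximum-weight total matchings; for every `Δ ≥ 1` its running time on nonempty
graphs `G` with maximum subdeterminant at most `Δ` is at most `C 2 ^ (c Δ log Δ) (|V| + |E|)`, with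
`C` and `c` absolute constants, and it only uses integers of size at most `C (|V| + |E|)`. -/
theorem mainTheorem1 :
    ∃ (P : RealRAM.Program) (C c : ℕ), ∀ Δ : ℕ, 1 ≤ Δ →
      ∀ (n m : ℕ) (G : SimpleGraph (Fin n)) (ends : Fin m → Fin n × Fin n)
        (wV : Fin n → ℝ) (wE : Sym2 (Fin n) → ℝ),
        1 ≤ n → TotalMatchingIO.IsEdgeList G ends → G.maxSubdet ≤ Δ →
        ∃ (t : ℕ) (τ : RealRAM.State),
          RealRAM.Exec (C * (n + m)) P (TotalMatchingIO.input ends wV wE) t τ ∧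
          (t : ℝ) ≤ (C : ℝ) * (2 : ℝ) ^ ((c : ℝ) * ((Δ : ℝ) * Real.log (Δ : ℝ))) *
            ((n : ℝ) + (m : ℝ)) ∧
          G.IsMaxWeightTotalMatching wV wE (TotalMatchingIO.outVertices n τ)
            (TotalMatchingIO.outEdges ends τ) := by
  classical
  -- The constant 1000 comes from the time bound; as a bound on integers it is generous, since `3 *
  -- n + 2 * m` is enough.
  refine ⟨RealRAM.Algo.program, 1000, 16, fun d hd n m G ends wV wE hn hE hG => ?_⟩
  have hdeg := TotalMatchingIO.length_toNet_adj hE wV wE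
  have hcard : ((Finset.range n).filter fun v =>
      3 ≤ ((TotalMatchingIO.toNet hE wV wE).adj v).length).card = G.branching.card := by
    rw [← Finset.card_map Fin.valEmbedding]
    congr 1
    ext v
    rw [Finset.mem_filter, Finset.mem_range, Finset.mem_map]
    constructor
    · rintro ⟨hv, h⟩
      exact ⟨⟨v, hv⟩, Finset.mem_filter.2 ⟨Finset.mem_univ _, hdeg ⟨v, hv⟩ ▸ h⟩, rfl⟩
    · rintro ⟨v, hv, rfl⟩
      exact ⟨v.2, (hdeg v).symm ▸ (Finset.mem_filter.1 hv).2⟩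
  have hX := G.card_branching_le
  obtain ⟨t, τ, hrun, ht, I, hI, hS, hT⟩ := RealRAM.Algo.runs_program (W := 1000 * (n + m))
    (K := d + 1) (TotalMatchingIO.loaded_input hE wV wE) hn
    (fun v hv => by
      have := G.degree_le_maxSubdet_add_one ⟨v, hv⟩
      have := hdeg ⟨v, hv⟩
      simp only at this
      omega)
    hcard (show 3 * n + 2 * m ≤ 1000 * (n + m) by omega)
    (TotalMatchingIO.fits_input wV wE (by omega))
  refine ⟨t, τ, hrun, time_bound hd hn (by omega) (fun h => ?_) ht, ?_⟩
  · exact (hX.2 (Finset.card_pos.1 (Nat.pos_of_ne_zero h))).trans hG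
  · exact TotalMatchingIO.isMaxWeightTotalMatching_of_maxIndep hE wV wE hI
      (fun v => by simp [hS v v.2, TotalMatchingIO.outVertices])
      (T := Finset.univ.filter fun j : Fin m => τ.iarr 3 j = 1)
      (fun j => (hT j j.2).trans (by simp))
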